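/- **Setting.** Let $N\ge 1$. Fix an even $\phi_0\in\mathcal S(\mathbb R^N;\mathbb R)$ with $\phi_0>0$ on $\{3/4<|\xi|<8/3\}$ and $\phi_0=0$ elsewhere, put $\phi_q(\xi)=\phi_0(2^{-q}\xi)$, $\mathcal F\Phi_q=\phi_q/\sum_{j\in\mathbb Z}\phi_j$ for $q\in\mathbb Z$ (with value $0$ at $\xi=0$), and $\mathcal F\Psi=1-\sum_{q\ge 0}\mathcal F\Phi_q$. Let $\dot\Delta_q u=\Phi_q*u$ for $q\in\mathbb Z$, and $\Delta_q u=\Phi_q*u$ for $q\ge 0$, $\Delta_{-1}u=\Psi*u$. For $T\in(0,\infty]$ let $L^\theta_T(L^p)=L^\theta(0,T;L^p(\mathbb R^N))$ and $$\|u\|_{\widetilde L^\theta_T(B^s_{p,r})}=\Big\|\big(2^{qs}\|\Delta_q u\|_{L^\theta_T(L^p)}\big)_{q\ge -1}\Big\|_{\ell^r},\qquad \|u\|_{\widetilde L^\theta_T(\dot B^s_{p,r})}=\Big\|\big(2^{qs}\|\dot\Delta_q u\|_{L^\theta_T(L^p)}\big)_{q\in\mathbb Z}\Big\|_{\ell^r}.$$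 All norms take values in $[0,\infty]$, with $0\cdot\infty=0$. Write $[s]$ for the integer part of $s$, and $\|h\|_{W^{k,\infty}(U)}=\sum_{m\le k}\|h^{(m)}\|_{L^\infty(U)}$ with weak derivatives ($+\infty$ if one of them does not exist). **Proposition 5.1.** Let $s>0$ and $1\le p,r,\theta,\theta_1,\theta_2,\theta_3,\theta_4\le\infty$ with $$\frac1\theta=\frac1{\theta_1}+\frac1{\theta_2}=\frac1{\theta_3}+\frac1{\theta_4}.$$ There is a constant $C$, depending only on $N,s,p,r,\theta,\theta_1,\dots,\theta_4$ and $\phi_0$, such that the following holds. Let $T\in(0,\infty]$, let $I\subseteq\mathbb R$ be an open interval containing $0$, let $F:I\to\mathbb R$ be twice differentiable with $F''\in W^{[s]+1,\infty}_{loc}(I)$ and $F'(0)=0$, let $J\subseteq I$ be an interval containing $0$, and let $f,g\in L^\infty_T(L^\infty)$ be real-valued with values in $J$ almost everywhere. Then $$\begin{aligned}\|F(f)-F(g)\|_{\widetilde L^\theta_T(B^s_{p,r})}\le{}& C\,\big(1+\|f\|_{L^\infty_T(L^\infty)}+\|g\|_{L^\infty_T(L^\infty)}\big)^{[s]+1}\,\|F''\|_{W^{[s]+1,\infty}(\mathrm{int}\,J)}\\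 &\times\Big(\|f-g\|_{L^{\theta_1}_T(L^\infty)}\sup_{\kappa\in[0,1]}\|g+\kappa(f-g)\|_{\widetilde L^{\theta_2}_T(B^s_{p,r})}\\ &\qquad+\|f-g\|_{\widetilde L^{\theta_4}_T(B^s_{p,r})}\sup_{\kappa\in[0,1]}\|g+\kappa(f-g)\|_{L^{\theta_3}_T(L^\infty)}\Big).\end{aligned}$$ **Proposition 5.2.** If in addition $s<N/p$, or $s=N/p$ and $r=1$, then the same statement holds with $\dot B^s_{p,r}$ in place of $B^s_{p,r}$ throughout. -/

import Mathlib

open MeasureTheory SchwartzMap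
open scoped ENNReal NNReal FourierTransform

/-! ### Weak derivatives and the spaces `W^{k,∞}` on open subsets of the line -/

/-- `v` is the weak derivative of order `m` of `u` on the open set `U ⊆ ℝ`: both are locally
integrable on `U`, and `∫ u φ⁽ᵐ⁾ = (-1)ᵐ ∫ v φ` for every test function `φ ∈ C_c^∞(U)`. -/
def HasWeakDerivOn (m : ℕ) (U : Set ℝ) (u v : ℝ → ℝ) : Prop :=
  LocallyIntegrableOn u U ∧ LocallyIntegrableOn v U ∧
    ∀ φ : ℝ → ℝ, ContDiff ℝ ((⊤ : ℕ∞) : WithTop ℕ∞) φ → HasCompactSupport φ → tsupport φ ⊆ U →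
      ∫ x, u x * iteratedDeriv m φ x = (-1) ^ m * ∫ x, v x * φ x

/-- `u ∈ W^{k,∞}_loc(U)`: the weak derivatives of `u` of order at most `k` exist on `U` and are
essentially bounded on every compact subset of `U`. -/
def MemSobolevInftyLoc (k : ℕ) (U : Set ℝ) (u : ℝ → ℝ) : Prop :=
  ∀ m ≤ k, ∃ v : ℝ → ℝ, HasWeakDerivOn m U u v ∧
    ∀ K ⊆ U, IsCompact K → MemLp v ∞ (volume.restrict K)

/-- The norm `‖u‖_{W^{k,∞}(U)} = ∑_{m ≤ k} ‖u⁽ᵐ⁾‖_{L^∞(U)}`, with values in `[0,∞]`. Weak derivatives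
being unique up to null sets, the infimum is over at most one class of functions; it is `∞` if the
weak derivative does not exist. -/
noncomputable def sobolevInftyNorm (k : ℕ) (U : Set ℝ) (u : ℝ → ℝ) : ℝ≥0∞ :=
  ∑ m ∈ Finset.range (k + 1),
    ⨅ (v : ℝ → ℝ) (_ : HasWeakDerivOn m U u v), eLpNorm v ∞ (volume.restrict U)

/-! ### Littlewood-Paley decomposition of `ℝ^N` -/

/-- The generating function `φ₀` of a dyadic partition: an even Schwartz function which is positive
in the annulus `3/4 < |ξ| < 8/3` and vanishes outside it, so that its support is the closed
annulus. -/
structure IsDyadicGenerator {N : ℕ} (φ₀ : 𝓢(EuclideanSpace ℝ (Fin N), ℝ)) : Prop where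
  even : ∀ ξ, φ₀ (-ξ) = φ₀ ξ
  pos : ∀ ξ, 3 / 4 < ‖ξ‖ → ‖ξ‖ < 8 / 3 → 0 < φ₀ ξ
  zero : ∀ ξ, ‖ξ‖ ≤ 3 / 4 ∨ 8 / 3 ≤ ‖ξ‖ → φ₀ ξ = 0

/-- The Fourier transform of `Φ_q`, that is `φ_q / ∑_j φ_j` with `φ_q(ξ) = φ₀(2^{-q} ξ)`
(at `ξ = 0` all `φ_q` vanish, and the value is `0`). -/
noncomputable def dyadicSymbol {N : ℕ} (φ₀ : 𝓢(EuclideanSpace ℝ (Fin N), ℝ)) (q : ℤ)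
    (ξ : EuclideanSpace ℝ (Fin N)) : ℝ :=
  φ₀ ((2 : ℝ) ^ (-q) • ξ) / ∑' j : ℤ, φ₀ ((2 : ℝ) ^ (-j) • ξ)

/-- The Fourier transform of `Ψ`, that is `1 - ∑_{q ≥ 0} 𝓕 Φ_q`. -/
noncomputable def lowSymbol {N : ℕ} (φ₀ : 𝓢(EuclideanSpace ℝ (Fin N), ℝ))
    (ξ : EuclideanSpace ℝ (Fin N)) : ℝ :=
  1 - ∑' q : ℕ, dyadicSymbol φ₀ (q : ℤ) ξ

/-- The function `Φ_q`, the inverse Fourier transform of its symbol. -/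
noncomputable def dyadicKernel {N : ℕ} (φ₀ : 𝓢(EuclideanSpace ℝ (Fin N), ℝ)) (q : ℤ) :
    EuclideanSpace ℝ (Fin N) → ℂ :=
  𝓕⁻ (fun ξ : EuclideanSpace ℝ (Fin N) => (dyadicSymbol φ₀ q ξ : ℂ))

/-- The function `Ψ`, the inverse Fourier transform of its symbol. -/
noncomputable def lowKernel {N : ℕ} (φ₀ : 𝓢(EuclideanSpace ℝ (Fin N), ℝ)) :
    EuclideanSpace ℝ (Fin N) → ℂ :=
  𝓕⁻ (fun ξ : EuclideanSpace ℝ (Fin N) => (lowSymbol φ₀ ξ : ℂ))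

/-- The convolution `(K * u)(x) = ∫ K(x - y) u(y) dy`. It is used for `K` in the Schwartz class and
`u` bounded, when it agrees with the convolution of `K` and the tempered distribution `u`. -/
noncomputable def kernelConv {N : ℕ} (K : EuclideanSpace ℝ (Fin N) → ℂ)
    (u : EuclideanSpace ℝ (Fin N) → ℝ) (x : EuclideanSpace ℝ (Fin N)) : ℂ :=
  ∫ y, K (x - y) * (u y : ℂ)

/-- The homogeneous dyadic block `Φ_q * u`, for every integer `q`. -/
noncomputable def homBlock {N : ℕ} (φ₀ : 𝓢(EuclideanSpace ℝ (Fin N), ℝ)) (q : ℤ)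
    (u : EuclideanSpace ℝ (Fin N) → ℝ) : EuclideanSpace ℝ (Fin N) → ℂ :=
  kernelConv (dyadicKernel φ₀ q) u

/-- The inhomogeneous dyadic block: `Φ_q * u` for `q ≥ 0`, `Ψ * u` for `q = -1`, and `0` for
`q ≤ -2`. -/
noncomputable def inhomBlock {N : ℕ} (φ₀ : 𝓢(EuclideanSpace ℝ (Fin N), ℝ)) (q : ℤ)
    (u : EuclideanSpace ℝ (Fin N) → ℝ) : EuclideanSpace ℝ (Fin N) → ℂ :=
  if 0 ≤ q then kernelConv (dyadicKernel φ₀ q) u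
  else if q = -1 then kernelConv (lowKernel φ₀) u
  else 0

/-! ### Mixed norms and Chemin-Lerner norms -/

/-- The time interval `(0, T)`, for `T ∈ (0, ∞]`. -/
def timeInterval (T : ℝ≥0∞) : Set ℝ := {t | 0 < t ∧ ENNReal.ofReal t < T}

/-- The norm of `L^θ(0, T; L^p(ℝ^N))`, with values in `[0,∞]`. -/
noncomputable def mixedNorm {N : ℕ} {F : Type*} [NormedAddCommGroup F] (T θ p : ℝ≥0∞)
    (u : ℝ → EuclideanSpace ℝ (Fin N) → F) : ℝ≥0∞ :=
  eLpNorm (fun t => eLpNorm (u t) p volume) θ (volume.restrict (timeInterval T))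

/-- The `ℓ^r` norm of a family of elements of `[0,∞]` indexed by the integers. -/
noncomputable def seqNorm (r : ℝ≥0∞) (c : ℤ → ℝ≥0∞) : ℝ≥0∞ :=
  if r = ∞ then ⨆ q, c q else (∑' q, c q ^ r.toReal) ^ (1 / r.toReal)

/-- The norm of the inhomogeneous Chemin-Lerner space `L̃^θ_T(B^s_{p,r})`. The blocks with `q ≤ -2`
are zero, so that the sum is over `q ≥ -1`. -/
noncomputable def cheminLernerNorm {N : ℕ} (φ₀ : 𝓢(EuclideanSpace ℝ (Fin N), ℝ)) (T θ : ℝ≥0∞)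
    (s : ℝ) (p r : ℝ≥0∞) (u : ℝ → EuclideanSpace ℝ (Fin N) → ℝ) : ℝ≥0∞ :=
  seqNorm r fun q =>
    ENNReal.ofReal ((2 : ℝ) ^ ((q : ℝ) * s)) * mixedNorm T θ p fun t => inhomBlock φ₀ q (u t)

/-- The norm of the homogeneous Chemin-Lerner space `L̃^θ_T(Ḃ^s_{p,r})`. -/
noncomputable def homCheminLernerNorm {N : ℕ} (φ₀ : 𝓢(EuclideanSpace ℝ (Fin N), ℝ)) (T θ : ℝ≥0∞)
    (s : ℝ) (p r : ℝ≥0∞) (u : ℝ → EuclideanSpace ℝ (Fin N) → ℝ) : ℝ≥0∞ :=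
  seqNorm r fun q =>
    ENNReal.ofReal ((2 : ℝ) ^ ((q : ℝ) * s)) * mixedNorm T θ p fun t => homBlock φ₀ q (u t)

/-- `F` is twice differentiable on the open interval `I ∋ 0`, with `F'(0) = 0` and
`F'' ∈ W^{k,∞}_loc(I)`. -/
structure IsAdmissibleNonlinearity (k : ℕ) (I : Set ℝ) (F : ℝ → ℝ) : Prop where
  isOpen : IsOpen I
  ordConnected : I.OrdConnected
  zero_mem : (0 : ℝ) ∈ I
  differentiable : DifferentiableOn ℝ F I
  differentiable_deriv : DifferentiableOn ℝ (deriv F) I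
  deriv_zero : deriv F 0 = 0
  sobolev : MemSobolevInftyLoc k I (deriv (deriv F))

/-- `u` is a measurable function on `(0, T) × ℝ^N` which belongs to `L^∞(0, T; L^∞(ℝ^N))` and
takes its values, almost everywhere, in `J`. -/
structure IsBoundedWithValuesIn {N : ℕ} (T : ℝ≥0∞) (J : Set ℝ)
    (u : ℝ → EuclideanSpace ℝ (Fin N) → ℝ) : Prop where
  measurable : AEStronglyMeasurable (fun z : ℝ × EuclideanSpace ℝ (Fin N) => u z.1 z.2)
    ((volume.restrict (timeInterval T)).prod volume)
  bounded : mixedNorm T ∞ ∞ u < ∞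
  values : ∀ᵐ z : ℝ × EuclideanSpace ℝ (Fin N)
    ∂((volume.restrict (timeInterval T)).prod volume), u z.1 z.2 ∈ J

/-! ### `L^p` norms of functions with values in `[0,∞]` -/

section ENNRealNorms

variable {α : Type*} [MeasurableSpace α] {μ : Measure α}

/-! The proof is a paradifferential linearization of a difference. Let `A j` be the low-frequency
cut-off at frequency `2^j` and `B j = A (j+1) - A j` the dyadic block. Then `F(f) - F(g)` is the sum
over `j` of the increments of `F(A j f) - F(A j g)`. Put `a_τ = A j f + τ B j f` and `b_τ = A j g +
τ B j g`. The increment is the integral over `τ ∈ [0,1]` of `F'(a_τ) B j (f - g) + (F'(a_τ) -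
F'(b_τ)) B j g`. Since `F'(0) = 0`, a second mean value formula, in `σ ∈ [0,1]`, turns both terms
into averages of products `F''(c) X Y`: here `c` and `X` have frequencies at most about `2^j`, while
the pair `(X, Y)` is `(a_τ, B j (f - g))` or `(a_τ - b_τ, B j g)`.

For such a product, every derivative costs a factor `2^j`. The symbol of the block at frequency
`2^q` vanishes near the origin, so that its kernel is a sum of derivatives of order `K` of
integrable kernels, and `K` derivatives moved onto the product gain `2^{-Kq}`. Hence the block `q`
of the increment `j` is controlled, with the factor `min(1, 2^{-K(q-j)})`, by `‖f‖_∞ ‖B j (f-g)‖_p +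
‖f-g‖_∞ ‖B j g‖_p`. With the weights `2^{qs}` this is a convolution on the integers, whose kernel is
summable exactly because `0 < s < K`, with `K = [s] + 1`. Hölder in time and Young in `ℓ^r`
conclude. The carriers are `exists_conv_le_iteratedFDeriv`, `IsLPFamily.exists_block_bound`,
`IsLPFamily.exists_increment_bound` and `seqNorm_interaction_le`. The homogeneous and inhomogeneous
cases share one proof, through the axioms `IsLPFamily`.

Three points remain. The telescoping series needs continuous functions; bounded ones are reached by
mollification and Fatou's lemma. The cut-offs `A j f` may leave `J`, the kernels having no sign, so
`F` is replaced by nonlinearities defined on the whole line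
(`IsAdmissibleNonlinearity.exists_approx`): derivatives of `F''` are mollified on the interior of
`J`, then extended with polynomial growth. This growth, together with the amplitude of `c` in the
chain rule, produces the power `K` of `1 + ‖f‖_∞ + ‖g‖_∞`. Finally, when the Sobolev norm is
infinite, the convention `0 · ∞ = 0` demands that the left side vanish whenever the last factor
does; this rests on the rigidity of bounded functions without dyadic blocks
(`IsLPFamily.exists_ae_eq_const`). -/

theorem eLpNorm_ennreal_eq_lintegral {p : ℝ≥0∞} (hp : 1 ≤ p) (hp' : p ≠ ∞) (f : α → ℝ≥0∞) :
    eLpNorm f p μ = (∫⁻ x, f x ^ p.toReal ∂μ) ^ (1 / p.toReal) := by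
  simpa using eLpNorm_eq_lintegral_rpow_enorm_toReal (f := f) (μ := μ)
    (zero_lt_one.trans_le hp).ne' hp'

theorem toReal_pos_of_one_le {p : ℝ≥0∞} (hp : 1 ≤ p) (hp' : p ≠ ∞) : 0 < p.toReal :=
  ENNReal.toReal_pos (zero_lt_one.trans_le hp).ne' hp'

theorem eLpNorm_top_ennreal (f : α → ℝ≥0∞) : eLpNorm f ∞ μ = essSup f μ := by
  simp [eLpNormEssSup]

theorem eLpNorm_const_mul_ennreal {p : ℝ≥0∞} (hp : 1 ≤ p) (c : ℝ≥0∞) {f : α → ℝ≥0∞}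
    (hf : AEMeasurable f μ) : eLpNorm (fun x => c * f x) p μ = c * eLpNorm f p μ := by
  by_cases hp' : p = ∞
  · subst hp'
    rw [eLpNorm_top_ennreal, eLpNorm_top_ennreal, ENNReal.essSup_const_mul]
  · have h0 := toReal_pos_of_one_le hp hp'
    rw [eLpNorm_ennreal_eq_lintegral hp hp', eLpNorm_ennreal_eq_lintegral hp hp']
    simp_rw [ENNReal.mul_rpow_of_nonneg _ _ h0.le]
    rw [lintegral_const_mul'' _ (hf.pow_const _), ENNReal.mul_rpow_of_nonneg _ _ (by positivity),
      ← ENNReal.rpow_mul, mul_one_div_cancel h0.ne', ENNReal.rpow_one]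

theorem eLpNorm_mono_ae_ennreal {p : ℝ≥0∞} {f g : α → ℝ≥0∞} (h : ∀ᵐ x ∂μ, f x ≤ g x) :
    eLpNorm f p μ ≤ eLpNorm g p μ :=
  eLpNorm_mono_enorm_ae (by simpa using h)

theorem eLpNorm_mono_ennreal {p : ℝ≥0∞} {f g : α → ℝ≥0∞} (h : ∀ x, f x ≤ g x) :
    eLpNorm f p μ ≤ eLpNorm g p μ :=
  eLpNorm_mono_enorm (by simpa using h)

theorem eLpNorm_add_le_ennreal {p : ℝ≥0∞} (hp : 1 ≤ p) {f g : α → ℝ≥0∞} (hf : AEMeasurable f μ)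
    (hg : AEMeasurable g μ) :
    eLpNorm (fun x => f x + g x) p μ ≤ eLpNorm f p μ + eLpNorm g p μ :=
  eLpNorm_add_le hf.aestronglyMeasurable hg.aestronglyMeasurable hp

theorem eLpNorm_finset_sum_le_ennreal {ι : Type*} {p : ℝ≥0∞} (hp : 1 ≤ p) (s : Finset ι)
    {f : ι → α → ℝ≥0∞} (hf : ∀ i, AEMeasurable (f i) μ) :
    eLpNorm (fun x => ∑ i ∈ s, f i x) p μ ≤ ∑ i ∈ s, eLpNorm (f i) p μ := by
  classical
  induction s using Finset.induction_on with
  | empty => simp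
  | insert a s ha ih =>
    simp_rw [Finset.sum_insert ha]
    refine (eLpNorm_add_le_ennreal hp (hf a) (Finset.aemeasurable_fun_sum s fun i _ => hf i)).trans ?_
    gcongr

/-- Minkowski's inequality for series of functions with values in `[0,∞]`. -/
theorem eLpNorm_tsum_le_ennreal {ι : Type*} [Denumerable ι] {p : ℝ≥0∞} (hp : 1 ≤ p)
    {f : ι → α → ℝ≥0∞} (hf : ∀ i, AEMeasurable (f i) μ) :
    eLpNorm (fun x => ∑' i, f i x) p μ ≤ ∑' i, eLpNorm (f i) p μ := by
  by_cases hp' : p = ∞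
  · subst hp'
    simp_rw [eLpNorm_top_ennreal]
    refine essSup_le_of_ae_le _ ?_
    filter_upwards [ae_all_iff.2 fun i => ENNReal.ae_le_essSup (f i)] with x hx
    exact ENNReal.tsum_le_tsum hx
  · have h0 := toReal_pos_of_one_le hp hp'
    have key : ∀ g : ℕ → α → ℝ≥0∞, (∀ i, AEMeasurable (g i) μ) →
        eLpNorm (fun x => ∑' i, g i x) p μ ≤ ∑' i, eLpNorm (g i) p μ := by
      intro g hg
      have hmono : ∀ x, Monotone fun n : ℕ => (∑ i ∈ Finset.range n, g i x) ^ p.toReal :=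
        fun x n m hnm => ENNReal.rpow_le_rpow
          (Finset.sum_le_sum_of_subset (Finset.range_mono hnm)) h0.le
      -- The partial sums increase, so monotone convergence reduces the claim to finite sums.
      have h1 : ∀ x, (∑' i, g i x) ^ p.toReal
          = ⨆ n : ℕ, (∑ i ∈ Finset.range n, g i x) ^ p.toReal := by
        intro x
        refine tendsto_nhds_unique ?_ (tendsto_atTop_iSup (hmono x))
        exact ((ENNReal.continuous_rpow_const).tendsto _).comp
          (ENNReal.tendsto_nat_tsum (fun i => g i x))
      rw [eLpNorm_ennreal_eq_lintegral hp hp']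
      simp_rw [h1]
      rw [lintegral_iSup' (fun n => (Finset.aemeasurable_fun_sum _ fun i _ => hg i).pow_const _)
        (Filter.Eventually.of_forall hmono)]
      rw [one_div, ENNReal.rpow_inv_le_iff h0]
      refine iSup_le fun n => ?_
      rw [← ENNReal.rpow_inv_le_iff h0, ← one_div]
      have := eLpNorm_finset_sum_le_ennreal hp (Finset.range n) hg
      rw [eLpNorm_ennreal_eq_lintegral hp hp'] at this
      exact this.trans (ENNReal.sum_le_tsum _)
    have e := (Denumerable.eqv ι).symm
    have := key (fun n => f (e n)) fun n => hf _
    rw [Equiv.tsum_eq e (fun i => eLpNorm (f i) p μ)] at this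
    refine le_trans (le_of_eq ?_) this
    congr 1
    funext x
    exact (Equiv.tsum_eq e (fun i => f i x)).symm

/-- Hölder's inequality for functions with values in `[0,∞]`. -/
theorem eLpNorm_mul_le_ennreal {p q r : ℝ≥0∞} (hr : 1 ≤ r) (hp : 1 ≤ p) (hq : 1 ≤ q)
    (h : r⁻¹ = p⁻¹ + q⁻¹) {f g : α → ℝ≥0∞} (hf : AEMeasurable f μ) (hg : AEMeasurable g μ) :
    eLpNorm (fun x => f x * g x) r μ ≤ eLpNorm f p μ * eLpNorm g q μ := by
  by_cases hp' : p = ∞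
  · subst hp'
    have : r = q := by simpa using h
    subst this
    rw [eLpNorm_top_ennreal, ← eLpNorm_const_mul_ennreal hr _ hg]
    apply eLpNorm_mono_ae_ennreal
    filter_upwards [ENNReal.ae_le_essSup f] with x hx
    gcongr
  by_cases hq' : q = ∞
  · subst hq'
    have : r = p := by simpa using h
    subst this
    rw [eLpNorm_top_ennreal, mul_comm, ← eLpNorm_const_mul_ennreal hr _ hf]
    apply eLpNorm_mono_ae_ennreal
    filter_upwards [ENNReal.ae_le_essSup g] with x hx
    rw [mul_comm]
    gcongr
  have hr' : r ≠ ∞ := by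
    rintro rfl
    simp only [ENNReal.inv_top] at h
    have := (add_eq_zero.1 h.symm).1
    simp at this
    exact hp' this
  have h0 := toReal_pos_of_one_le hr hr'
  have hp0 := toReal_pos_of_one_le hp hp'
  have hq0 := toReal_pos_of_one_le hq hq'
  have hreal : 1 / r.toReal = 1 / p.toReal + 1 / q.toReal := by
    have := congrArg ENNReal.toReal h
    rw [ENNReal.toReal_add (by simp; exact (zero_lt_one.trans_le hp).ne')
      (by simp; exact (zero_lt_one.trans_le hq).ne')] at this
    simpa [ENNReal.toReal_inv] using this
  rw [eLpNorm_ennreal_eq_lintegral hr hr', eLpNorm_ennreal_eq_lintegral hp hp',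
    eLpNorm_ennreal_eq_lintegral hq hq']
  refine ENNReal.lintegral_Lp_mul_le_Lq_mul_Lr h0 ?_ hreal μ hf hg
  have : 0 < 1 / q.toReal := by positivity
  exact lt_of_one_div_lt_one_div hp0 (by linarith)

/-- The essential supremum exceeds `c` exactly where the slice of `{h > c}` has positive measure,
and the measure of a slice depends measurably on the parameter. -/
theorem measurable_essSup_section {β : Type*} [MeasurableSpace β] {ν : Measure β} [SFinite ν]
    {h : α × β → ℝ≥0∞} (hh : Measurable h) : Measurable fun t => essSup (fun x => h (t, x)) ν := by
  refine measurable_of_Ioi fun c => ?_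
  have : (fun t => essSup (fun x => h (t, x)) ν) ⁻¹' Set.Ioi c
      = {t | 0 < ν (Prod.mk t ⁻¹' {z | c < h z})} := by
    ext t
    simp only [Set.mem_preimage, Set.mem_Ioi, Set.mem_ofPred_eq]
    rw [pos_iff_ne_zero, ← not_iff_not]
    simp only [not_lt, not_not, ne_eq]
    constructor
    · intro hle
      have : ∀ᵐ x ∂ν, h (t, x) ≤ c :=
        (ENNReal.ae_le_essSup (fun x => h (t, x))).mono fun x hx => hx.trans hle
      rw [ae_iff] at this
      simpa using this
    · intro h0
      refine essSup_le_of_ae_le _ ?_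
      change ∀ᵐ x ∂ν, h (t, x) ≤ c
      rw [ae_iff]
      simpa using h0
  rw [this]
  exact measurableSet_lt measurable_const
    (measurable_measure_prodMk_left (measurableSet_lt measurable_const hh))

theorem measurable_eLpNorm_section {β : Type*} [MeasurableSpace β] {ν : Measure β} [SFinite ν]
    {p : ℝ≥0∞} (hp : 1 ≤ p) {h : α × β → ℝ≥0∞} (hh : Measurable h) :
    Measurable fun t => eLpNorm (fun x => h (t, x)) p ν := by
  by_cases hp' : p = ∞
  · subst hp'
    simp_rw [eLpNorm_top_ennreal]
    exact measurable_essSup_section hh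
  · simp_rw [eLpNorm_ennreal_eq_lintegral hp hp']
    exact (Measurable.lintegral_prod_right' (f := fun z => h z ^ p.toReal)
      (hh.pow_const _)).pow_const _

end ENNRealNorms

/-! ### Sequence norms on the integers, and Young's inequalities -/

theorem seqNorm_eq_eLpNorm {r : ℝ≥0∞} (hr : 1 ≤ r) (c : ℤ → ℝ≥0∞) :
    seqNorm r c = eLpNorm c r Measure.count := by
  unfold seqNorm
  split_ifs with h
  · subst h
    rw [eLpNorm_top_ennreal, essSup_count]
  · rw [eLpNorm_ennreal_eq_lintegral hr h, lintegral_count]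

/-- Young's inequality on the integers, for the convolution of a summable and an `ℓ^r` sequence. -/
theorem seqNorm_conv_le {r : ℝ≥0∞} (hr : 1 ≤ r) (e x : ℤ → ℝ≥0∞) :
    seqNorm r (fun q => ∑' j, e (q - j) * x j) ≤ (∑' n, e n) * seqNorm r x := by
  -- The substitution `n = q - j` writes the convolution as a superposition of translates of `x`, so
  -- Minkowski's inequality and translation invariance suffice.
  have h1 : ∀ q, ∑' j, e (q - j) * x j = ∑' n, e n * x (q - n) := by
    intro q
    rw [← Equiv.tsum_eq (Equiv.subLeft q) (fun n => e n * x (q - n))]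
    simp
  simp_rw [h1, seqNorm_eq_eLpNorm hr]
  refine (eLpNorm_tsum_le_ennreal hr fun n => (measurable_of_countable _).aemeasurable).trans ?_
  rw [← ENNReal.tsum_mul_right]
  refine ENNReal.tsum_le_tsum fun n => ?_
  rw [eLpNorm_const_mul_ennreal hr _ (measurable_of_countable _).aemeasurable]
  refine mul_le_mul_right (le_of_eq ?_) _
  rw [← seqNorm_eq_eLpNorm hr, ← seqNorm_eq_eLpNorm hr]
  unfold seqNorm
  have h2 : ⨆ q, x (q - n) = ⨆ q, x q := Equiv.iSup_congr (Equiv.subRight n) (fun _ => rfl)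
  have h3 : ∑' q, x (q - n) ^ r.toReal = ∑' q, x q ^ r.toReal :=
    Equiv.tsum_eq (Equiv.subRight n) (fun q => x q ^ r.toReal)
  simp only [h2, h3]

theorem seqNorm_mono {r : ℝ≥0∞} (hr : 1 ≤ r) {c d : ℤ → ℝ≥0∞} (h : ∀ q, c q ≤ d q) :
    seqNorm r c ≤ seqNorm r d := by
  simp_rw [seqNorm_eq_eLpNorm hr]
  exact eLpNorm_mono_ennreal h

theorem seqNorm_add_le {r : ℝ≥0∞} (hr : 1 ≤ r) (c d : ℤ → ℝ≥0∞) :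
    seqNorm r (fun q => c q + d q) ≤ seqNorm r c + seqNorm r d := by
  simp_rw [seqNorm_eq_eLpNorm hr]
  exact eLpNorm_add_le_ennreal hr (measurable_of_countable _).aemeasurable
    (measurable_of_countable _).aemeasurable

theorem seqNorm_const_mul {r : ℝ≥0∞} (hr : 1 ≤ r) (a : ℝ≥0∞) (c : ℤ → ℝ≥0∞) :
    seqNorm r (fun q => a * c q) = a * seqNorm r c := by
  simp_rw [seqNorm_eq_eLpNorm hr]
  exact eLpNorm_const_mul_ennreal hr _ (measurable_of_countable _).aemeasurable

theorem seqNorm_eq_zero {r : ℝ≥0∞} (hr : 1 ≤ r) {c : ℤ → ℝ≥0∞} (h : seqNorm r c = 0) (q : ℤ) :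
    c q = 0 := by
  rw [seqNorm_eq_eLpNorm hr, eLpNorm_eq_zero_iff (measurable_of_countable _).aestronglyMeasurable
    (zero_lt_one.trans_le hr).ne'] at h
  simpa using congrFun (Measure.ae_count_iff.1 h |> fun h => funext h) q

/-- Young's inequality for the convolution with a nonnegative integrable kernel. -/
theorem eLpNorm_lintegral_conv_le {E : Type*} [NormedAddCommGroup E] [NormedSpace ℝ E]
    [FiniteDimensional ℝ E] [MeasurableSpace E] [BorelSpace E] {μ : Measure E} [μ.IsAddHaarMeasure]
    {p : ℝ≥0∞} (hp : 1 ≤ p) {η v : E → ℝ≥0∞} (hη : Measurable η) (hv : AEMeasurable v μ) :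
    eLpNorm (fun x => ∫⁻ y, η (x - y) * v y ∂μ) p μ ≤ (∫⁻ x, η x ∂μ) * eLpNorm v p μ := by
  have hshift : ∀ x, ∫⁻ y, η (x - y) ∂μ = ∫⁻ y, η y ∂μ := fun x =>
    lintegral_sub_left_eq_self η x
  have hsub : Measurable fun z : E × E => η (z.1 - z.2) := hη.comp (measurable_fst.sub measurable_snd)
  by_cases hp' : p = ∞
  · subst hp'
    rw [eLpNorm_top_ennreal, eLpNorm_top_ennreal]
    refine essSup_le_of_ae_le _ (Filter.Eventually.of_forall fun x => ?_)
    change ∫⁻ y, η (x - y) * v y ∂μ ≤ (∫⁻ y, η y ∂μ) * essSup v μ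
    rw [← hshift x, ← lintegral_mul_const _ (by fun_prop)]
    refine lintegral_mono_ae ?_
    filter_upwards [ENNReal.ae_le_essSup v] with y hy
    gcongr
  have h0 := toReal_pos_of_one_le hp hp'
  set P := p.toReal with hP
  have hP1 : 1 ≤ P := by
    have := ENNReal.toReal_mono hp' hp
    simpa using this
  have tonelli : ∫⁻ x, ∫⁻ y, η (x - y) * v y ^ P ∂μ ∂μ = (∫⁻ x, η x ∂μ) * ∫⁻ y, v y ^ P ∂μ := by
    have hm : AEMeasurable (fun z : E × E => η (z.1 - z.2) * v z.2 ^ P) (μ.prod μ) :=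
      hsub.aemeasurable.mul ((hv.comp_quasiMeasurePreserving
        Measure.quasiMeasurePreserving_snd).pow_const _)
    rw [lintegral_lintegral_swap hm]
    have : ∀ y, ∫⁻ x, η (x - y) * v y ^ P ∂μ = (∫⁻ x, η x ∂μ) * v y ^ P := by
      intro y
      rw [lintegral_mul_const _ (by fun_prop)]
      congr 1
      exact lintegral_sub_right_eq_self η y
    simp_rw [this]
    exact lintegral_const_mul'' _ (hv.pow_const _)
  -- Jensen's inequality for the measure `η(x - y) dy`, from Hölder's inequality for the splitting
  -- `η v = η^{1/Q} · (η^{1/P} v)`. For `P = 1` there is no finite conjugate exponent, and the claim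
  -- is an equality.
  have jensen : ∀ x, (∫⁻ y, η (x - y) * v y ∂μ) ^ P
      ≤ (∫⁻ y, η y ∂μ) ^ (P - 1) * ∫⁻ y, η (x - y) * v y ^ P ∂μ := by
    intro x
    rcases hP1.eq_or_lt with h1 | h1
    · simp [← h1]
    have hq := Real.HolderConjugate.conjExponent h1
    set Q := P.conjExponent
    have hQ0 : 0 < Q := hq.symm.pos
    have hηx : AEMeasurable (fun y => η (x - y)) μ :=
      (hη.comp (measurable_const.sub measurable_id)).aemeasurable
    have hh := ENNReal.lintegral_mul_le_Lp_mul_Lq μ hq.symm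
      (f := fun y => η (x - y) ^ (1 / Q)) (g := fun y => η (x - y) ^ (1 / P) * v y)
      (hηx.pow_const _) ((hηx.pow_const _).mul hv)
    have e1 : ∀ y, ((fun y => η (x - y) ^ (1 / Q)) * fun y => η (x - y) ^ (1 / P) * v y) y
        = η (x - y) * v y := by
      intro y
      simp only [Pi.mul_apply]
      rw [← mul_assoc, ← ENNReal.rpow_add_of_nonneg _ _ (by positivity) (by positivity),
        show 1 / Q + 1 / P = 1 by simpa using hq.symm.inv_add_inv_eq_one, ENNReal.rpow_one]
    have e2 : ∀ y, (η (x - y) ^ (1 / Q)) ^ Q = η (x - y) := fun y => by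
      rw [← ENNReal.rpow_mul, one_div_mul_cancel hQ0.ne', ENNReal.rpow_one]
    have e3 : ∀ y, (η (x - y) ^ (1 / P) * v y) ^ P = η (x - y) * v y ^ P := fun y => by
      rw [ENNReal.mul_rpow_of_nonneg _ _ h0.le, ← ENNReal.rpow_mul, one_div_mul_cancel h0.ne',
        ENNReal.rpow_one]
    simp_rw [e1, e2, e3, hshift x] at hh
    refine (ENNReal.rpow_le_rpow hh h0.le).trans (le_of_eq ?_)
    rw [ENNReal.mul_rpow_of_nonneg _ _ h0.le, ← ENNReal.rpow_mul, ← ENNReal.rpow_mul,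
      one_div_mul_cancel h0.ne', ENNReal.rpow_one]
    congr 2
    rw [one_div, inv_mul_eq_div]
    exact hq.div_conj_eq_sub_one
  rw [eLpNorm_ennreal_eq_lintegral hp hp', eLpNorm_ennreal_eq_lintegral hp hp', ← hP, one_div,
    ENNReal.rpow_inv_le_iff h0, ENNReal.mul_rpow_of_nonneg _ _ h0.le, ← ENNReal.rpow_mul,
    inv_mul_cancel₀ h0.ne', ENNReal.rpow_one]
  refine (lintegral_mono jensen).trans ?_
  have hm' : AEMeasurable (fun x => ∫⁻ y, η (x - y) * v y ^ P ∂μ) μ :=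
    AEMeasurable.lintegral_prod_right' (f := fun z : E × E => η (z.1 - z.2) * v z.2 ^ P)
      (hsub.aemeasurable.mul ((hv.comp_quasiMeasurePreserving
        Measure.quasiMeasurePreserving_snd).pow_const _))
  rw [lintegral_const_mul'' _ hm', tonelli, ← mul_assoc]
  refine mul_le_mul_left (le_of_eq ?_) _
  nth_rw 2 [← ENNReal.rpow_one (∫⁻ x, η x ∂μ)]
  rw [← ENNReal.rpow_add_of_nonneg _ _ (by linarith) zero_le_one]
  congr 1
  ring

/-! ### Convolution of Schwartz kernels and bounded functions -/

section KernelConvolution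

set_option linter.unusedSectionVars false

variable {E : Type} [NormedAddCommGroup E] [InnerProductSpace ℝ E] [FiniteDimensional ℝ E]
  [MeasurableSpace E] [BorelSpace E] {V : Type} [NormedAddCommGroup V] [NormedSpace ℝ V]

/-- `f` is measurable and essentially bounded by `R`. -/
def EssBddBy (R : ℝ) (f : E → ℝ) : Prop :=
  AEStronglyMeasurable f volume ∧ ∀ᵐ y, ‖f y‖ ≤ R

/-- The convolution `(k * f)(x) = ∫ f(y) k(x - y) dy`. -/
noncomputable def conv (k : 𝓢(E, V)) (f : E → ℝ) (x : E) : V := ∫ y, f y • k (x - y)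

theorem EssBddBy.of_continuous {R : ℝ} {f : E → ℝ} (hf : Continuous f) (h : ∀ y, ‖f y‖ ≤ R) :
    EssBddBy R f :=
  ⟨hf.aestronglyMeasurable, Filter.Eventually.of_forall h⟩

theorem EssBddBy.nonneg {R : ℝ} {f : E → ℝ} (hf : EssBddBy R f) : 0 ≤ R := by
  obtain ⟨y, hy⟩ := hf.2.exists
  exact (norm_nonneg _).trans hy

theorem EssBddBy.sub {R S : ℝ} {f g : E → ℝ} (hf : EssBddBy R f) (hg : EssBddBy S g) :
    EssBddBy (R + S) (fun y => f y - g y) := by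
  refine ⟨hf.1.sub hg.1, ?_⟩
  filter_upwards [hf.2, hg.2] with y h1 h2
  exact (norm_sub_le _ _).trans (add_le_add h1 h2)

theorem EssBddBy.eLpNorm_le {R : ℝ} {f : E → ℝ} (hf : EssBddBy R f) :
    eLpNorm f ∞ volume ≤ ENNReal.ofReal R := by
  rw [eLpNorm_exponent_top]
  refine essSup_le_of_ae_le _ ?_
  filter_upwards [hf.2] with y hy
  rw [← ofReal_norm]
  exact ENNReal.ofReal_le_ofReal hy

theorem schwartz_comp_sub_continuous (k : 𝓢(E, V)) (x : E) : Continuous fun y => k (x - y) :=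
  k.continuous.comp (continuous_const.sub continuous_id)

theorem integrable_kernel_sub (k : 𝓢(E, V)) (x : E) :
    Integrable (fun y => k (x - y)) (volume : Measure E) :=
  (k.integrable (μ := volume)).comp_sub_left x

theorem integrable_conv {R : ℝ} {f : E → ℝ} (hf : EssBddBy R f) (k : 𝓢(E, V)) (x : E) :
    Integrable (fun y => f y • k (x - y)) (volume : Measure E) :=
  (integrable_kernel_sub k x).bdd_smul R hf.1 hf.2

theorem conv_add (k l : 𝓢(E, V)) {R : ℝ} {f : E → ℝ} (hf : EssBddBy R f) (x : E) :
    conv (k + l) f x = conv k f x + conv l f x := by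
  unfold conv
  rw [← integral_add (integrable_conv hf k x) (integrable_conv hf l x)]
  simp [smul_add]

theorem conv_sub_right (k : 𝓢(E, V)) {R S : ℝ} {f g : E → ℝ} (hf : EssBddBy R f)
    (hg : EssBddBy S g) (x : E) :
    conv k (fun y => f y - g y) x = conv k f x - conv k g x := by
  unfold conv
  rw [← integral_sub (integrable_conv hf k x) (integrable_conv hg k x)]
  simp [sub_smul]

theorem conv_add_right (k : 𝓢(E, V)) {R S : ℝ} {f g : E → ℝ} (hf : EssBddBy R f)
    (hg : EssBddBy S g) (x : E) :
    conv k (fun y => f y + g y) x = conv k f x + conv k g x := by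
  unfold conv
  rw [← integral_add (integrable_conv hf k x) (integrable_conv hg k x)]
  simp [add_smul]

@[simp]
theorem conv_zero_left (f : E → ℝ) (x : E) : conv (0 : 𝓢(E, V)) f x = 0 := by
  simp [conv]

theorem conv_congr_ae (k : 𝓢(E, V)) {f g : E → ℝ} (h : f =ᵐ[volume] g) (x : E) :
    conv k f x = conv k g x :=
  integral_congr_ae (h.mono fun y hy => by simp [hy])

/-- The function `f` is only bounded, so the derivative falls on the kernel, whose rapid decay
dominates the difference quotients. -/
theorem hasFDerivAt_conv (k : 𝓢(E, V)) {R : ℝ} {f : E → ℝ} (hf : EssBddBy R f) (x : E) :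
    HasFDerivAt (conv k f) (conv (SchwartzMap.fderivCLM ℝ E V k) f x) x := by
  set k' := SchwartzMap.fderivCLM ℝ E V k with hk'
  -- One more power than the dimension makes `(1 + ‖x‖)^{-n}` integrable.
  set n : ℕ := Module.finrank ℝ E + 1 with hn
  obtain ⟨C, hC⟩ : ∃ C : ℝ, ∀ z, (1 + ‖z‖) ^ n * ‖k' z‖ ≤ C := by
    refine ⟨_, fun z => le_trans (le_of_eq ?_)
      (one_add_le_sup_seminorm_apply (𝕜 := ℝ) (m := (n, 0)) le_rfl le_rfl k' z)⟩
    rw [norm_iteratedFDeriv_zero]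
  have hC0 : 0 ≤ C := (by positivity : (0 : ℝ) ≤ (1 + ‖(0 : E)‖) ^ n * ‖k' 0‖).trans (hC 0)
  -- The domination must be uniform in `x'`: within the unit ball, `1 + ‖x - y‖` and `1 + ‖x' - y‖`
  -- are comparable up to a factor `2`.
  have hdecay : ∀ x' ∈ Metric.ball x 1, ∀ y, ‖k' (x' - y)‖ ≤ C * 2 ^ n * (1 + ‖x - y‖) ^ (-(n : ℝ)) := by
    intro x' hx' y
    have h1 : 1 + ‖x - y‖ ≤ 2 * (1 + ‖x' - y‖) := by
      have : ‖x - y‖ ≤ ‖x - x'‖ + ‖x' - y‖ := norm_sub_le_norm_sub_add_norm_sub _ _ _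
      have h2 : ‖x - x'‖ < 1 := by rw [norm_sub_rev, ← dist_eq_norm]; exact hx'
      have := norm_nonneg (x' - y)
      linarith
    have hpos : 0 < 1 + ‖x - y‖ := by positivity
    rw [Real.rpow_neg hpos.le, Real.rpow_natCast, ← div_eq_mul_inv, le_div_iff₀ (by positivity)]
    calc ‖k' (x' - y)‖ * (1 + ‖x - y‖) ^ n
        ≤ ‖k' (x' - y)‖ * (2 * (1 + ‖x' - y‖)) ^ n := by gcongr
      _ = ((1 + ‖x' - y‖) ^ n * ‖k' (x' - y)‖) * 2 ^ n := by rw [mul_pow]; ring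
      _ ≤ C * 2 ^ n := by gcongr; exact hC _
  unfold conv
  refine hasFDerivAt_integral_of_dominated_of_fderiv_le
    (F' := fun x y => f y • k' (x - y)) (bound := fun y => R * (C * 2 ^ n * (1 + ‖x - y‖) ^ (-(n : ℝ))))
    (Metric.ball_mem_nhds x one_pos)
    (Filter.Eventually.of_forall fun x' => (integrable_conv hf k x').aestronglyMeasurable)
    (integrable_conv hf k x) (integrable_conv hf k' x).aestronglyMeasurable ?_ ?_ ?_
  · filter_upwards [hf.2] with y hy x' hx'
    rw [norm_smul]
    exact mul_le_mul hy (hdecay x' hx' y) (norm_nonneg _) hf.nonneg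
  · refine (Integrable.const_mul ?_ _).const_mul _
    have h := integrable_one_add_norm (E := E) (μ := volume) (r := n) (by rw [hn]; push_cast; linarith)
    exact h.comp_sub_left x
  · refine Filter.Eventually.of_forall fun y x' _ => ?_
    have h1 : HasFDerivAt k (k' (x' - y)) (x' - y) := k.differentiableAt.hasFDerivAt
    have h2 := h1.comp x' ((hasFDerivAt_id x').sub_const y)
    exact h2.const_smul (f y)

theorem fderiv_conv (k : 𝓢(E, V)) {R : ℝ} {f : E → ℝ} (hf : EssBddBy R f) :
    fderiv ℝ (conv k f) = conv (SchwartzMap.fderivCLM ℝ E V k) f :=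
  funext fun x => (hasFDerivAt_conv k hf x).fderiv

/-- The derivative of the kernel takes values in a space of linear maps, hence the induction on `n`
must quantify over all target spaces. -/
theorem contDiff_conv_nat {R : ℝ} {f : E → ℝ} (hf : EssBddBy R f) (n : ℕ) :
    ∀ {V : Type} [NormedAddCommGroup V] [NormedSpace ℝ V] (k : 𝓢(E, V)),
      ContDiff ℝ n (conv k f) := by
  induction n with
  | zero =>
    intro V _ _ k
    refine contDiff_zero.2 (continuous_iff_continuousAt.2 fun x => ?_)
    exact (hasFDerivAt_conv k hf x).continuousAt
  | succ n ih =>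
    intro V _ _ k
    have hcast : ((n + 1 : ℕ) : WithTop ℕ∞) = (n : WithTop ℕ∞) + 1 := by norm_cast
    rw [hcast]
    refine contDiff_succ_iff_fderiv.2 ⟨fun x => (hasFDerivAt_conv k hf x).differentiableAt,
      fun h => absurd h (by simp), ?_⟩
    rw [fderiv_conv k hf]
    exact ih _

theorem contDiff_conv {R : ℝ} {f : E → ℝ} (hf : EssBddBy R f) (k : 𝓢(E, V)) :
    ContDiff ℝ ((⊤ : ℕ∞) : WithTop ℕ∞) (conv k f) :=
  contDiff_infty.2 fun n => contDiff_conv_nat hf n k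

theorem continuous_conv {R : ℝ} {f : E → ℝ} (hf : EssBddBy R f) (k : 𝓢(E, V)) :
    Continuous (conv k f) :=
  (contDiff_conv hf k).continuous

/-- With all derivatives on the kernel, a scalar convolution remains, to which Young's inequality
applies in every `L^p`. -/
theorem enorm_iteratedFDeriv_conv_le {R : ℝ} {f : E → ℝ} (hf : EssBddBy R f) (m : ℕ) :
    ∀ {V : Type} [NormedAddCommGroup V] [NormedSpace ℝ V] (k : 𝓢(E, V)) (x : E),
      ‖iteratedFDeriv ℝ m (conv k f) x‖ₑ
        ≤ ∫⁻ y, ‖iteratedFDeriv ℝ m k (x - y)‖ₑ * ‖f y‖ₑ := by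
  induction m with
  | zero =>
    intro V _ _ k x
    rw [← ofReal_norm, norm_iteratedFDeriv_zero, ofReal_norm]
    refine (enorm_integral_le_lintegral_enorm _).trans (lintegral_mono fun y => ?_)
    rw [enorm_smul, mul_comm, ← ofReal_norm (iteratedFDeriv ℝ 0 _ _), norm_iteratedFDeriv_zero,
      ofReal_norm]
  | succ m ih =>
    intro V _ _ k x
    rw [← ofReal_norm, ← norm_iteratedFDeriv_fderiv, ofReal_norm, fderiv_conv k hf]
    refine (ih _ x).trans (lintegral_mono fun y => ?_)
    gcongr
    rw [← ofReal_norm, ← ofReal_norm, ← norm_iteratedFDeriv_fderiv]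
    rfl

/-- The `L^1` norm of the derivative of order `m` of a kernel. -/
noncomputable def kernelMass (m : ℕ) (k : 𝓢(E, V)) : ℝ≥0∞ :=
  ∫⁻ x, ‖iteratedFDeriv ℝ m k x‖ₑ ∂(volume : Measure E)

theorem continuous_iteratedFDeriv_schwartz (k : 𝓢(E, V)) (m : ℕ) :
    Continuous (iteratedFDeriv ℝ m k) :=
  (k.smooth m).continuous_iteratedFDeriv le_rfl

theorem kernelMass_lt_top (m : ℕ) (k : 𝓢(E, V)) : kernelMass m k < ∞ := by
  have h := SchwartzMap.integrable_pow_mul_iteratedFDeriv (μ := (volume : Measure E)) k 0 m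
  simp only [pow_zero, one_mul] at h
  have := h.2
  simpa [HasFiniteIntegral, kernelMass] using this

theorem eLpNorm_iteratedFDeriv_conv_le {p : ℝ≥0∞} (hp : 1 ≤ p) {R : ℝ} {f : E → ℝ}
    (hf : EssBddBy R f) (m : ℕ) (k : 𝓢(E, V)) :
    eLpNorm (fun x => ‖iteratedFDeriv ℝ m (conv k f) x‖ₑ) p volume
      ≤ kernelMass m k * eLpNorm f p volume := by
  refine (eLpNorm_mono_ennreal (enorm_iteratedFDeriv_conv_le hf m k)).trans ?_
  refine (eLpNorm_lintegral_conv_le hp (η := fun z => ‖iteratedFDeriv ℝ m k z‖ₑ)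
    (continuous_iteratedFDeriv_schwartz k m).enorm.measurable hf.1.enorm).trans ?_
  rw [eLpNorm_enorm]
  rfl

theorem enorm_iteratedFDeriv_conv_le_top {R : ℝ} {f : E → ℝ} (hf : EssBddBy R f) (m : ℕ)
    (k : 𝓢(E, V)) (x : E) :
    ‖iteratedFDeriv ℝ m (conv k f) x‖ₑ ≤ kernelMass m k * eLpNorm f ∞ volume := by
  refine (enorm_iteratedFDeriv_conv_le hf m k x).trans ?_
  have h1 : kernelMass m k = ∫⁻ y, ‖iteratedFDeriv ℝ m k (x - y)‖ₑ := by
    unfold kernelMass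
    rw [lintegral_sub_left_eq_self (fun y => ‖iteratedFDeriv ℝ m k y‖ₑ) x]
  have h2 : Measurable fun y => ‖iteratedFDeriv ℝ m k (x - y)‖ₑ :=
    ((continuous_iteratedFDeriv_schwartz k m).comp
      (continuous_const.sub continuous_id)).enorm.measurable
  rw [h1, ← lintegral_mul_const _ h2]
  refine lintegral_mono_ae ?_
  filter_upwards [ae_le_eLpNormEssSup (f := f) (μ := volume)] with y hy
  rw [eLpNorm_exponent_top]
  exact mul_le_mul_right hy _

theorem norm_iteratedFDeriv_conv_le {R : ℝ} {f : E → ℝ} (hf : EssBddBy R f) (m : ℕ)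
    (k : 𝓢(E, V)) (x : E) :
    ‖iteratedFDeriv ℝ m (conv k f) x‖ ≤ (kernelMass m k).toReal * R := by
  have h := enorm_iteratedFDeriv_conv_le_top hf m k x
  have h2 : ‖iteratedFDeriv ℝ m (conv k f) x‖ₑ ≤ ENNReal.ofReal ((kernelMass m k).toReal * R) := by
    rw [ENNReal.ofReal_mul ENNReal.toReal_nonneg, ENNReal.ofReal_toReal (kernelMass_lt_top m k).ne]
    exact h.trans (mul_le_mul_right hf.eLpNorm_le _)
  rw [← ofReal_norm] at h2
  exact (ENNReal.ofReal_le_ofReal_iff (mul_nonneg ENNReal.toReal_nonneg hf.nonneg)).1 h2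

theorem norm_conv_le {R : ℝ} {f : E → ℝ} (hf : EssBddBy R f) (k : 𝓢(E, V)) (x : E) :
    ‖conv k f x‖ ≤ (kernelMass 0 k).toReal * R := by
  simpa using norm_iteratedFDeriv_conv_le hf 0 k x

theorem essBddBy_conv {R : ℝ} {f : E → ℝ} (hf : EssBddBy R f) (k : 𝓢(E, ℝ)) :
    EssBddBy ((kernelMass 0 k).toReal * R) (conv k f) :=
  .of_continuous (continuous_conv hf k) (norm_conv_le hf k)

theorem eLpNorm_conv_le {p : ℝ≥0∞} (hp : 1 ≤ p) {R : ℝ} {f : E → ℝ}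
    (hf : EssBddBy R f) (k : 𝓢(E, V)) :
    eLpNorm (conv k f) p volume ≤ kernelMass 0 k * eLpNorm f p volume := by
  have h := eLpNorm_iteratedFDeriv_conv_le hp hf 0 k
  refine le_trans (le_of_eq ?_) h
  rw [← eLpNorm_enorm]
  congr 1
  funext x
  rw [← ofReal_norm, ← ofReal_norm, norm_iteratedFDeriv_zero]

/-! ### Dilations of kernels -/

/-- The dilation `2^{jN} k(2^j ·)`, which preserves the mass of `k`. -/
noncomputable def dil (j : ℤ) (k : 𝓢(E, V)) : 𝓢(E, V) :=
  (((2 : ℝ) ^ j) ^ Module.finrank ℝ E) • SchwartzMap.compCLMOfContinuousLinearEquiv ℝ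
    (ContinuousLinearEquiv.smulLeft (R₁ := ℝ) (M₁ := E)
      (Units.mk0 ((2 : ℝ) ^ j) (zpow_ne_zero _ two_ne_zero))) k

theorem dil_apply (j : ℤ) (k : 𝓢(E, V)) (x : E) :
    dil j k x = (((2 : ℝ) ^ j) ^ Module.finrank ℝ E) • k ((2 : ℝ) ^ j • x) := rfl

theorem dil_dil (i j : ℤ) (k : 𝓢(E, V)) : dil i (dil j k) = dil (i + j) k := by
  ext x
  rw [dil_apply, dil_apply, dil_apply, smul_smul, smul_smul, ← mul_pow,
    zpow_add₀ (two_ne_zero' ℝ), mul_comm ((2 : ℝ) ^ j)]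

@[simp]
theorem dil_zero_index (k : 𝓢(E, V)) : dil 0 k = k := by
  ext x
  simp [dil_apply]

theorem lintegral_comp_two_zpow_smul (j : ℤ) (f : E → ℝ≥0∞) :
    ENNReal.ofReal (((2 : ℝ) ^ j) ^ Module.finrank ℝ E) * ∫⁻ x, f ((2 : ℝ) ^ j • x) = ∫⁻ x, f x := by
  have h2 : (2 : ℝ) ^ j ≠ 0 := zpow_ne_zero _ two_ne_zero
  have hpos : 0 < ((2 : ℝ) ^ j) ^ Module.finrank ℝ E := by positivity
  have h := lintegral_map_equiv (μ := (volume : Measure E)) f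
    (Homeomorph.smulOfNeZero ((2 : ℝ) ^ j) h2).toMeasurableEquiv
  have h' : Measure.map (Homeomorph.smulOfNeZero ((2 : ℝ) ^ j) h2).toMeasurableEquiv
      (volume : Measure E) = Measure.map (fun x : E => (2 : ℝ) ^ j • x) volume := rfl
  rw [h', Measure.map_addHaar_smul _ h2, lintegral_smul_measure] at h
  change _ = ∫⁻ x, f ((2 : ℝ) ^ j • x) at h
  rw [← h, smul_eq_mul, ← mul_assoc, ← ENNReal.ofReal_mul hpos.le, abs_of_pos (inv_pos.2 hpos),
    mul_inv_cancel₀ hpos.ne', ENNReal.ofReal_one, one_mul]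

theorem iteratedFDeriv_dil (j : ℤ) (k : 𝓢(E, V)) (m : ℕ) (x : E) :
    ‖iteratedFDeriv ℝ m (dil j k) x‖ₑ = ENNReal.ofReal (((2 : ℝ) ^ j) ^ Module.finrank ℝ E) *
      (ENNReal.ofReal (((2 : ℝ) ^ j) ^ m) * ‖iteratedFDeriv ℝ m k ((2 : ℝ) ^ j • x)‖ₑ) := by
  have h1 : (dil j k : E → V)
      = fun x => (((2 : ℝ) ^ j) ^ Module.finrank ℝ E) • (fun z => k ((2 : ℝ) ^ j • z)) x := rfl
  have hk : ContDiff ℝ m k := k.smooth m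
  rw [h1, iteratedFDeriv_const_smul_apply' (f := fun z => k ((2 : ℝ) ^ j • z))
      (hk.comp (contDiff_const_smul _)).contDiffAt,
    iteratedFDeriv_comp_const_smul _ hk, enorm_smul, enorm_smul,
    Real.enorm_of_nonneg (by positivity), Real.enorm_of_nonneg (by positivity)]

theorem kernelMass_dil (j : ℤ) (k : 𝓢(E, V)) (m : ℕ) :
    kernelMass m (dil j k) = ENNReal.ofReal (((2 : ℝ) ^ j) ^ m) * kernelMass m k := by
  unfold kernelMass
  simp_rw [iteratedFDeriv_dil]
  rw [lintegral_const_mul' _ _ ENNReal.ofReal_ne_top,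
    lintegral_comp_two_zpow_smul j fun x => ENNReal.ofReal (((2 : ℝ) ^ j) ^ m) *
      ‖iteratedFDeriv ℝ m k x‖ₑ,
    lintegral_const_mul' _ _ ENNReal.ofReal_ne_top]

theorem kernelMass_zero_eq (k : 𝓢(E, V)) : kernelMass 0 k = ∫⁻ x, ‖k x‖ₑ := by
  unfold kernelMass
  congr 1
  funext x
  rw [← ofReal_norm, ← ofReal_norm, norm_iteratedFDeriv_zero]

/-! ### Associativity, integration by parts -/

/-- Associativity of the convolution. -/
theorem conv_conv_eq_integral (k l : 𝓢(E, ℝ)) {R : ℝ} {f : E → ℝ}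
    (hf : EssBddBy R f) (x : E) : conv k (conv l f) x = ∫ z, f z • conv k l (x - z) := by
  -- Fubini's theorem is available because `f` is bounded and both kernels are integrable.
  have hint : Integrable (fun z : E × E => k (x - z.1) * (l (z.1 - z.2) * f z.2))
      ((volume : Measure E).prod volume) := by
    have hm : AEStronglyMeasurable (fun z : E × E => k (x - z.1) * (l (z.1 - z.2) * f z.2))
        ((volume : Measure E).prod volume) := by
      refine AEStronglyMeasurable.mul ?_ (AEStronglyMeasurable.mul ?_ ?_)
      · exact (k.continuous.comp (continuous_const.sub continuous_fst)).aestronglyMeasurable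
      · exact (l.continuous.comp (continuous_fst.sub continuous_snd)).aestronglyMeasurable
      · exact hf.1.comp_snd
    refine (integrable_prod_iff hm).2 ⟨Filter.Eventually.of_forall fun y => ?_, ?_⟩
    · have := (integrable_conv hf l y).const_mul (k (x - y))
      simpa [mul_comm (f _)] using this
    · have h1 : Integrable (fun y => ‖k (x - y)‖ * ((kernelMass 0 l).toReal * R)) volume :=
        (integrable_kernel_sub k x).norm.mul_const _
      refine h1.mono' hm.norm.integral_prod_right' (Filter.Eventually.of_forall fun y => ?_)
      rw [Real.norm_of_nonneg (integral_nonneg fun _ => norm_nonneg _)]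
      simp only [norm_mul (k _)]
      rw [integral_const_mul]
      refine mul_le_mul_of_nonneg_left ?_ (norm_nonneg _)
      have h2 : ∫ z, ‖l (y - z)‖ * R = (kernelMass 0 l).toReal * R := by
        rw [integral_mul_const, kernelMass_zero_eq, integral_sub_left_eq_self (fun z => ‖l z‖),
          integral_norm_eq_lintegral_enorm l.continuous.aestronglyMeasurable]
      rw [← h2]
      refine integral_mono_of_nonneg (Filter.Eventually.of_forall fun z => norm_nonneg _)
        ((integrable_kernel_sub l y).norm.mul_const _) ?_
      filter_upwards [hf.2] with z hz
      simp only [norm_mul]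
      gcongr
  unfold conv
  calc ∫ y, (∫ z, f z • l (y - z)) • k (x - y)
      = ∫ y, ∫ z, k (x - y) * (l (y - z) * f z) := by
        congr 1
        funext y
        rw [integral_const_mul, smul_eq_mul, mul_comm]
        congr 2
        funext z
        rw [smul_eq_mul, mul_comm]
    _ = ∫ z, ∫ y, k (x - y) * (l (y - z) * f z) := integral_integral_swap hint
    _ = ∫ z, f z • ∫ y, l y • k (x - z - y) := by
        congr 1
        funext z
        rw [smul_eq_mul, ← integral_const_mul,
          ← integral_sub_right_eq_self (fun y => f z * (l y • k (x - z - y))) z]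
        congr 1
        funext y
        rw [smul_eq_mul, sub_sub_sub_cancel_right]
        ring

/-- Associativity of the convolution, when `m` is the convolution of `k` and `l`. -/
theorem conv_conv {k l m : 𝓢(E, ℝ)} (h : ∀ x, conv k l x = m x) {R : ℝ} {f : E → ℝ}
    (hf : EssBddBy R f) (x : E) : conv k (conv l f) x = conv m f x := by
  rw [conv_conv_eq_integral k l hf]
  simp_rw [h]
  rfl

theorem schwartz_conv_comm (k l : 𝓢(E, ℝ)) (x : E) :
    conv k l x = conv l k x := by
  unfold conv
  rw [← integral_sub_left_eq_self (fun y => k y • l (x - y)) volume x]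
  congr 1
  funext y
  simp [mul_comm]

/-- This moves a mollifier from inside a dyadic block to the outside. -/
theorem conv_conv_comm (k l : 𝓢(E, ℝ)) {R : ℝ} {f : E → ℝ} (hf : EssBddBy R f) (x : E) :
    conv k (conv l f) x = conv l (conv k f) x := by
  rw [conv_conv_eq_integral k l hf, conv_conv_eq_integral l k hf]
  simp_rw [schwartz_conv_comm k l]

open LineDeriv in
/-- Integration by parts in a convolution. -/
theorem conv_lineDeriv (k : 𝓢(E, ℝ)) (v : E) {R R' : ℝ} {w : E → ℝ} (hw : ContDiff ℝ 1 w)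
    (hb : ∀ x, ‖w x‖ ≤ R) (hb' : ∀ x, ‖fderiv ℝ w x‖ ≤ R') (x : E) :
    conv (∂_{v} k) w x = conv k (fun y => fderiv ℝ w y v) x := by
  have hw0 : EssBddBy R w := .of_continuous hw.continuous hb
  have hcont : Continuous fun y => fderiv ℝ w y v :=
    (hw.continuous_fderiv one_ne_zero).clm_apply continuous_const
  have hw1 : EssBddBy (R' * ‖v‖) (fun y => fderiv ℝ w y v) :=
    .of_continuous hcont fun y =>
      (ContinuousLinearMap.le_opNorm _ _).trans (by gcongr; exact hb' y)
  have hd : ∀ y, HasFDerivAt (fun y => k (x - y)) (-(fderiv ℝ k (x - y))) y := by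
    intro y
    have h1 : HasFDerivAt k (fderiv ℝ k (x - y)) (x - y) := k.differentiableAt.hasFDerivAt
    refine (h1.comp y ((hasFDerivAt_id y).const_sub x)).congr_fderiv ?_
    ext z
    simp
  have hline : ∀ y, fderiv ℝ (fun y => k (x - y)) y v = -(∂_{v} k) (x - y) := by
    intro y
    rw [(hd y).fderiv]
    simp [SchwartzMap.lineDerivOp_apply_eq_fderiv]
  have := integral_mul_fderiv_eq_neg_fderiv_mul_of_integrable (μ := (volume : Measure E))
    (f := fun y => k (x - y)) (g := w) (v := v) ?_ ?_ ?_ (fun y _ => (hd y).differentiableAt)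
    (fun y _ => (hw.differentiable one_ne_zero) y)
  · unfold conv
    simp_rw [hline] at this
    simp only [smul_eq_mul]
    simp_rw [mul_comm (fderiv ℝ w _ v)]
    rw [this, ← integral_neg]
    congr 1
    funext y
    ring
  · simp_rw [hline]
    have := (integrable_conv hw0 (∂_{v} k) x).neg
    refine this.congr (Filter.Eventually.of_forall fun y => ?_)
    simp [mul_comm]
  · refine (integrable_conv hw1 k x).congr (Filter.Eventually.of_forall fun y => ?_)
    simp [mul_comm]
  · refine (integrable_conv hw0 k x).congr (Filter.Eventually.of_forall fun y => ?_)
    simp [mul_comm]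

end KernelConvolution

/-! ### Symbols of the dyadic blocks -/

section Symbols

set_option linter.unusedSectionVars false

variable {N : ℕ} {φ₀ : 𝓢(EuclideanSpace ℝ (Fin N), ℝ)}

theorem norm_two_zpow_smul (j : ℤ) (ξ : EuclideanSpace ℝ (Fin N)) : ‖(2 : ℝ) ^ j • ξ‖ = (2 : ℝ) ^ j * ‖ξ‖ := by
  rw [norm_smul, Real.norm_of_nonneg (by positivity)]

theorem IsDyadicGenerator.nonneg (h : IsDyadicGenerator φ₀) (ξ : EuclideanSpace ℝ (Fin N)) : 0 ≤ φ₀ ξ := by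
  by_cases h1 : 3 / 4 < ‖ξ‖ ∧ ‖ξ‖ < 8 / 3
  · exact (h.pos ξ h1.1 h1.2).le
  · rw [h.zero ξ (by by_contra! h2; exact h1 ⟨h2.1, h2.2⟩)]

/-- The annulus `1/2 < ‖ξ‖ < 4` is a neighbourhood of the support of `φ₀` and meets few of its
dilates. On it the normalizing series is a finite sum over a window that does not depend on `ξ`. -/
theorem IsDyadicGenerator.eq_zero_of_notMem (h : IsDyadicGenerator φ₀) {ξ : EuclideanSpace ℝ (Fin N)} (h1 : 1 / 2 < ‖ξ‖)
    (h2 : ‖ξ‖ < 4) {j : ℤ} (hj : j ∉ Finset.Icc (-3 : ℤ) 3) : φ₀ ((2 : ℝ) ^ (-j) • ξ) = 0 := by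
  apply h.zero
  rw [norm_two_zpow_smul]
  simp only [Finset.mem_Icc, not_and_or, not_le] at hj
  rcases hj with hj | hj
  · right
    have : (16 : ℝ) ≤ (2 : ℝ) ^ (-j) := le_trans (by norm_num)
      (zpow_le_zpow_right₀ one_le_two (by omega : 4 ≤ -j))
    nlinarith
  · left
    have : (2 : ℝ) ^ (-j) ≤ 1 / 16 :=
      (zpow_le_zpow_right₀ one_le_two (by omega : -j ≤ -4)).trans (by norm_num)
    have h3 : 0 < (2 : ℝ) ^ (-j) := by positivity
    nlinarith

/-- Dilation by a power of `2` brings any nonzero frequency into a region where the generator is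
positive. This reduces the summability of the normalizing series to a finite window and gives its
positivity. -/
theorem exists_zpow_annulus {ξ : EuclideanSpace ℝ (Fin N)} (hξ : ξ ≠ 0) :
    ∃ n : ℤ, 1 < (2 : ℝ) ^ (-n) * ‖ξ‖ ∧ (2 : ℝ) ^ (-n) * ‖ξ‖ ≤ 2 := by
  obtain ⟨n, h1, h2⟩ := exists_mem_Ioc_zpow (norm_pos_iff.2 hξ) (one_lt_two (α := ℝ))
  refine ⟨n, ?_, ?_⟩
  · rw [zpow_neg, inv_mul_eq_div, lt_div_iff₀ (by positivity), one_mul]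
    exact h1
  · rw [zpow_neg, inv_mul_eq_div, div_le_iff₀ (by positivity)]
    rw [zpow_add₀ two_ne_zero, zpow_one] at h2
    linarith

theorem tsum_generator_shift (ξ : EuclideanSpace ℝ (Fin N)) (n : ℤ) :
    ∑' j : ℤ, φ₀ ((2 : ℝ) ^ (-j) • (2 : ℝ) ^ (-n) • ξ) = ∑' j : ℤ, φ₀ ((2 : ℝ) ^ (-j) • ξ) := by
  rw [← Equiv.tsum_eq (Equiv.addRight n) (fun j : ℤ => φ₀ ((2 : ℝ) ^ (-j) • ξ))]
  congr 1
  funext j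
  rw [smul_smul, ← zpow_add₀ (two_ne_zero' ℝ)]
  congr 3
  simp
  ring

theorem IsDyadicGenerator.summable (h : IsDyadicGenerator φ₀) (ξ : EuclideanSpace ℝ (Fin N)) :
    Summable fun j : ℤ => φ₀ ((2 : ℝ) ^ (-j) • ξ) := by
  by_cases hξ : ξ = 0
  · subst hξ
    simp only [smul_zero, h.zero 0 (Or.inl (by norm_num : ‖(0 : EuclideanSpace ℝ (Fin N))‖ ≤ 3 / 4))]
    exact summable_zero
  obtain ⟨n, h1, h2⟩ := exists_zpow_annulus hξ
  have h3 : Summable fun j : ℤ => φ₀ ((2 : ℝ) ^ (-j) • (2 : ℝ) ^ (-n) • ξ) := by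
    refine summable_of_ne_finset_zero (s := Finset.Icc (-3 : ℤ) 3) fun j hj => ?_
    exact h.eq_zero_of_notMem (by rw [norm_two_zpow_smul]; linarith)
      (by rw [norm_two_zpow_smul]; linarith) hj
  rw [← (Equiv.addRight n).summable_iff]
  convert h3 using 2 with j
  simp only [Function.comp, Equiv.coe_addRight]
  rw [smul_smul, ← zpow_add₀ (two_ne_zero' ℝ)]
  congr 3
  ring

theorem IsDyadicGenerator.tsum_pos (h : IsDyadicGenerator φ₀) {ξ : EuclideanSpace ℝ (Fin N)} (hξ : ξ ≠ 0) :
    0 < ∑' j : ℤ, φ₀ ((2 : ℝ) ^ (-j) • ξ) := by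
  obtain ⟨n, h1, h2⟩ := exists_zpow_annulus hξ
  refine (h.summable ξ).tsum_pos (fun j => h.nonneg _) n (h.pos _ ?_ ?_) <;>
    rw [norm_two_zpow_smul] <;> linarith

theorem dyadicSymbol_eq (q : ℤ) (ξ : EuclideanSpace ℝ (Fin N)) :
    dyadicSymbol φ₀ q ξ = dyadicSymbol φ₀ 0 ((2 : ℝ) ^ (-q) • ξ) := by
  unfold dyadicSymbol
  rw [tsum_generator_shift]
  simp

theorem dyadicSymbol_two_smul (q n : ℤ) (ξ : EuclideanSpace ℝ (Fin N)) :
    dyadicSymbol φ₀ q ((2 : ℝ) ^ (-n) • ξ) = dyadicSymbol φ₀ (q + n) ξ := by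
  rw [dyadicSymbol_eq, dyadicSymbol_eq (q + n), smul_smul, ← zpow_add₀ (two_ne_zero' ℝ), neg_add]

theorem IsDyadicGenerator.dyadicSymbol_eq_zero (h : IsDyadicGenerator φ₀) {q : ℤ} {ξ : EuclideanSpace ℝ (Fin N)}
    (hξ : (2 : ℝ) ^ (-q) * ‖ξ‖ ≤ 3 / 4 ∨ 8 / 3 ≤ (2 : ℝ) ^ (-q) * ‖ξ‖) : dyadicSymbol φ₀ q ξ = 0 := by
  unfold dyadicSymbol
  rw [h.zero _ (by rwa [norm_two_zpow_smul]), zero_div]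

theorem IsDyadicGenerator.summable_dyadicSymbol (h : IsDyadicGenerator φ₀) (ξ : EuclideanSpace ℝ (Fin N)) :
    Summable fun q : ℤ => dyadicSymbol φ₀ q ξ :=
  (h.summable ξ).div_const _

theorem IsDyadicGenerator.tsum_dyadicSymbol (h : IsDyadicGenerator φ₀) {ξ : EuclideanSpace ℝ (Fin N)} (hξ : ξ ≠ 0) :
    ∑' q : ℤ, dyadicSymbol φ₀ q ξ = 1 := by
  unfold dyadicSymbol
  rw [tsum_div_const, div_self (h.tsum_pos hξ).ne']

theorem IsDyadicGenerator.dyadicSymbol_neg (h : IsDyadicGenerator φ₀) (q : ℤ) (ξ : EuclideanSpace ℝ (Fin N)) :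
    dyadicSymbol φ₀ q (-ξ) = dyadicSymbol φ₀ q ξ := by
  unfold dyadicSymbol
  simp only [smul_neg, h.even]

theorem IsDyadicGenerator.lowSymbol_neg (h : IsDyadicGenerator φ₀) (ξ : EuclideanSpace ℝ (Fin N)) :
    lowSymbol φ₀ (-ξ) = lowSymbol φ₀ ξ := by
  unfold lowSymbol
  simp only [h.dyadicSymbol_neg]

/-- Near the annulus the denominator is a positive finite sum of smooth functions; elsewhere the
quotient vanishes in a neighbourhood. The two open regions cover the space, and the origin, where
the denominator vanishes, lies in the second. -/
theorem IsDyadicGenerator.contDiff_dyadicSymbol_zero (h : IsDyadicGenerator φ₀) :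
    ContDiff ℝ ((⊤ : ℕ∞) : WithTop ℕ∞) (dyadicSymbol φ₀ 0) := by
  refine contDiff_iff_contDiffAt.2 fun ξ => ?_
  by_cases hξ : 1 / 2 < ‖ξ‖ ∧ ‖ξ‖ < 4
  · have hU : {ζ : EuclideanSpace ℝ (Fin N) | 1 / 2 < ‖ζ‖ ∧ ‖ζ‖ < 4} ∈ nhds ξ :=
      ((isOpen_lt continuous_const continuous_norm).inter
        (isOpen_lt continuous_norm continuous_const)).mem_nhds hξ
    have heq : ∀ ζ : EuclideanSpace ℝ (Fin N), 1 / 2 < ‖ζ‖ → ‖ζ‖ < 4 → ∑' j : ℤ, φ₀ ((2 : ℝ) ^ (-j) • ζ)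
        = ∑ j ∈ Finset.Icc (-3 : ℤ) 3, φ₀ ((2 : ℝ) ^ (-j) • ζ) := fun ζ h1 h2 =>
      tsum_eq_sum fun j hj => h.eq_zero_of_notMem h1 h2 hj
    have hev : dyadicSymbol φ₀ 0 =ᶠ[nhds ξ]
        fun ζ => φ₀ ζ / ∑ j ∈ Finset.Icc (-3 : ℤ) 3, φ₀ ((2 : ℝ) ^ (-j) • ζ) := by
      filter_upwards [hU] with ζ hζ
      unfold dyadicSymbol
      rw [heq ζ hζ.1 hζ.2]
      simp
    refine ContDiffAt.congr_of_eventuallyEq ?_ hev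
    have hφ : ContDiff ℝ ((⊤ : ℕ∞) : WithTop ℕ∞) φ₀ := φ₀.smooth ⊤
    refine hφ.contDiffAt.div (ContDiffAt.sum fun j _ => ?_) ?_
    · exact (hφ.comp (contDiff_const_smul _)).contDiffAt
    · rw [← heq ξ hξ.1 hξ.2]
      refine (h.tsum_pos ?_).ne'
      rintro rfl
      norm_num at hξ
  · have hev : dyadicSymbol φ₀ 0 =ᶠ[nhds ξ] fun _ => 0 := by
      have hU : {ζ : EuclideanSpace ℝ (Fin N) | ‖ζ‖ < 3 / 4 ∨ 8 / 3 < ‖ζ‖} ∈ nhds ξ := by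
        refine ((isOpen_lt continuous_norm continuous_const).union
          (isOpen_lt continuous_const continuous_norm)).mem_nhds ?_
        change ‖ξ‖ < 3 / 4 ∨ 8 / 3 < ‖ξ‖
        by_contra! h1
        exact hξ ⟨by linarith [h1.1], by linarith [h1.2]⟩
      filter_upwards [hU] with ζ hζ
      refine h.dyadicSymbol_eq_zero ?_
      simp only [neg_zero, zpow_zero, one_mul]
      exact hζ.imp le_of_lt le_of_lt
    exact contDiffAt_const.congr_of_eventuallyEq hev

/-- Halving the frequency shifts the indices of the series by one, which leaves the term `q = 0` as
the difference. This is the source of the relation `A (j+1) = A j + B j`. -/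
theorem IsDyadicGenerator.lowSymbol_half (h : IsDyadicGenerator φ₀) (ξ : EuclideanSpace ℝ (Fin N)) :
    lowSymbol φ₀ ((2 : ℝ) ^ (-1 : ℤ) • ξ) - lowSymbol φ₀ ξ = dyadicSymbol φ₀ 0 ξ := by
  unfold lowSymbol
  have hs : Summable fun q : ℕ => dyadicSymbol φ₀ (q : ℤ) ξ :=
    (h.summable_dyadicSymbol ξ).comp_injective Nat.cast_injective
  rw [hs.tsum_eq_zero_add]
  simp only [dyadicSymbol_two_smul]
  push_cast
  ring

theorem IsDyadicGenerator.lowSymbol_eq_one (h : IsDyadicGenerator φ₀) {ξ : EuclideanSpace ℝ (Fin N)} (hξ : ‖ξ‖ ≤ 3 / 4) :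
    lowSymbol φ₀ ξ = 1 := by
  unfold lowSymbol
  have : ∀ q : ℕ, dyadicSymbol φ₀ (q : ℤ) ξ = 0 := by
    intro q
    refine h.dyadicSymbol_eq_zero (Or.inl ?_)
    have h1 : (2 : ℝ) ^ (-(q : ℤ)) ≤ 1 := zpow_le_one_of_nonpos₀ one_le_two (by omega)
    have := norm_nonneg ξ
    nlinarith
  simp [this]

/-- For these frequencies the blocks with `q < 0` vanish, since `2^{-q} ‖ξ‖ ≥ 8/3`; the sum over `q
≥ 0` is then the whole partition of unity. -/
theorem IsDyadicGenerator.lowSymbol_eq_zero (h : IsDyadicGenerator φ₀) {ξ : EuclideanSpace ℝ (Fin N)} (hξ : 4 / 3 ≤ ‖ξ‖) :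
    lowSymbol φ₀ ξ = 0 := by
  unfold lowSymbol
  have hne : ξ ≠ 0 := by
    rintro rfl
    norm_num at hξ
  rw [← h.tsum_dyadicSymbol hne, sub_eq_zero]
  symm
  refine Function.Injective.tsum_eq (f := fun q : ℤ => dyadicSymbol φ₀ q ξ)
    (g := fun q : ℕ => (q : ℤ)) Nat.cast_injective fun q hq => ?_
  by_contra hneg
  refine hq (h.dyadicSymbol_eq_zero (Or.inr ?_))
  have hq0 : q < 0 := by
    by_contra! h0
    exact hneg ⟨q.toNat, by simp [h0]⟩
  have : (2 : ℝ) ≤ (2 : ℝ) ^ (-q) := le_trans (by norm_num)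
    (zpow_le_zpow_right₀ one_le_two (by omega : 1 ≤ -q))
  nlinarith

/-- The low-pass symbol vanishes at `2ξ`, so the difference relation leaves a single block.
Smoothness away from the origin follows from that of the block. -/
theorem IsDyadicGenerator.lowSymbol_eq_dyadicSymbol (h : IsDyadicGenerator φ₀) {ξ : EuclideanSpace ℝ (Fin N)}
    (hξ : 2 / 3 ≤ ‖ξ‖) : lowSymbol φ₀ ξ = dyadicSymbol φ₀ 0 ((2 : ℝ) • ξ) := by
  have h1 := h.lowSymbol_half ((2 : ℝ) • ξ)
  rw [h.lowSymbol_eq_zero (ξ := (2 : ℝ) • ξ) (by rw [norm_smul]; norm_num; linarith), smul_smul] at h1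
  norm_num at h1
  exact h1

theorem IsDyadicGenerator.contDiff_lowSymbol (h : IsDyadicGenerator φ₀) :
    ContDiff ℝ ((⊤ : ℕ∞) : WithTop ℕ∞) (lowSymbol φ₀) := by
  refine contDiff_iff_contDiffAt.2 fun ξ => ?_
  by_cases hξ : ‖ξ‖ < 3 / 4
  · refine contDiffAt_const (c := (1 : ℝ)) |>.congr_of_eventuallyEq ?_
    filter_upwards [(isOpen_lt continuous_norm continuous_const).mem_nhds hξ] with ζ hζ
    exact h.lowSymbol_eq_one (le_of_lt hζ)
  · have hξ' : 2 / 3 < ‖ξ‖ := by linarith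
    have h1 : ContDiff ℝ ((⊤ : ℕ∞) : WithTop ℕ∞) fun ξ : EuclideanSpace ℝ (Fin N) => dyadicSymbol φ₀ 0 ((2 : ℝ) • ξ) :=
      h.contDiff_dyadicSymbol_zero.comp (contDiff_const_smul _)
    refine h1.contDiffAt.congr_of_eventuallyEq ?_
    filter_upwards [(isOpen_lt continuous_const continuous_norm).mem_nhds hξ'] with ζ hζ
    exact h.lowSymbol_eq_dyadicSymbol (le_of_lt hζ)

theorem IsDyadicGenerator.hasCompactSupport_lowSymbol (h : IsDyadicGenerator φ₀) :
    HasCompactSupport (lowSymbol φ₀) :=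
  HasCompactSupport.intro (isCompact_closedBall (0 : EuclideanSpace ℝ (Fin N)) (4 / 3)) fun ξ hξ =>
    h.lowSymbol_eq_zero (by simpa using (not_le.1 (by simpa using hξ)).le)

theorem IsDyadicGenerator.hasCompactSupport_dyadicSymbol_zero (h : IsDyadicGenerator φ₀) :
    HasCompactSupport (dyadicSymbol φ₀ 0) :=
  HasCompactSupport.intro (isCompact_closedBall (0 : EuclideanSpace ℝ (Fin N)) (8 / 3)) fun ξ hξ =>
    h.dyadicSymbol_eq_zero (Or.inr (by simpa using (not_le.1 (by simpa using hξ)).le))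

/-- The symbol of `Φ_0`, as a Schwartz function. -/
noncomputable def IsDyadicGenerator.blockSymbol (h : IsDyadicGenerator φ₀) : 𝓢(EuclideanSpace ℝ (Fin N), ℝ) :=
  h.hasCompactSupport_dyadicSymbol_zero.toSchwartzMap h.contDiff_dyadicSymbol_zero

/-- The symbol of `Ψ`, as a Schwartz function. -/
noncomputable def IsDyadicGenerator.lowPassSymbol (h : IsDyadicGenerator φ₀) : 𝓢(EuclideanSpace ℝ (Fin N), ℝ) :=
  h.hasCompactSupport_lowSymbol.toSchwartzMap h.contDiff_lowSymbol

theorem IsDyadicGenerator.blockSymbol_apply (h : IsDyadicGenerator φ₀) (ξ : EuclideanSpace ℝ (Fin N)) :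
    h.blockSymbol ξ = dyadicSymbol φ₀ 0 ξ := rfl

theorem IsDyadicGenerator.lowPassSymbol_apply (h : IsDyadicGenerator φ₀) (ξ : EuclideanSpace ℝ (Fin N)) :
    h.lowPassSymbol ξ = lowSymbol φ₀ ξ := rfl

end Symbols

/-! ### Real kernels with a given symbol -/

section RealKernels

set_option linter.unusedSectionVars false

variable {E : Type} [NormedAddCommGroup E] [InnerProductSpace ℝ E] [FiniteDimensional ℝ E]
  [MeasurableSpace E] [BorelSpace E]

/-- The real part of the inverse Fourier transform of a complex symbol. -/
noncomputable def reFourierInv (m : 𝓢(E, ℂ)) : 𝓢(E, ℝ) :=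
  SchwartzMap.postcompCLM (𝕜 := ℝ) Complex.reCLM (𝓕⁻ m)

/-- The complexification of a real symbol. -/
noncomputable def complexify (m : 𝓢(E, ℝ)) : 𝓢(E, ℂ) :=
  SchwartzMap.postcompCLM (𝕜 := ℝ) Complex.ofRealCLM m

/-- The kernel whose Fourier transform is the even real symbol `m`. -/
noncomputable def symbolKernel (m : 𝓢(E, ℝ)) : 𝓢(E, ℝ) := reFourierInv (complexify m)

theorem reFourierInv_apply (m : 𝓢(E, ℂ)) (x : E) :
    reFourierInv m x = ((𝓕⁻ m : 𝓢(E, ℂ)) x).re := rfl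

theorem complexify_apply (m : 𝓢(E, ℝ)) (x : E) : complexify m x = (m x : ℂ) := rfl

theorem reFourierInv_add (a b : 𝓢(E, ℂ)) :
    reFourierInv (a + b) = reFourierInv a + reFourierInv b := by
  unfold reFourierInv
  rw [FourierTransform.fourierInv_add, map_add]

theorem symbolKernel_add (a b : 𝓢(E, ℝ)) :
    symbolKernel (a + b) = symbolKernel a + symbolKernel b := by
  unfold symbolKernel
  rw [← reFourierInv_add]
  congr 1
  ext x
  simp [complexify_apply]

/-- An even real symbol has a real inverse Fourier transform: conjugation amounts to the change of
variable `v ↦ -v`. Hence nothing is lost in taking the real part. -/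
theorem ofReal_symbolKernel {m : 𝓢(E, ℝ)} (hm : ∀ ξ, m (-ξ) = m ξ) (x : E) :
    (symbolKernel m x : ℂ) = 𝓕⁻ (fun ξ => (m ξ : ℂ)) x := by
  have h1 : (𝓕⁻ (complexify m) : 𝓢(E, ℂ)) x = 𝓕⁻ (fun ξ => (m ξ : ℂ)) x := by
    rw [fourierInv_coe]
    rfl
  have h2 : (starRingEnd ℂ) (𝓕⁻ (fun ξ => (m ξ : ℂ)) x) = 𝓕⁻ (fun ξ => (m ξ : ℂ)) x := by
    rw [Real.fourierInv_eq', ← integral_conj, ← integral_neg_eq_self]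
    congr 1
    funext v
    simp only [smul_eq_mul, map_mul, Complex.conj_ofReal, hm, ← Complex.exp_conj, inner_neg_left]
    congr 2
    push_cast
    simp
  rw [symbolKernel, reFourierInv_apply, h1]
  exact Complex.conj_eq_iff_re.1 h2

theorem complexify_symbolKernel {m : 𝓢(E, ℝ)} (hm : ∀ ξ, m (-ξ) = m ξ) :
    complexify (symbolKernel m) = 𝓕⁻ (complexify m) := by
  ext x
  rw [complexify_apply, ofReal_symbolKernel hm, fourierInv_coe]
  rfl

theorem integral_symbolKernel {m : 𝓢(E, ℝ)} (hm : ∀ ξ, m (-ξ) = m ξ) :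
    ∫ x, symbolKernel m x = m 0 := by
  have h1 : 𝓕 (complexify (symbolKernel m)) = complexify m := by
    rw [complexify_symbolKernel hm, FourierTransform.fourier_fourierInv_eq]
  have h2 : (𝓕 (complexify (symbolKernel m)) : 𝓢(E, ℂ)) 0 = (m 0 : ℂ) := by
    rw [h1, complexify_apply]
  rw [fourier_coe, Real.fourier_eq'] at h2
  simp only [inner_zero_right, mul_zero, Complex.ofReal_zero, zero_mul, Complex.exp_zero, one_smul,
    complexify_apply] at h2
  rw [integral_complex_ofReal] at h2
  exact_mod_cast h2

/-- The convolution of kernels corresponds to the product of symbols. -/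
theorem conv_symbolKernel {a b : 𝓢(E, ℝ)} (ha : ∀ ξ, a (-ξ) = a ξ) (hb : ∀ ξ, b (-ξ) = b ξ)
    (hab : ∀ ξ, a ξ * b ξ = b ξ) (x : E) :
    conv (symbolKernel a) (symbolKernel b) x = symbolKernel b x := by
  set A := complexify (symbolKernel a)
  set B := complexify (symbolKernel b)
  have h1 : SchwartzMap.convolution (ContinuousLinearMap.mul ℂ ℂ) B A = B := by
    have hF : 𝓕 (SchwartzMap.convolution (ContinuousLinearMap.mul ℂ ℂ) B A) = 𝓕 B := by
      rw [SchwartzMap.fourier_convolution]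
      ext ξ
      rw [SchwartzMap.pairing_apply_apply]
      have hA : 𝓕 A = complexify a := by
        rw [show A = 𝓕⁻ (complexify a) from complexify_symbolKernel ha, FourierTransform.fourier_fourierInv_eq]
      have hB : 𝓕 B = complexify b := by
        rw [show B = 𝓕⁻ (complexify b) from complexify_symbolKernel hb, FourierTransform.fourier_fourierInv_eq]
      rw [hA, hB, ContinuousLinearMap.mul_apply', complexify_apply, complexify_apply, mul_comm,
        ← Complex.ofReal_mul, hab]
    have := congrArg (fun f : 𝓢(E, ℂ) => (𝓕⁻ f : 𝓢(E, ℂ))) hF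
    simpa [FourierTransform.fourierInv_fourier_eq] using this
  have h2 := congrArg (fun f : 𝓢(E, ℂ) => f x) h1
  simp only [SchwartzMap.convolution_apply] at h2
  unfold MeasureTheory.convolution at h2
  have h3 : ∫ t, (ContinuousLinearMap.mul ℂ ℂ) (B t) (A (x - t))
      = ((conv (symbolKernel a) (symbolKernel b) x : ℝ) : ℂ) := by
    unfold conv
    rw [← integral_complex_ofReal]
    congr 1
    funext t
    simp [A, B, complexify_apply]
  rw [h3] at h2
  exact Complex.ofReal_injective h2

theorem symbolKernel_comp_smul {m m' : 𝓢(E, ℝ)} {q : ℤ} (h : ∀ ξ, m' ξ = m ((2 : ℝ) ^ (-q) • ξ)) :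
    symbolKernel m' = dil q (symbolKernel m) := by
  ext x
  have h0 : ((2 : ℝ) ^ q) ≠ 0 := zpow_ne_zero _ two_ne_zero
  rw [dil_apply, symbolKernel, symbolKernel, reFourierInv_apply, reFourierInv_apply, smul_eq_mul,
    ← Complex.re_ofReal_mul, fourierInv_coe, fourierInv_coe, Real.fourierInv_eq', Real.fourierInv_eq']
  congr 1
  have := Measure.integral_comp_smul (volume : Measure E)
    (fun v => Complex.exp (↑(2 * Real.pi * inner ℝ v ((2 : ℝ) ^ q • x)) * Complex.I) •
      complexify m v) ((2 : ℝ) ^ (-q))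
  rw [abs_of_pos (by positivity), zpow_neg, inv_pow, inv_inv] at this
  rw [← Complex.real_smul, ← this]
  congr 1
  funext v
  rw [complexify_apply, complexify_apply, h, zpow_neg, inner_smul_left, inner_smul_right,
    RCLike.conj_to_real, inv_mul_cancel_left₀ h0]

/-! ### Kernels whose symbol vanishes near the origin -/

open LineDeriv in
-- Write `g = ∑ (2πi ξ_i) G_i` with `G_i = ξ_i g / (2πi ‖ξ‖²)`. The quotient is smooth because `g`
-- vanishes near the origin, and each `G_i` again vanishes there, so the decomposition can be
-- iterated. The symbols become complex, which is why kernels are defined from complex symbols.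
theorem reFourierInv_lineDeriv_sum {g : E → ℂ} (hg : ContDiff ℝ ((⊤ : ℕ∞) : WithTop ℕ∞) g)
    (hc : HasCompactSupport g) {ρ : ℝ} (hρ : 0 < ρ) (h0 : ∀ ξ, ‖ξ‖ < ρ → g ξ = 0) :
    ∃ (G : Fin (Module.finrank ℝ E) → E → ℂ)
      (hG : ∀ i, ContDiff ℝ ((⊤ : ℕ∞) : WithTop ℕ∞) (G i)) (hcG : ∀ i, HasCompactSupport (G i)),
      (∀ i ξ, ‖ξ‖ < ρ → G i ξ = 0) ∧
      reFourierInv (hc.toSchwartzMap hg) = ∑ i, ∂_{stdOrthonormalBasis ℝ E i}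
        (reFourierInv ((hcG i).toSchwartzMap (hG i))) := by
  set b := stdOrthonormalBasis ℝ E
  let G : Fin (Module.finrank ℝ E) → E → ℂ := fun i ξ =>
    ((inner ℝ ξ (b i) / ‖ξ‖ ^ 2 : ℝ) : ℂ) * ((2 * Real.pi * Complex.I)⁻¹ * g ξ)
  have hG : ∀ i, ContDiff ℝ ((⊤ : ℕ∞) : WithTop ℕ∞) (G i) := by
    intro i
    refine contDiff_iff_contDiffAt.2 fun ξ => ?_
    by_cases hξ : ‖ξ‖ < ρ
    · refine (contDiffAt_const (c := (0 : ℂ))).congr_of_eventuallyEq ?_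
      filter_upwards [(isOpen_lt continuous_norm continuous_const).mem_nhds hξ] with ζ hζ
      simp [G, h0 ζ hζ]
    · have hne : ξ ≠ 0 := by
        rintro rfl
        simp [hρ] at hξ
      refine ContDiffAt.mul ?_ (contDiffAt_const.mul hg.contDiffAt)
      refine Complex.ofRealCLM.contDiff.contDiffAt.comp ξ (ContDiffAt.div ?_ ?_ (by simpa using hne))
      · exact contDiffAt_id.inner ℝ contDiffAt_const
      · exact (contDiff_norm_sq ℝ).contDiffAt
  have hcG : ∀ i, HasCompactSupport (G i) := fun i => (hc.mul_left).mul_left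
  refine ⟨G, hG, hcG, fun i ξ hξ => by simp [G, h0 ξ hξ], ?_⟩
  have key : (hc.toSchwartzMap hg : 𝓢(E, ℂ)) = ∑ i, ((2 * Real.pi * Complex.I) •
      (SchwartzMap.smulLeftCLM ℂ fun x => inner ℝ x (b i)) ((hcG i).toSchwartzMap (hG i))) := by
    ext ξ
    have htg : ∀ i, Function.HasTemperateGrowth fun x : E => inner ℝ x (b i) := fun i => by fun_prop
    have hval : ∀ i, ((2 * Real.pi * Complex.I) •
        (SchwartzMap.smulLeftCLM ℂ fun x => inner ℝ x (b i)) ((hcG i).toSchwartzMap (hG i))) ξ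
        = ((inner ℝ ξ (b i) ^ 2 / ‖ξ‖ ^ 2 : ℝ) : ℂ) * g ξ := by
      intro i
      rw [_root_.smul_apply, SchwartzMap.smulLeftCLM_apply_apply (htg i)]
      change (2 * Real.pi * Complex.I) • (inner ℝ ξ (b i) • G i ξ) = _
      simp only [G, smul_eq_mul, Complex.real_smul]
      have : (2 * Real.pi * Complex.I : ℂ) ≠ 0 := Complex.two_pi_I_ne_zero
      push_cast
      field_simp
    rw [_root_.sum_apply]
    simp_rw [hval]
    rw [← Finset.sum_mul, ← Complex.ofReal_sum, ← Finset.sum_div]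
    change g ξ = _
    by_cases hξ : ‖ξ‖ < ρ
    · simp [h0 ξ hξ]
    · have hne : ‖ξ‖ ^ 2 ≠ 0 := by
        have : 0 < ‖ξ‖ := hρ.trans_le (not_lt.1 hξ)
        positivity
      have hsum : ∑ i, inner ℝ ξ (b i) ^ 2 = ‖ξ‖ ^ 2 := by
        rw [← b.sum_sq_norm_inner_left ξ]
        simp
      rw [hsum, div_self hne]
      simp
  rw [key]
  have hsum : ∀ (s : Finset (Fin (Module.finrank ℝ E))) (F : Fin (Module.finrank ℝ E) → 𝓢(E, ℂ)),
      reFourierInv (∑ i ∈ s, F i) = ∑ i ∈ s, reFourierInv (F i) := by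
    classical
    intro s F
    induction s using Finset.induction_on with
    | empty =>
      ext x
      have : (𝓕⁻ (0 : 𝓢(E, ℂ)) : 𝓢(E, ℂ)) = 0 := by
        exact FourierTransform.fourierInv_zero
      simp [reFourierInv_apply, this]
    | insert a s ha ih => rw [Finset.sum_insert ha, Finset.sum_insert ha, reFourierInv_add, ih]
  rw [hsum]
  refine Finset.sum_congr rfl fun i _ => ?_
  ext x
  rw [reFourierInv_apply, ← SchwartzMap.lineDerivOp_fourierInv_eq,
    SchwartzMap.lineDerivOp_apply_eq_fderiv, SchwartzMap.lineDerivOp_apply_eq_fderiv]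
  have h1 : HasFDerivAt (𝓕⁻ ((hcG i).toSchwartzMap (hG i)) : 𝓢(E, ℂ))
      (fderiv ℝ (𝓕⁻ ((hcG i).toSchwartzMap (hG i)) : 𝓢(E, ℂ)) x) x :=
    (SchwartzMap.differentiableAt _).hasFDerivAt
  have h2 : HasFDerivAt (reFourierInv ((hcG i).toSchwartzMap (hG i)))
      (Complex.reCLM.comp (fderiv ℝ (𝓕⁻ ((hcG i).toSchwartzMap (hG i)) : 𝓢(E, ℂ)) x)) x :=
    Complex.reCLM.hasFDerivAt.comp x h1
  rw [h2.fderiv]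
  rfl

/-- The derivatives of `w` of order at most `m` are continuous and bounded. -/
def HasBddDerivs (m : ℕ) (w : E → ℝ) : Prop :=
  ContDiff ℝ m w ∧ ∀ i ≤ m, ∃ R : ℝ, ∀ x, ‖iteratedFDeriv ℝ i w x‖ ≤ R

theorem HasBddDerivs.essBddBy {m : ℕ} {w : E → ℝ} (hw : HasBddDerivs m w) :
    ∃ R : ℝ, (∀ x, ‖w x‖ ≤ R) ∧ EssBddBy R w := by
  obtain ⟨R, hR⟩ := hw.2 0 (Nat.zero_le _)
  have : ∀ x, ‖w x‖ ≤ R := fun x => by simpa using hR x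
  exact ⟨R, this, .of_continuous hw.1.continuous this⟩

theorem HasBddDerivs.lineDeriv {m : ℕ} {w : E → ℝ} (hw : HasBddDerivs (m + 1) w) (v : E) :
    HasBddDerivs m (fun y => fderiv ℝ w y v) ∧ ∀ i ≤ m, ∀ x,
      ‖iteratedFDeriv ℝ i (fun y => fderiv ℝ w y v) x‖ ≤ ‖v‖ * ‖iteratedFDeriv ℝ (i + 1) w x‖ := by
  have hc : ContDiff ℝ m (fderiv ℝ w) := by
    refine hw.1.fderiv_right ?_
    norm_cast
  have hle : ∀ i ≤ m, ∀ x,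
      ‖iteratedFDeriv ℝ i (fun y => fderiv ℝ w y v) x‖ ≤ ‖v‖ * ‖iteratedFDeriv ℝ (i + 1) w x‖ := by
    intro i hi x
    refine (norm_iteratedFDeriv_clm_apply_const (n := i) (hc.of_le (by exact_mod_cast hi)).contDiffAt le_rfl).trans ?_
    rw [norm_iteratedFDeriv_fderiv]
  refine ⟨⟨hc.clm_apply contDiff_const, fun i hi => ?_⟩, hle⟩
  obtain ⟨R, hR⟩ := hw.2 (i + 1) (by omega)
  exact ⟨‖v‖ * R, fun x => (hle i hi x).trans (by gcongr; exact hR x)⟩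

open LineDeriv in
/-- A kernel whose symbol vanishes near the origin annihilates polynomials; convolution with it is
controlled by derivatives of arbitrary order. -/
theorem exists_conv_le_iteratedFDeriv (m : ℕ) : ∀ {g : E → ℂ}
    (hg : ContDiff ℝ ((⊤ : ℕ∞) : WithTop ℕ∞) g) (hc : HasCompactSupport g) {ρ : ℝ} (_ : 0 < ρ)
    (_ : ∀ ξ, ‖ξ‖ < ρ → g ξ = 0), ∃ η : E → ℝ≥0∞, Measurable η ∧ ∫⁻ x, η x < ∞ ∧
      ∀ w : E → ℝ, HasBddDerivs m w → ∀ x, ‖conv (reFourierInv (hc.toSchwartzMap hg)) w x‖ₑ ≤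
        ∫⁻ y, η (x - y) * ‖iteratedFDeriv ℝ m w y‖ₑ := by
  induction m with
  | zero =>
    intro g hg hc ρ hρ h0
    set k := reFourierInv (hc.toSchwartzMap hg)
    refine ⟨fun x => ‖k x‖ₑ, k.continuous.enorm.measurable, ?_, fun w hw x => ?_⟩
    · rw [← kernelMass_zero_eq]
      exact kernelMass_lt_top 0 k
    · obtain ⟨R, -, hR⟩ := hw.essBddBy
      unfold conv
      refine (enorm_integral_le_lintegral_enorm _).trans (lintegral_mono fun y => ?_)
      rw [enorm_smul, mul_comm, ← ofReal_norm (iteratedFDeriv ℝ 0 _ _), norm_iteratedFDeriv_zero,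
        ofReal_norm]
  | succ m ih =>
    intro g hg hc ρ hρ h0
    -- Each of these directional derivatives is moved onto `w` by integration by parts, and the
    -- induction hypothesis is applied to the remaining kernel and the derivative of `w`.
    obtain ⟨G, hG, hcG, h0G, hk⟩ := reFourierInv_lineDeriv_sum hg hc hρ h0
    choose η hηm hηi hη using fun i => ih (hG i) (hcG i) hρ (h0G i)
    refine ⟨fun x => ∑ i, η i x, Finset.measurable_fun_sum _ fun i _ => hηm i, ?_, fun w hw x => ?_⟩
    · rw [lintegral_finsetSum _ fun i _ => hηm i]
      exact ENNReal.sum_lt_top.2 fun i _ => hηi i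
    obtain ⟨R, hR, hwR⟩ := hw.essBddBy
    obtain ⟨R', hR'⟩ := hw.2 1 (by omega)
    rw [hk]
    have hsum : conv (∑ i, ∂_{stdOrthonormalBasis ℝ E i}
        (reFourierInv ((hcG i).toSchwartzMap (hG i)))) w x
        = ∑ i, conv (∂_{stdOrthonormalBasis ℝ E i}
          (reFourierInv ((hcG i).toSchwartzMap (hG i)))) w x := by
      unfold conv
      rw [← integral_finsetSum _ fun i _ => integrable_conv hwR _ x]
      congr 1
      funext y
      rw [_root_.sum_apply, Finset.smul_sum]
    rw [hsum]
    refine (enorm_sum_le _ _).trans ?_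
    have hmeas : ∀ i, Measurable fun y => η i (x - y) * ‖iteratedFDeriv ℝ (m + 1) w y‖ₑ := fun i =>
      ((hηm i).comp (measurable_const.sub measurable_id)).mul
        (hw.1.continuous_iteratedFDeriv le_rfl).enorm.measurable
    simp_rw [Finset.sum_mul]
    rw [lintegral_finsetSum _ fun i _ => hmeas i]
    refine Finset.sum_le_sum fun i _ => ?_
    rw [conv_lineDeriv _ _ (hw.1.of_le (by norm_cast; omega)) hR fun x => by
      rw [← norm_iteratedFDeriv_one]; exact hR' x]
    obtain ⟨hb, hle⟩ := hw.lineDeriv (stdOrthonormalBasis ℝ E i)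
    refine (hη i _ hb x).trans (lintegral_mono fun y => ?_)
    gcongr
    rw [← ofReal_norm, ← ofReal_norm]
    refine ENNReal.ofReal_le_ofReal ((hle m le_rfl y).trans (le_of_eq ?_))
    rw [OrthonormalBasis.norm_eq_one, one_mul]

theorem conv_dil (q : ℤ) (k : 𝓢(E, ℝ)) (w : E → ℝ) (x : E) :
    conv (dil q k) w x = conv k (fun z => w ((2 : ℝ) ^ (-q) • z)) ((2 : ℝ) ^ q • x) := by
  have h0 : ((2 : ℝ) ^ q) ≠ 0 := zpow_ne_zero _ two_ne_zero
  unfold conv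
  have := Measure.integral_comp_smul (volume : Measure E)
    (fun z => w ((2 : ℝ) ^ (-q) • z) • k ((2 : ℝ) ^ q • x - z)) ((2 : ℝ) ^ q)
  rw [abs_of_pos (by positivity), ← inv_smul_eq_iff₀ (by positivity), inv_inv] at this
  rw [← this, ← integral_smul]
  congr 1
  funext y
  rw [dil_apply, smul_smul ((2 : ℝ) ^ (-q)), zpow_neg, inv_mul_cancel₀ h0, one_smul, smul_sub]
  simp only [smul_eq_mul]
  ring

/-- The rescaled form of `exists_conv_le_iteratedFDeriv`. -/
theorem conv_dil_le_iteratedFDeriv {m : ℕ} {k : 𝓢(E, ℝ)} {η : E → ℝ≥0∞} (hη : Measurable η)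
    (h : ∀ w : E → ℝ, HasBddDerivs m w → ∀ x, ‖conv k w x‖ₑ ≤
        ∫⁻ y, η (x - y) * ‖iteratedFDeriv ℝ m w y‖ₑ) (q : ℤ) :
    ∃ ζ : E → ℝ≥0∞, Measurable ζ ∧ ∫⁻ x, ζ x = ∫⁻ x, η x ∧
      ∀ w : E → ℝ, HasBddDerivs m w → ∀ x, ‖conv (dil q k) w x‖ₑ ≤
        ENNReal.ofReal (((2 : ℝ) ^ (-q)) ^ m) * ∫⁻ y, ζ (x - y) * ‖iteratedFDeriv ℝ m w y‖ₑ := by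
  have h0 : ((2 : ℝ) ^ q) ≠ 0 := zpow_ne_zero _ two_ne_zero
  set c := ENNReal.ofReal (((2 : ℝ) ^ q) ^ Module.finrank ℝ E) with hc
  have hcont : Continuous fun z : E => (2 : ℝ) ^ q • z := continuous_const_smul _
  -- The mass-preserving dilation of `η`; the gain `2^{-qm}` comes from the `m` derivatives of
  -- `w(2^{-q} ·)`.
  refine ⟨fun x => c * η ((2 : ℝ) ^ q • x), (hη.comp hcont.measurable).const_mul _, ?_,
    fun w hw x => ?_⟩
  · rw [lintegral_const_mul' _ _ ENNReal.ofReal_ne_top, lintegral_comp_two_zpow_smul]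
  rw [conv_dil]
  have hder : ∀ i ≤ m, ∀ z, ‖iteratedFDeriv ℝ i (fun z => w ((2 : ℝ) ^ (-q) • z)) z‖
      = ((2 : ℝ) ^ (-q)) ^ i * ‖iteratedFDeriv ℝ i w ((2 : ℝ) ^ (-q) • z)‖ := by
    intro i hi z
    rw [iteratedFDeriv_comp_const_smul _ (hw.1.of_le (by exact_mod_cast hi)), norm_smul,
      Real.norm_of_nonneg (by positivity)]
  have hw' : HasBddDerivs m (fun z => w ((2 : ℝ) ^ (-q) • z)) := by
    refine ⟨hw.1.comp (contDiff_const_smul _), fun i hi => ?_⟩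
    obtain ⟨R, hR⟩ := hw.2 i hi
    refine ⟨((2 : ℝ) ^ (-q)) ^ i * R, fun z => ?_⟩
    rw [hder i hi]
    gcongr
    exact hR _
  refine (h _ hw' _).trans (le_of_eq ?_)
  have hder' : ∀ z, ‖iteratedFDeriv ℝ m (fun z => w ((2 : ℝ) ^ (-q) • z)) z‖ₑ
      = ENNReal.ofReal (((2 : ℝ) ^ (-q)) ^ m) * ‖iteratedFDeriv ℝ m w ((2 : ℝ) ^ (-q) • z)‖ₑ := by
    intro z
    rw [← ofReal_norm, hder m le_rfl, ENNReal.ofReal_mul (by positivity), ofReal_norm]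
  simp_rw [hder']
  rw [← lintegral_comp_two_zpow_smul q, ← lintegral_const_mul' _ _ ENNReal.ofReal_ne_top,
    ← lintegral_const_mul' _ _ ENNReal.ofReal_ne_top]
  congr 1
  funext y
  rw [smul_smul ((2 : ℝ) ^ (-q)), zpow_neg, inv_mul_cancel₀ h0, one_smul, smul_sub]
  ring

end RealKernels

/-! ### Littlewood-Paley families of kernels -/

section LPFamilies

set_option linter.unusedSectionVars false

/-- The properties shared by the homogeneous and the inhomogeneous Littlewood-Paley
decompositions: `A j` is the low-frequency cut-off at frequency `2^j`, and `B j` is the dyadic block.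
The predicate `act` says which blocks are present. -/
structure IsLPFamily {E : Type} [NormedAddCommGroup E] [InnerProductSpace ℝ E]
    [FiniteDimensional ℝ E] [MeasurableSpace E] [BorelSpace E]
    (act : ℤ → Prop) (A B : ℤ → 𝓢(E, ℝ)) : Prop where
  add : ∀ j, A (j + 1) = A j + B j
  inactive : ∀ j, ¬ act j → B j = 0
  low_mass : ∀ m : ℕ, ∃ C : ℝ≥0, ∀ j, kernelMass m (A j) ≤ C * ENNReal.ofReal (((2 : ℝ) ^ j) ^ m)
  block_mass : ∀ m : ℕ, ∃ C : ℝ≥0, ∀ j, kernelMass m (B j) ≤ C * ENNReal.ofReal (((2 : ℝ) ^ j) ^ m)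
  -- A single kernel, dilated, reproduces all the blocks: this yields Bernstein constants uniform in
  -- `j`.
  reproducing : ∃ χ : 𝓢(E, ℝ), ∀ (j : ℤ) (R : ℝ) (f : E → ℝ), EssBddBy R f → ∀ x,
    conv (dil j χ) (conv (B j) f) x = conv (B j) f x
  -- The existence of an active index below `q` excludes the inhomogeneous block `q = -1`, whose
  -- kernel has integral one and cannot be controlled by derivatives.
  smoothing : ∀ m : ℕ, ∃ C : ℝ≥0, ∀ q, (∃ j < q, act j) → ∃ ζ : E → ℝ≥0∞, Measurable ζ ∧
    ∫⁻ x, ζ x ≤ C ∧ ∀ w : E → ℝ, HasBddDerivs m w → ∀ x, ‖conv (B q) w x‖ₑ ≤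
      ENNReal.ofReal (((2 : ℝ) ^ (-q)) ^ m) * ∫⁻ y, ζ (x - y) * ‖iteratedFDeriv ℝ m w y‖ₑ
  tendsto : ∀ (R : ℝ) (f : E → ℝ), Continuous f → (∀ y, ‖f y‖ ≤ R) → ∀ x,
    Filter.Tendsto (fun j : ℕ => conv (A j) f x) Filter.atTop (nhds (f x))
  -- The alternative serves to start the telescoping sum: either the low-frequency parts are
  -- eventually zero, or every block annihilates constants.
  low : (∃ J, ∀ j ≤ J, A j = 0) ∨ ∀ j, act j

variable {E : Type} [NormedAddCommGroup E] [InnerProductSpace ℝ E]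
    [FiniteDimensional ℝ E] [MeasurableSpace E] [BorelSpace E]

theorem dil_add (j : ℤ) (k l : 𝓢(E, ℝ)) : dil j (k + l) = dil j k + dil j l := by
  ext x
  simp [dil_apply, mul_add]

theorem conv_dil_dil {χ k : 𝓢(E, ℝ)} (h : ∀ x, conv χ k x = k x) (j : ℤ) (x : E) :
    conv (dil j χ) (dil j k) x = dil j k x := by
  rw [conv_dil, dil_apply, ← h]
  unfold conv
  rw [← integral_smul]
  congr 1
  funext y
  beta_reduce
  rw [dil_apply, smul_smul, ← zpow_add₀ (two_ne_zero' ℝ)]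
  simp [mul_assoc]

theorem tendsto_conv_dil {k : 𝓢(E, ℝ)} (hk : ∫ x, k x = 1) {R : ℝ} {f : E → ℝ} (hf : Continuous f)
    (hb : ∀ y, ‖f y‖ ≤ R) (x : E) :
    Filter.Tendsto (fun j : ℕ => conv (dil (j : ℤ) k) f x) Filter.atTop (nhds (f x)) := by
  have h1 : ∀ j : ℕ, conv (dil (j : ℤ) k) f x = ∫ z, f (x - (2 : ℝ) ^ (-(j : ℤ)) • z) * k z := by
    intro j
    have h0 : ((2 : ℝ) ^ (j : ℤ)) ≠ 0 := zpow_ne_zero _ two_ne_zero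
    rw [conv_dil]
    unfold conv
    rw [← integral_sub_left_eq_self (fun z => f (x - (2 : ℝ) ^ (-(j : ℤ)) • z) * k z) volume
      ((2 : ℝ) ^ (j : ℤ) • x)]
    congr 1
    funext z
    rw [smul_eq_mul, smul_sub, smul_smul, zpow_neg, inv_mul_cancel₀ h0, one_smul, sub_sub_cancel]
  simp_rw [h1]
  have h2 : f x = ∫ z, f x * k z := by rw [integral_const_mul, hk, mul_one]
  rw [h2]
  refine tendsto_integral_of_dominated_convergence (fun z => R * ‖k z‖) (fun j => ?_)
    ((k.integrable (μ := volume)).norm.const_mul R) (fun j => Filter.Eventually.of_forall fun z => ?_)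
    (Filter.Eventually.of_forall fun z => ?_)
  · exact ((hf.comp (continuous_const.sub (continuous_const_smul _))).mul
      k.continuous).aestronglyMeasurable
  · rw [norm_mul]
    gcongr
    exact hb _
  · refine Filter.Tendsto.mul_const _ ?_
    have h3 : Filter.Tendsto (fun j : ℕ => x - (2 : ℝ) ^ (-(j : ℤ)) • z) Filter.atTop
        (nhds (x - (0 : ℝ) • z)) := by
      refine tendsto_const_nhds.sub (Filter.Tendsto.smul_const ?_ z)
      have := tendsto_pow_atTop_nhds_zero_of_lt_one (r := (1 / 2 : ℝ)) (by norm_num) (by norm_num)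
      refine this.congr fun j => ?_
      rw [zpow_neg, zpow_natCast, one_div, inv_pow]
    rw [zero_smul, sub_zero] at h3
    exact (hf.tendsto x).comp h3

/-- The data from which both Littlewood-Paley families are built. -/
structure IsLPPair (ψ φ : 𝓢(E, ℝ)) : Prop where
  sub : dil 1 ψ = ψ + φ
  integral : ∫ x, ψ x = 1
  -- The dilation index is one less than for the block, so that a common `χ` can serve for `ψ`
  -- placed at the index `-1`.
  repr_low : ∀ x, conv (dil 2 ψ) ψ x = ψ x
  repr_block : ∀ x, conv (dil 3 ψ) φ x = φ x
  smoothing : ∀ m : ℕ, ∃ η : E → ℝ≥0∞, Measurable η ∧ ∫⁻ x, η x < ∞ ∧ ∀ w : E → ℝ,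
    HasBddDerivs m w → ∀ x, ‖conv φ w x‖ₑ ≤ ∫⁻ y, η (x - y) * ‖iteratedFDeriv ℝ m w y‖ₑ

variable {ψ φ : 𝓢(E, ℝ)}

theorem IsLPPair.dil_succ (h : IsLPPair ψ φ) (j : ℤ) : dil (j + 1) ψ = dil j ψ + dil j φ := by
  rw [← dil_dil, h.sub, dil_add]

theorem IsLPPair.smoothing_dil (h : IsLPPair ψ φ) (m : ℕ) : ∃ C : ℝ≥0, ∀ q : ℤ,
    ∃ ζ : E → ℝ≥0∞, Measurable ζ ∧
    ∫⁻ x, ζ x ≤ C ∧ ∀ w : E → ℝ, HasBddDerivs m w → ∀ x, ‖conv (dil q φ) w x‖ₑ ≤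
      ENNReal.ofReal (((2 : ℝ) ^ (-q)) ^ m) * ∫⁻ y, ζ (x - y) * ‖iteratedFDeriv ℝ m w y‖ₑ := by
  obtain ⟨η, hη, hηi, hw⟩ := h.smoothing m
  refine ⟨(∫⁻ x, η x).toNNReal, fun q => ?_⟩
  obtain ⟨ζ, hζ, hζi, hζw⟩ := conv_dil_le_iteratedFDeriv hη hw q
  exact ⟨ζ, hζ, by rw [hζi, ENNReal.coe_toNNReal hηi.ne], hζw⟩

theorem kernelMass_dil_le (k : 𝓢(E, ℝ)) (m : ℕ) (j : ℤ) :
    kernelMass m (dil j k) ≤ (kernelMass m k).toNNReal * ENNReal.ofReal (((2 : ℝ) ^ j) ^ m) := by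
  rw [kernelMass_dil, ENNReal.coe_toNNReal (kernelMass_lt_top m k).ne, mul_comm]

/-- The homogeneous Littlewood-Paley family. -/
theorem IsLPPair.hom (h : IsLPPair ψ φ) :
    IsLPFamily (fun _ => True) (fun j => dil j ψ) (fun j => dil j φ) where
  add := h.dil_succ
  inactive := by simp
  low_mass m := ⟨_, kernelMass_dil_le ψ m⟩
  block_mass m := ⟨_, kernelMass_dil_le φ m⟩
  reproducing := ⟨dil 3 ψ, fun j R f hf x =>
    conv_conv (conv_dil_dil h.repr_block j) hf x⟩
  smoothing m := by
    obtain ⟨C, hC⟩ := h.smoothing_dil m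
    exact ⟨C, fun q _ => hC q⟩
  tendsto R f hf hb x := tendsto_conv_dil h.integral hf hb x
  low := Or.inr fun _ => trivial

theorem kernelMass_zero_right (m : ℕ) : kernelMass m (0 : 𝓢(E, ℝ)) = 0 := by
  unfold kernelMass
  have h0 : ((0 : 𝓢(E, ℝ)) : E → ℝ) = fun _ => 0 := rfl
  simp_rw [h0, iteratedFDeriv_fun_zero, ← ofReal_norm, Pi.zero_apply, norm_zero]
  simp

/-- The inhomogeneous Littlewood-Paley family. -/
theorem IsLPPair.inhom (h : IsLPPair ψ φ) :
    IsLPFamily (fun j => -1 ≤ j) (fun j => if 0 ≤ j then dil j ψ else 0)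
      (fun j => if 0 ≤ j then dil j φ else if j = -1 then ψ else 0) where
  add j := by
    by_cases h0 : 0 ≤ j
    · simp [h0, (by omega : 0 ≤ j + 1), h.dil_succ]
    · by_cases h1 : j = -1
      · subst h1
        simp
      · rw [if_neg (by omega : ¬ 0 ≤ j + 1), if_neg h0, if_neg h0, if_neg h1, add_zero]
  inactive j hj := by rw [if_neg (by omega), if_neg (by omega)]
  low_mass m := by
    refine ⟨(kernelMass m ψ).toNNReal, fun j => ?_⟩
    split_ifs
    · exact kernelMass_dil_le ψ m j
    · rw [kernelMass_zero_right]
      exact zero_le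
  block_mass m := by
    refine ⟨(kernelMass m φ).toNNReal + (kernelMass m (dil 1 ψ)).toNNReal, fun j => ?_⟩
    push_cast
    rw [add_mul]
    split_ifs with h0 h1
    · exact (kernelMass_dil_le φ m j).trans le_self_add
    · have := kernelMass_dil_le (dil 1 ψ) m (-1)
      rw [dil_dil, neg_add_cancel, dil_zero_index] at this
      subst h1
      exact this.trans le_add_self
    · rw [kernelMass_zero_right]
      exact zero_le
  reproducing := by
    refine ⟨dil 3 ψ, fun j R f hf x => ?_⟩
    split_ifs with h0 h1
    · exact conv_conv (conv_dil_dil h.repr_block j) hf x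
    · subst h1
      -- Here `dil (-1) (dil 3 ψ)` is `dil 2 ψ`, which reproduces `ψ`.
      rw [dil_dil]
      exact conv_conv h.repr_low hf x
    · simp [conv]
  smoothing m := by
    obtain ⟨C, hC⟩ := h.smoothing_dil m
    refine ⟨C, fun q ⟨j, hj, hj'⟩ => ?_⟩
    simp only [(by omega : 0 ≤ q), if_true]
    exact hC q
  tendsto R f hf hb x := by simpa using tendsto_conv_dil h.integral hf hb x
  low := Or.inl ⟨-1, fun j hj => if_neg (by omega)⟩

/-! ### The kernels of the dyadic decomposition -/

section DyadicKernels

variable {N : ℕ} {φ₀ : 𝓢(EuclideanSpace ℝ (Fin N), ℝ)}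

/-- The kernel `Ψ`, as a real Schwartz function. -/
noncomputable def IsDyadicGenerator.lowPassKernel (h : IsDyadicGenerator φ₀) :
    𝓢(EuclideanSpace ℝ (Fin N), ℝ) := symbolKernel h.lowPassSymbol

/-- The kernel `Φ_0`, as a real Schwartz function. -/
noncomputable def IsDyadicGenerator.blockKernel (h : IsDyadicGenerator φ₀) :
    𝓢(EuclideanSpace ℝ (Fin N), ℝ) := symbolKernel h.blockSymbol

/-- The low-pass symbol at frequency `2^q`. -/
noncomputable def IsDyadicGenerator.lowPassSymbolDil (h : IsDyadicGenerator φ₀) (q : ℤ) :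
    𝓢(EuclideanSpace ℝ (Fin N), ℝ) :=
  SchwartzMap.compCLMOfContinuousLinearEquiv ℝ (ContinuousLinearEquiv.smulLeft (R₁ := ℝ)
    (M₁ := EuclideanSpace ℝ (Fin N)) (Units.mk0 ((2 : ℝ) ^ (-q)) (zpow_ne_zero _ two_ne_zero)))
    h.lowPassSymbol

theorem IsDyadicGenerator.lowPassSymbolDil_apply (h : IsDyadicGenerator φ₀) (q : ℤ)
    (ξ : EuclideanSpace ℝ (Fin N)) :
    h.lowPassSymbolDil q ξ = lowSymbol φ₀ ((2 : ℝ) ^ (-q) • ξ) := rfl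

theorem IsDyadicGenerator.symbolKernel_lowPassSymbolDil (h : IsDyadicGenerator φ₀) (q : ℤ) :
    symbolKernel (h.lowPassSymbolDil q) = dil q h.lowPassKernel :=
  symbolKernel_comp_smul fun _ => rfl

theorem IsDyadicGenerator.lowPassSymbolDil_neg (h : IsDyadicGenerator φ₀) (q : ℤ)
    (ξ : EuclideanSpace ℝ (Fin N)) : h.lowPassSymbolDil q (-ξ) = h.lowPassSymbolDil q ξ := by
  rw [h.lowPassSymbolDil_apply, h.lowPassSymbolDil_apply, smul_neg, h.lowSymbol_neg]

theorem IsDyadicGenerator.isLPPair (h : IsDyadicGenerator φ₀) :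
    IsLPPair h.lowPassKernel h.blockKernel where
  sub := by
    rw [← h.symbolKernel_lowPassSymbolDil, IsDyadicGenerator.lowPassKernel,
      IsDyadicGenerator.blockKernel, ← symbolKernel_add]
    congr 1
    ext ξ
    change lowSymbol φ₀ ((2 : ℝ) ^ (-1 : ℤ) • ξ) = lowSymbol φ₀ ξ + dyadicSymbol φ₀ 0 ξ
    rw [← h.lowSymbol_half]
    ring
  integral := by
    rw [IsDyadicGenerator.lowPassKernel, integral_symbolKernel h.lowSymbol_neg]
    exact h.lowSymbol_eq_one (by norm_num : ‖(0 : EuclideanSpace ℝ (Fin N))‖ ≤ 3 / 4)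
  repr_low x := by
    rw [← h.symbolKernel_lowPassSymbolDil]
    refine conv_symbolKernel (h.lowPassSymbolDil_neg 2) h.lowSymbol_neg (fun ξ => ?_) x
    rw [h.lowPassSymbolDil_apply, h.lowPassSymbol_apply]
    -- The symbol `lowSymbol(ξ/4)` equals one for `‖ξ‖ ≤ 3`, hence on the support of the low-pass
    -- symbol. For the block below, `lowSymbol(ξ/8)` equals one for `‖ξ‖ ≤ 6`.
    by_cases hξ : 4 / 3 ≤ ‖ξ‖
    · rw [h.lowSymbol_eq_zero hξ, mul_zero]
    · rw [h.lowSymbol_eq_one, one_mul]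
      rw [norm_two_zpow_smul]
      norm_num
      linarith
  repr_block x := by
    rw [← h.symbolKernel_lowPassSymbolDil]
    refine conv_symbolKernel (h.lowPassSymbolDil_neg 3) (h.dyadicSymbol_neg 0) (fun ξ => ?_) x
    rw [h.lowPassSymbolDil_apply, h.blockSymbol_apply]
    by_cases hξ : 8 / 3 ≤ ‖ξ‖
    · rw [h.dyadicSymbol_eq_zero (Or.inr (by simpa using hξ)), mul_zero]
    · rw [h.lowSymbol_eq_one, one_mul]
      rw [norm_two_zpow_smul]
      norm_num
      linarith
  smoothing m := by
    have hg : ContDiff ℝ ((⊤ : ℕ∞) : WithTop ℕ∞)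
        (fun ξ : EuclideanSpace ℝ (Fin N) => (dyadicSymbol φ₀ 0 ξ : ℂ)) :=
      Complex.ofRealCLM.contDiff.comp h.contDiff_dyadicSymbol_zero
    have hc : HasCompactSupport
        (fun ξ : EuclideanSpace ℝ (Fin N) => (dyadicSymbol φ₀ 0 ξ : ℂ)) :=
      h.hasCompactSupport_dyadicSymbol_zero.comp_left Complex.ofReal_zero
    exact exists_conv_le_iteratedFDeriv m hg hc (ρ := 3 / 4) (by norm_num) fun ξ hξ => by
      rw [h.dyadicSymbol_eq_zero (Or.inl (by simpa using hξ.le)), Complex.ofReal_zero]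

theorem kernelConv_eq_conv {K : EuclideanSpace ℝ (Fin N) → ℂ} {k : 𝓢(EuclideanSpace ℝ (Fin N), ℝ)}
    (h : ∀ x, K x = k x) (u : EuclideanSpace ℝ (Fin N) → ℝ) (x : EuclideanSpace ℝ (Fin N)) :
    kernelConv K u x = ((conv k u x : ℝ) : ℂ) := by
  unfold kernelConv conv
  rw [← integral_complex_ofReal]
  congr 1
  funext y
  rw [h, smul_eq_mul, mul_comm, Complex.ofReal_mul]

theorem IsDyadicGenerator.dyadicKernel_eq (h : IsDyadicGenerator φ₀) (q : ℤ)
    (x : EuclideanSpace ℝ (Fin N)) : dyadicKernel φ₀ q x = (dil q h.blockKernel x : ℂ) := by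
  let m' : 𝓢(EuclideanSpace ℝ (Fin N), ℝ) :=
    SchwartzMap.compCLMOfContinuousLinearEquiv ℝ (ContinuousLinearEquiv.smulLeft (R₁ := ℝ)
    (M₁ := EuclideanSpace ℝ (Fin N)) (Units.mk0 ((2 : ℝ) ^ (-q)) (zpow_ne_zero _ two_ne_zero)))
    h.blockSymbol
  have hm : ∀ ξ, m' ξ = dyadicSymbol φ₀ q ξ := fun ξ => (dyadicSymbol_eq q ξ).symm
  rw [IsDyadicGenerator.blockKernel, ← symbolKernel_comp_smul (m' := m') fun _ => rfl,
    ofReal_symbolKernel fun ξ => by rw [hm, hm, h.dyadicSymbol_neg]]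
  simp only [hm]
  rfl

theorem IsDyadicGenerator.lowKernel_eq (h : IsDyadicGenerator φ₀)
    (x : EuclideanSpace ℝ (Fin N)) : lowKernel φ₀ x = (h.lowPassKernel x : ℂ) := by
  rw [IsDyadicGenerator.lowPassKernel, ofReal_symbolKernel h.lowSymbol_neg]
  rfl

theorem IsDyadicGenerator.homBlock_eq (h : IsDyadicGenerator φ₀) (q : ℤ)
    (u : EuclideanSpace ℝ (Fin N) → ℝ) :
    homBlock φ₀ q u = fun x => ((conv (dil q h.blockKernel) u x : ℝ) : ℂ) :=
  funext fun x => kernelConv_eq_conv (h.dyadicKernel_eq q) u x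

theorem IsDyadicGenerator.inhomBlock_eq (h : IsDyadicGenerator φ₀) (q : ℤ)
    (u : EuclideanSpace ℝ (Fin N) → ℝ) :
    inhomBlock φ₀ q u = fun x => ((conv (if 0 ≤ q then dil q h.blockKernel
      else if q = -1 then h.lowPassKernel else 0) u x : ℝ) : ℂ) := by
  unfold inhomBlock
  split_ifs
  · exact funext fun x => kernelConv_eq_conv (h.dyadicKernel_eq q) u x
  · exact funext fun x => kernelConv_eq_conv h.lowKernel_eq u x
  · funext x
    simp

end DyadicKernels

end LPFamilies

/-! ### Derivatives of compositions and products at a given frequency -/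

section FrequencyBounds

set_option linter.unusedSectionVars false

variable {E : Type} [NormedAddCommGroup E] [InnerProductSpace ℝ E] [FiniteDimensional ℝ E]
  [MeasurableSpace E] [BorelSpace E]

/-- Both functions are normalized by the amplitude: `G ∘ c` is `G(R ·)` composed with `c / R`. The
inner derivatives of order `i ≥ 1` are then at most `(LΛ)^i`, where `L ≥ 1` is used, the outer ones
at most `M`, and the general bound for compositions applies. -/
theorem norm_iteratedFDeriv_comp_le_of_scale {K : ℕ} {G : ℝ → ℝ} {c : E → ℝ} (hG : ContDiff ℝ K G)
    (hc : ContDiff ℝ K c) {R L Λ M : ℝ} (hR : 0 < R) (hL : 1 ≤ L) (hΛ : 0 ≤ Λ) {y : E}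
    (hcb : ∀ i ≤ K, ‖iteratedFDeriv ℝ i c y‖ ≤ L * R * Λ ^ i)
    (hGb : ∀ i ≤ K, |iteratedDeriv i G (c y)| * R ^ i ≤ M) {n : ℕ} (hn : n ≤ K) :
    ‖iteratedFDeriv ℝ n (fun y => G (c y)) y‖ ≤ n.factorial * M * (L * Λ) ^ n := by
  have hcomp : (fun y => G (c y)) = (fun t => G (R • t)) ∘ (fun y => R⁻¹ • c y) := by
    funext y
    simp [hR.ne']
  have hG' : ContDiff ℝ K (fun t => G (R • t)) := hG.comp (contDiff_const_smul _)
  have hc' : ContDiff ℝ K (fun y => R⁻¹ • c y) := hc.const_smul _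
  rw [hcomp]
  refine norm_iteratedFDeriv_comp_le hG' hc' (by exact_mod_cast hn) y ?_ ?_
  · intro i hi
    rw [iteratedFDeriv_comp_const_smul R (hG.of_le (by exact_mod_cast hi.trans hn)), norm_smul,
      norm_iteratedFDeriv_eq_norm_iteratedDeriv, norm_pow, Real.norm_of_nonneg hR.le, mul_comm]
    simpa [hR.ne'] using hGb i (hi.trans hn)
  · intro i hi hin
    rw [iteratedFDeriv_const_smul_apply' (hc.of_le (by exact_mod_cast hin.trans hn)).contDiffAt,
      norm_smul, norm_inv, Real.norm_of_nonneg hR.le, inv_mul_le_iff₀ hR, mul_pow]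
    refine (hcb i (hin.trans hn)).trans ?_
    have hLi : L ≤ L ^ i := le_self_pow₀ hL (by omega)
    have h0 : 0 ≤ Λ ^ i := by positivity
    nlinarith [mul_le_mul_of_nonneg_right hLi (mul_nonneg hR.le h0)]

theorem norm_iteratedFDeriv_mul_le_of_scale {K : ℕ} {Z X : E → ℝ} (hZ : ContDiff ℝ K Z)
    (hX : ContDiff ℝ K X) {a b Λ : ℝ} (ha : 0 ≤ a) (hΛ : 0 ≤ Λ) {y : E}
    (hZb : ∀ i ≤ K, ‖iteratedFDeriv ℝ i Z y‖ ≤ a * Λ ^ i)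
    (hXb : ∀ i ≤ K, ‖iteratedFDeriv ℝ i X y‖ ≤ b * Λ ^ i) {n : ℕ} (hn : n ≤ K) :
    ‖iteratedFDeriv ℝ n (fun y => Z y * X y) y‖ ≤ 2 ^ n * (a * b) * Λ ^ n := by
  refine (norm_iteratedFDeriv_mul_le hZ hX y (by exact_mod_cast hn)).trans ?_
  have hsum : (2 : ℝ) ^ n = ∑ i ∈ Finset.range (n + 1), (n.choose i : ℝ) := by
    exact_mod_cast (Nat.sum_range_choose n).symm
  rw [hsum, mul_assoc, Finset.sum_mul]
  refine Finset.sum_le_sum fun i hi => ?_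
  have hi' : i ≤ n := Nat.lt_succ_iff.1 (Finset.mem_range.1 hi)
  calc (n.choose i : ℝ) * ‖iteratedFDeriv ℝ i Z y‖ * ‖iteratedFDeriv ℝ (n - i) X y‖
      ≤ (n.choose i : ℝ) * (a * Λ ^ i) * (b * Λ ^ (n - i)) := by
        gcongr
        · exact hZb i (hi'.trans hn)
        · exact hXb _ (by omega)
    _ = (n.choose i : ℝ) * (a * b * Λ ^ n) := by
        rw [show Λ ^ n = Λ ^ i * Λ ^ (n - i) by rw [← pow_add]; congr 1; omega]
        ring

/-- Derivatives of `G(c) X Y` when `c` and `X` live at frequency `Λ`. -/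
theorem norm_iteratedFDeriv_triple_le {K : ℕ} {G : ℝ → ℝ} {c X Y : E → ℝ} (hG : ContDiff ℝ K G)
    (hc : ContDiff ℝ K c) (hX : ContDiff ℝ K X) (hY : ContDiff ℝ K Y) {R L Λ M X₀ : ℝ} (hR : 0 < R)
    (hL : 1 ≤ L) (hΛ : 0 ≤ Λ) (hM : 0 ≤ M) (hX₀ : 0 ≤ X₀) {y : E}
    (hcb : ∀ i ≤ K, ‖iteratedFDeriv ℝ i c y‖ ≤ L * R * Λ ^ i)
    (hGb : ∀ i ≤ K, |iteratedDeriv i G (c y)| * R ^ i ≤ M)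
    (hXb : ∀ i ≤ K, ‖iteratedFDeriv ℝ i X y‖ ≤ L * X₀ * Λ ^ i) {n : ℕ} (hn : n ≤ K) :
    ‖iteratedFDeriv ℝ n (fun y => G (c y) * X y * Y y) y‖ ≤
      (4 ^ K * K.factorial * L ^ (K + 1)) * (M * X₀) *
        ∑ i ∈ Finset.range (n + 1), Λ ^ (n - i) * ‖iteratedFDeriv ℝ i Y y‖ := by
  have hGc : ContDiff ℝ K (fun y => G (c y)) := hG.comp hc
  have h1 : ∀ i ≤ K, ‖iteratedFDeriv ℝ i (fun y => G (c y)) y‖ ≤ K.factorial * M * L ^ K * Λ ^ i := by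
    intro i hi
    refine (norm_iteratedFDeriv_comp_le_of_scale hG hc hR hL hΛ hcb hGb hi).trans ?_
    rw [mul_pow, ← mul_assoc]
    gcongr
  have h2 : ∀ i ≤ K, ‖iteratedFDeriv ℝ i (fun y => G (c y) * X y) y‖
      ≤ 2 ^ K * (K.factorial * M * L ^ K * (L * X₀)) * Λ ^ i := by
    intro i hi
    refine (norm_iteratedFDeriv_mul_le_of_scale hGc hX (by positivity) hΛ h1 hXb hi).trans ?_
    gcongr
    norm_num
  -- The constant collects `K! L^K` from the composition, `L` from `X`, and one factor `2^K` for
  -- each of the two Leibniz formulas. The sum is then reflected, to be indexed by the order of the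
  -- derivative of `Y`.
  refine (norm_iteratedFDeriv_mul_le (hGc.mul hX) hY y (by exact_mod_cast hn)).trans ?_
  rw [Finset.mul_sum, ← Finset.sum_range_reflect]
  refine Finset.sum_le_sum fun i hi => ?_
  have hi' : i ≤ n := Nat.lt_succ_iff.1 (Finset.mem_range.1 hi)
  have e1 : n + 1 - 1 - i = n - i := by omega
  have e2 : n - (n - i) = i := by omega
  rw [e1, e2]
  have hch : (n.choose (n - i) : ℝ) ≤ 2 ^ K := by
    have : n.choose (n - i) ≤ 2 ^ n := Nat.choose_le_two_pow _ _
    calc (n.choose (n - i) : ℝ) ≤ 2 ^ n := by exact_mod_cast this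
      _ ≤ 2 ^ K := by gcongr; norm_num
  calc (n.choose (n - i) : ℝ) * ‖iteratedFDeriv ℝ (n - i) (fun y => G (c y) * X y) y‖ *
        ‖iteratedFDeriv ℝ i Y y‖
      ≤ 2 ^ K * (2 ^ K * (K.factorial * M * L ^ K * (L * X₀)) * Λ ^ (n - i)) *
        ‖iteratedFDeriv ℝ i Y y‖ := by
        gcongr
        exact h2 _ (by omega)
    _ = 4 ^ K * K.factorial * L ^ (K + 1) * (M * X₀) * (Λ ^ (n - i) * ‖iteratedFDeriv ℝ i Y y‖) := by
        rw [show (4 : ℝ) = 2 * 2 by norm_num, mul_pow]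
        ring

/-! ### Mean value inequalities under a convolution -/

/-- A pointwise substitute for integration in `τ`: at a fixed `x`, the mean value inequality is
applied to the scalar function `τ ↦ (k * H τ)(x)`. The larger interval `(-1, 2)` makes it
differentiable up to the endpoints `0` and `1`. -/
theorem norm_conv_sub_le_of_deriv (k : 𝓢(E, ℝ)) {H H' : ℝ → E → ℝ} {S : ℝ}
    (hH : ∀ τ, Continuous (H τ)) (hHb : ∀ τ ∈ Set.Ioo (-1 : ℝ) 2, ∃ R, ∀ y, ‖H τ y‖ ≤ R)
    (hH' : ∀ τ, Continuous (H' τ)) (hS : ∀ τ ∈ Set.Ioo (-1 : ℝ) 2, ∀ y, ‖H' τ y‖ ≤ S)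
    (hd : ∀ τ y, HasDerivAt (fun τ => H τ y) (H' τ y) τ) {x : E} {β : ℝ≥0∞}
    (hβ : ∀ τ ∈ Set.Icc (0 : ℝ) 1, ‖conv k (H' τ) x‖ₑ ≤ β) :
    ‖conv k (fun y => H 1 y - H 0 y) x‖ₑ ≤ β := by
  by_cases hβ' : β = ∞
  · simp [hβ']
  have hHe : ∀ τ ∈ Set.Ioo (-1 : ℝ) 2, ∃ R, EssBddBy R (H τ) := fun τ hτ => by
    obtain ⟨R, hR⟩ := hHb τ hτ
    exact ⟨R, .of_continuous (hH τ) hR⟩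
  have hH'e : ∀ τ ∈ Set.Ioo (-1 : ℝ) 2, EssBddBy S (H' τ) := fun τ hτ =>
    .of_continuous (hH' τ) (hS τ hτ)
  have hder : ∀ τ ∈ Set.Ioo (-1 : ℝ) 2,
      HasDerivAt (fun τ => conv k (H τ) x) (conv k (H' τ) x) τ := by
    intro τ hτ
    unfold conv
    obtain ⟨R, hR⟩ := hHe τ hτ
    refine (hasDerivAt_integral_of_dominated_loc_of_deriv_le (F := fun τ y => H τ y • k (x - y))
      (F' := fun τ y => H' τ y • k (x - y)) (bound := fun y => S * ‖k (x - y)‖)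
      (s := Set.Ioo (-1 : ℝ) 2) (isOpen_Ioo.mem_nhds hτ) ?_ (integrable_conv hR k x)
      (integrable_conv (hH'e τ hτ) k x).aestronglyMeasurable ?_
      ((integrable_kernel_sub k x).norm.const_mul S) ?_).2
    · exact Filter.Eventually.of_forall fun τ' =>
        ((hH τ').smul (schwartz_comp_sub_continuous k x)).aestronglyMeasurable
    · refine Filter.Eventually.of_forall fun y τ' hτ' => ?_
      rw [norm_smul]
      gcongr
      exact hS τ' hτ' y
    · exact Filter.Eventually.of_forall fun y τ' _ => (hd τ' y).smul_const _
  have hsub : Set.Icc (0 : ℝ) 1 ⊆ Set.Ioo (-1 : ℝ) 2 := fun τ hτ =>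
    ⟨by linarith [hτ.1], by linarith [hτ.2]⟩
  have h0 : (0 : ℝ) ∈ Set.Ioo (-1 : ℝ) 2 := by norm_num
  have h1 : (1 : ℝ) ∈ Set.Ioo (-1 : ℝ) 2 := by norm_num
  have hreal := norm_image_sub_le_of_norm_deriv_le_segment_01' (C := β.toReal)
    (f := fun τ => conv k (H τ) x) (f' := fun τ => conv k (H' τ) x)
    (fun τ hτ => (hder τ (hsub hτ)).hasDerivWithinAt) (fun τ hτ => by
      have := hβ τ ⟨hτ.1, hτ.2.le⟩
      rw [← ofReal_norm] at this
      exact (ENNReal.ofReal_le_iff_le_toReal hβ').1 this)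
  obtain ⟨R0, hR0⟩ := hHe 0 h0
  obtain ⟨R1, hR1⟩ := hHe 1 h1
  rw [conv_sub_right k hR1 hR0, ← ofReal_norm]
  exact (ENNReal.ofReal_le_iff_le_toReal hβ').2 hreal

theorem exists_bound_comp {G : ℝ → ℝ} (hG : Continuous G) (P : ℝ) :
    ∃ S, 0 ≤ S ∧ ∀ t, |t| ≤ P → ‖G t‖ ≤ S := by
  obtain ⟨S, hS⟩ := (isCompact_Icc (a := -P) (b := P)).exists_bound_of_continuousOn hG.continuousOn
  refine ⟨max S 0, le_max_right _ _, fun t ht => (hS t (abs_le.1 ht)).trans (le_max_left _ _)⟩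

/-- The mean value inequality for `(G(a) - G(b)) Y`. -/
theorem enorm_conv_diff_mul_le (k : 𝓢(E, ℝ)) {G : ℝ → ℝ} (hG : ContDiff ℝ 1 G) {a b Y : E → ℝ}
    (ha : Continuous a) (hb : Continuous b) (hY : Continuous Y) {P : ℝ} (haP : ∀ y, |a y| ≤ P)
    (hbP : ∀ y, |b y| ≤ P) (hYP : ∀ y, |Y y| ≤ P) {x : E} {β : ℝ≥0∞}
    (hβ : ∀ σ ∈ Set.Icc (0 : ℝ) 1,
      ‖conv k (fun y => deriv G (b y + σ * (a y - b y)) * (a y - b y) * Y y) x‖ₑ ≤ β) :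
    ‖conv k (fun y => (G (a y) - G (b y)) * Y y) x‖ₑ ≤ β := by
  have hG' : Continuous (deriv G) := hG.continuous_deriv le_rfl
  obtain ⟨S, hS0, hS⟩ := exists_bound_comp hG.continuous (5 * P)
  obtain ⟨S', hS0', hS'⟩ := exists_bound_comp hG' (5 * P)
  have hrange : ∀ σ ∈ Set.Ioo (-1 : ℝ) 2, ∀ y, |b y + σ * (a y - b y)| ≤ 5 * P := by
    intro σ hσ y
    have h1 : |σ| ≤ 2 := abs_le.2 ⟨by linarith [hσ.1], hσ.2.le⟩
    have h2 : |a y - b y| ≤ 2 * P := (abs_sub _ _).trans (by linarith [haP y, hbP y])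
    calc |b y + σ * (a y - b y)| ≤ |b y| + |σ| * |a y - b y| := by
          rw [← abs_mul]; exact abs_add_le _ _
      _ ≤ P + 2 * (2 * P) := by
          gcongr
          exact hbP y
      _ = 5 * P := by ring
  have key := norm_conv_sub_le_of_deriv k
    (H := fun σ y => G (b y + σ * (a y - b y)) * Y y)
    (H' := fun σ y => deriv G (b y + σ * (a y - b y)) * (a y - b y) * Y y) (S := S' * (2 * P) * P)
    (x := x) (β := β) (fun σ => (hG.continuous.comp (hb.add (continuous_const.mul (ha.sub hb)))).mul hY)
    (fun σ hσ => ⟨S * P, fun y => ?_⟩)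
    (fun σ => ((hG'.comp (hb.add (continuous_const.mul (ha.sub hb)))).mul (ha.sub hb)).mul hY)
    (fun σ hσ y => ?_) (fun σ y => ?_) hβ
  · convert key using 4 with y
    ring_nf
  · rw [norm_mul]
    exact mul_le_mul (hS _ (hrange σ hσ y)) (hYP y) (norm_nonneg _) hS0
  · rw [norm_mul, norm_mul]
    have h2 : ‖a y - b y‖ ≤ 2 * P := (norm_sub_le _ _).trans (by
      have := haP y; have := hbP y; simp only [Real.norm_eq_abs]; linarith)
    have hP0 : 0 ≤ P := (abs_nonneg _).trans (haP y)
    exact mul_le_mul (mul_le_mul (hS' _ (hrange σ hσ y)) h2 (norm_nonneg _) hS0') (hYP y)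
      (norm_nonneg _) (by positivity)
  · have h1 : HasDerivAt G (deriv G (b y + σ * (a y - b y))) (b y + σ * (a y - b y)) :=
      (hG.differentiable one_ne_zero _).hasDerivAt
    have h2 : HasDerivAt (fun σ => b y + σ * (a y - b y)) (a y - b y) σ := by
      simpa using ((hasDerivAt_id σ).mul_const (a y - b y)).const_add (b y)
    exact (h1.comp σ h2).mul_const _

/-- The mean value inequality for a difference of increments. -/
theorem enorm_conv_increment_le (k : 𝓢(E, ℝ)) {F : ℝ → ℝ} (hF : ContDiff ℝ 1 F)
    {a b da db : E → ℝ} (ha : Continuous a) (hb : Continuous b) (hda : Continuous da)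
    (hdb : Continuous db) {P : ℝ} (haP : ∀ y, |a y| ≤ P) (hbP : ∀ y, |b y| ≤ P)
    (hdaP : ∀ y, |da y| ≤ P) (hdbP : ∀ y, |db y| ≤ P) {x : E} {β γ : ℝ≥0∞}
    (hβ : ∀ τ ∈ Set.Icc (0 : ℝ) 1,
      ‖conv k (fun y => deriv F (a y + τ * da y) * (da y - db y)) x‖ₑ ≤ β)
    (hγ : ∀ τ ∈ Set.Icc (0 : ℝ) 1,
      ‖conv k (fun y => (deriv F (a y + τ * da y) - deriv F (b y + τ * db y)) * db y) x‖ₑ ≤ γ) :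
    ‖conv k (fun y => (F (a y + da y) - F (b y + db y)) - (F (a y) - F (b y))) x‖ₑ ≤ β + γ := by
  have hF' : Continuous (deriv F) := hF.continuous_deriv le_rfl
  obtain ⟨S, hS0, hS⟩ := exists_bound_comp hF.continuous (3 * P)
  obtain ⟨S', hS0', hS'⟩ := exists_bound_comp hF' (3 * P)
  have hrange : ∀ τ ∈ Set.Ioo (-1 : ℝ) 2, ∀ s t : ℝ, |s| ≤ P → |t| ≤ P → |s + τ * t| ≤ 3 * P := by
    intro τ hτ s t hs ht
    have h1 : |τ| ≤ 2 := abs_le.2 ⟨by linarith [hτ.1], hτ.2.le⟩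
    calc |s + τ * t| ≤ |s| + |τ| * |t| := by rw [← abs_mul]; exact abs_add_le _ _
      _ ≤ P + 2 * P := by gcongr
      _ = 3 * P := by ring
  have hca : ∀ τ : ℝ, Continuous fun y => a y + τ * da y := fun τ =>
    ha.add (continuous_const.mul hda)
  have hcb : ∀ τ : ℝ, Continuous fun y => b y + τ * db y := fun τ =>
    hb.add (continuous_const.mul hdb)
  have hb1 : ∀ τ ∈ Set.Ioo (-1 : ℝ) 2, ∀ y, ‖deriv F (a y + τ * da y) * da y‖ ≤ S' * P := by
    intro τ hτ y
    rw [norm_mul]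
    exact mul_le_mul (hS' _ (hrange τ hτ _ _ (haP y) (hdaP y))) (hdaP y) (norm_nonneg _) hS0'
  have hb2 : ∀ τ ∈ Set.Ioo (-1 : ℝ) 2, ∀ y, ‖deriv F (b y + τ * db y) * db y‖ ≤ S' * P := by
    intro τ hτ y
    rw [norm_mul]
    exact mul_le_mul (hS' _ (hrange τ hτ _ _ (hbP y) (hdbP y))) (hdbP y) (norm_nonneg _) hS0'
  have hd : ∀ (s t τ : ℝ), HasDerivAt (fun τ => F (s + τ * t)) (deriv F (s + τ * t) * t) τ := by
    intro s t τ
    have h1 : HasDerivAt F (deriv F (s + τ * t)) (s + τ * t) :=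
      (hF.differentiable one_ne_zero _).hasDerivAt
    have h2 : HasDerivAt (fun τ => s + τ * t) t τ := by
      simpa using ((hasDerivAt_id τ).mul_const t).const_add s
    exact h1.comp τ h2
  have key := norm_conv_sub_le_of_deriv k
    (H := fun τ y => F (a y + τ * da y) - F (b y + τ * db y))
    (H' := fun τ y => deriv F (a y + τ * da y) * da y - deriv F (b y + τ * db y) * db y)
    (S := S' * P + S' * P) (x := x) (β := β + γ)
    (fun τ => (hF.continuous.comp (hca τ)).sub (hF.continuous.comp (hcb τ)))
    (fun τ hτ => ⟨S + S, fun y => (norm_sub_le _ _).trans (add_le_add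
      (hS _ (hrange τ hτ _ _ (haP y) (hdaP y))) (hS _ (hrange τ hτ _ _ (hbP y) (hdbP y))))⟩)
    (fun τ => ((hF'.comp (hca τ)).mul hda).sub ((hF'.comp (hcb τ)).mul hdb))
    (fun τ hτ y => (norm_sub_le _ _).trans (add_le_add (hb1 τ hτ y) (hb2 τ hτ y)))
    (fun τ y => (hd _ _ τ).sub (hd _ _ τ)) (fun τ hτ => ?_)
  · simpa using key
  · have hτ' : τ ∈ Set.Ioo (-1 : ℝ) 2 := ⟨by linarith [hτ.1], by linarith [hτ.2]⟩
    -- The derivative in `τ` is split so that one term contains the difference of the blocks, and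
    -- the other the difference of the values of `F'`.
    have e : (fun y => deriv F (a y + τ * da y) * da y - deriv F (b y + τ * db y) * db y)
        = fun y => deriv F (a y + τ * da y) * (da y - db y)
          + (deriv F (a y + τ * da y) - deriv F (b y + τ * db y)) * db y := by
      funext y
      ring
    have hF'a : ∀ y, ‖deriv F (a y + τ * da y)‖ ≤ S' := fun y =>
      hS' _ (hrange τ hτ' _ _ (haP y) (hdaP y))
    have hF'b : ∀ y, ‖deriv F (b y + τ * db y)‖ ≤ S' := fun y =>
      hS' _ (hrange τ hτ' _ _ (hbP y) (hdbP y))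
    have m1 : EssBddBy (S' * (P + P)) (fun y => deriv F (a y + τ * da y) * (da y - db y)) := by
      refine .of_continuous ((hF'.comp (hca τ)).mul (hda.sub hdb)) fun y => ?_
      rw [norm_mul]
      exact mul_le_mul (hF'a y) ((norm_sub_le _ _).trans (add_le_add (hdaP y) (hdbP y)))
        (norm_nonneg _) hS0'
    have m2 : EssBddBy ((S' + S') * P)
        (fun y => (deriv F (a y + τ * da y) - deriv F (b y + τ * db y)) * db y) := by
      refine .of_continuous (((hF'.comp (hca τ)).sub (hF'.comp (hcb τ))).mul hdb) fun y => ?_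
      rw [norm_mul]
      exact mul_le_mul ((norm_sub_le _ _).trans (add_le_add (hF'a y) (hF'b y))) (hdbP y)
        (norm_nonneg _) (by positivity)
    rw [e, conv_add_right k m1 m2]
    exact (enorm_add_le _ _).trans (add_le_add (hβ τ hτ) (hγ τ hτ))

end FrequencyBounds

/-! ### Dyadic blocks of products at a lower frequency -/

section BlockBounds

set_option linter.unusedSectionVars false

variable {E : Type} [NormedAddCommGroup E] [InnerProductSpace ℝ E] [FiniteDimensional ℝ E]
  [MeasurableSpace E] [BorelSpace E]

/-- The gain `2^{-K n}` for `n ≥ 0`, and `1` for `n ≤ 0`. -/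
noncomputable def freqGain (K : ℕ) (n : ℤ) : ℝ≥0∞ := ENNReal.ofReal (((2 : ℝ) ^ (-(max n 0))) ^ K)

/-- The sum of the derivatives of `Y` of order at most `K`, normalized at frequency `2^j`. -/
noncomputable def scaledJet (K : ℕ) (j : ℤ) (Y : E → ℝ) (y : E) : ℝ≥0∞ :=
  ∑ i ∈ Finset.range (K + 1), ENNReal.ofReal (((2 : ℝ) ^ (-j)) ^ i) * ‖iteratedFDeriv ℝ i Y y‖ₑ

/-- `X` is bounded by `X₀` and lives at frequencies at most `2^j`, up to the order `K` and the
constant `L`. -/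
def IsAtScale (K : ℕ) (L : ℝ) (j : ℤ) (X₀ : ℝ) (X : E → ℝ) : Prop :=
  ContDiff ℝ K X ∧ ∀ i ≤ K, ∀ y, ‖iteratedFDeriv ℝ i X y‖ ≤ L * X₀ * ((2 : ℝ) ^ j) ^ i

theorem measurable_scaledJet {K : ℕ} {Y : E → ℝ} (hY : ContDiff ℝ K Y) (j : ℤ) :
    Measurable (scaledJet K j Y) := by
  refine Finset.measurable_fun_sum _ fun i hi => Measurable.const_mul ?_ _
  refine (hY.continuous_iteratedFDeriv ?_).enorm.measurable
  exact_mod_cast Nat.lt_succ_iff.1 (Finset.mem_range.1 hi)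

/-- Derivatives of order `K` of the product cost `2^{jK}`, and the block at frequency `2^q` returns
`2^{-qK}`; this is useful only for `q > j`. For `q ≤ j` the integrability of the kernel is enough.
The function `ζ` depends on `q` and `j` alone, so that Young's inequality can be applied later in
any `L^p`. -/
theorem IsLPFamily.exists_block_bound {act : ℤ → Prop} {A B : ℤ → 𝓢(E, ℝ)}
    (h : IsLPFamily act A B) (K : ℕ) {L : ℝ} (hL : 1 ≤ L) :
    ∃ C : ℝ≥0, ∀ q j, act j → ∃ ζ : E → ℝ≥0∞, Measurable ζ ∧ ∫⁻ x, ζ x ≤ C ∧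
      ∀ (G : ℝ → ℝ) (c X Y : E → ℝ) (R M X₀ : ℝ), 0 < R → 0 ≤ M → 0 ≤ X₀ → ContDiff ℝ K G →
      IsAtScale K L j R c → (∀ i ≤ K, ∀ y, |iteratedDeriv i G (c y)| * R ^ i ≤ M) →
      IsAtScale K L j X₀ X → HasBddDerivs K Y → ∀ x,
      ‖conv (B q) (fun y => G (c y) * X y * Y y) x‖ₑ ≤
        freqGain K (q - j) * ENNReal.ofReal (M * X₀) * ∫⁻ y, ζ (x - y) * scaledJet K j Y y := by
  obtain ⟨Cs, hCs⟩ := h.smoothing K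
  obtain ⟨Cb, hCb⟩ := h.block_mass 0
  set D : ℝ := 4 ^ K * K.factorial * L ^ (K + 1) with hD
  have hD0 : 0 ≤ D := by positivity
  refine ⟨D.toNNReal * (Cs + Cb), fun q j hj => ?_⟩
  have hΛ : (0 : ℝ) < (2 : ℝ) ^ j := by positivity
  have real_bound : ∀ (G : ℝ → ℝ) (c X Y : E → ℝ) (R M X₀ : ℝ), 0 < R → 0 ≤ M → 0 ≤ X₀ →
      ContDiff ℝ K G → IsAtScale K L j R c →
      (∀ i ≤ K, ∀ y, |iteratedDeriv i G (c y)| * R ^ i ≤ M) → IsAtScale K L j X₀ X →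
      HasBddDerivs K Y → HasBddDerivs K (fun y => G (c y) * X y * Y y) ∧ ∀ n ≤ K, ∀ y,
      ‖iteratedFDeriv ℝ n (fun y => G (c y) * X y * Y y) y‖ₑ ≤
        ENNReal.ofReal D * ENNReal.ofReal (M * X₀) * ∑ i ∈ Finset.range (n + 1),
          ENNReal.ofReal (((2 : ℝ) ^ j) ^ (n - i)) * ‖iteratedFDeriv ℝ i Y y‖ₑ := by
    intro G c X Y R M X₀ hR hM hX₀ hG hc hGb hX hY
    have hn : ∀ n ≤ K, ∀ y, ‖iteratedFDeriv ℝ n (fun y => G (c y) * X y * Y y) y‖ ≤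
        D * (M * X₀) * ∑ i ∈ Finset.range (n + 1),
          ((2 : ℝ) ^ j) ^ (n - i) * ‖iteratedFDeriv ℝ i Y y‖ := fun n hn y =>
      norm_iteratedFDeriv_triple_le hG hc.1 hX.1 hY.1 hR hL hΛ.le hM hX₀ (fun i hi => hc.2 i hi y)
        (fun i hi => hGb i hi y) (fun i hi => hX.2 i hi y) hn
    refine ⟨⟨((hG.comp hc.1).mul hX.1).mul hY.1, fun n hnK => ?_⟩, fun n hnK y => ?_⟩
    · choose! S hS using hY.2
      refine ⟨D * (M * X₀) * ∑ i ∈ Finset.range (n + 1), ((2 : ℝ) ^ j) ^ (n - i) * S i,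
        fun y => (hn n hnK y).trans ?_⟩
      gcongr with i hi
      exact hS i (by have := Finset.mem_range.1 hi; omega) y
    · rw [← ofReal_norm, ← ENNReal.ofReal_mul hD0]
      refine (ENNReal.ofReal_le_ofReal (hn n hnK y)).trans (le_of_eq ?_)
      rw [ENNReal.ofReal_mul (by positivity), ENNReal.ofReal_sum_of_nonneg fun i _ => by positivity]
      congr 1
      refine Finset.sum_congr rfl fun i _ => ?_
      rw [ENNReal.ofReal_mul (by positivity), ofReal_norm]
  by_cases hqj : j < q
  -- The active index `j < q` is precisely what the smoothing property asks for.
  · obtain ⟨ζ, hζm, hζC, hζ⟩ := hCs q ⟨j, hqj, hj⟩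
    refine ⟨fun x => ENNReal.ofReal D * ζ x, hζm.const_mul _, ?_, ?_⟩
    · rw [lintegral_const_mul' _ _ ENNReal.ofReal_ne_top]
      push_cast
      change ENNReal.ofReal D * _ ≤ ENNReal.ofReal D * _
      gcongr
      exact hζC.trans le_self_add
    · intro G c X Y R M X₀ hR hM hX₀ hG hc hGb hX hY x
      obtain ⟨hw, hb⟩ := real_bound G c X Y R M X₀ hR hM hX₀ hG hc hGb hX hY
      refine (hζ _ hw x).trans ?_
      rw [← lintegral_const_mul' _ _ ENNReal.ofReal_ne_top,
        ← lintegral_const_mul' (freqGain K (q - j) * ENNReal.ofReal (M * X₀)) _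
          (ENNReal.mul_ne_top ENNReal.ofReal_ne_top ENNReal.ofReal_ne_top)]
      refine lintegral_mono fun y => ?_
      -- When `i` derivatives fall on `Y`, the powers recombine as `2^{-qK} 2^{j(K-i)} = 2^{-(q-j)K}
      -- 2^{-ji}`; the last factor is the normalization of the jet.
      have hexp : ∀ i ∈ Finset.range (K + 1), ENNReal.ofReal (((2 : ℝ) ^ (-q)) ^ K) *
          ENNReal.ofReal (((2 : ℝ) ^ j) ^ (K - i))
          = freqGain K (q - j) * ENNReal.ofReal (((2 : ℝ) ^ (-j)) ^ i) := by
        intro i hi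
        have hi' : i ≤ K := Nat.lt_succ_iff.1 (Finset.mem_range.1 hi)
        rw [freqGain, max_eq_left (by omega), ← ENNReal.ofReal_mul (by positivity),
          ← ENNReal.ofReal_mul (by positivity)]
        congr 1
        simp only [← zpow_natCast, ← zpow_mul]
        rw [← zpow_add₀ (two_ne_zero' ℝ), ← zpow_add₀ (two_ne_zero' ℝ)]
        congr 1
        push_cast [hi']
        ring
      calc ENNReal.ofReal (((2 : ℝ) ^ (-q)) ^ K) *
            (ζ (x - y) * ‖iteratedFDeriv ℝ K (fun y => G (c y) * X y * Y y) y‖ₑ)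
          ≤ ENNReal.ofReal (((2 : ℝ) ^ (-q)) ^ K) * (ζ (x - y) * (ENNReal.ofReal D *
            ENNReal.ofReal (M * X₀) * ∑ i ∈ Finset.range (K + 1),
            ENNReal.ofReal (((2 : ℝ) ^ j) ^ (K - i)) * ‖iteratedFDeriv ℝ i Y y‖ₑ)) := by
            gcongr
            exact hb K le_rfl y
        _ = ζ (x - y) * (ENNReal.ofReal D * ENNReal.ofReal (M * X₀)) *
            ∑ i ∈ Finset.range (K + 1), (ENNReal.ofReal (((2 : ℝ) ^ (-q)) ^ K) *
            ENNReal.ofReal (((2 : ℝ) ^ j) ^ (K - i))) * ‖iteratedFDeriv ℝ i Y y‖ₑ := by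
            simp_rw [mul_assoc (ENNReal.ofReal (((2 : ℝ) ^ (-q)) ^ K)), ← Finset.mul_sum]
            ring
        _ = ζ (x - y) * (ENNReal.ofReal D * ENNReal.ofReal (M * X₀)) *
            (freqGain K (q - j) * scaledJet K j Y y) := by
            congr 1
            rw [scaledJet, Finset.mul_sum]
            refine Finset.sum_congr rfl fun i hi => ?_
            rw [hexp i hi, mul_assoc]
        _ = _ := by ring
  · refine ⟨fun x => ENNReal.ofReal D * ‖B q x‖ₑ, (B q).continuous.enorm.measurable.const_mul _,
      ?_, ?_⟩
    · rw [lintegral_const_mul' _ _ ENNReal.ofReal_ne_top, ← kernelMass_zero_eq]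
      push_cast
      change ENNReal.ofReal D * _ ≤ ENNReal.ofReal D * _
      gcongr
      refine le_trans ?_ le_add_self
      simpa using hCb q
    · intro G c X Y R M X₀ hR hM hX₀ hG hc hGb hX hY x
      obtain ⟨hw, hb⟩ := real_bound G c X Y R M X₀ hR hM hX₀ hG hc hGb hX hY
      have hdec : freqGain K (q - j) = 1 := by
        rw [freqGain, max_eq_right (by omega)]
        simp
      rw [hdec, one_mul, ← lintegral_const_mul' _ _ ENNReal.ofReal_ne_top]
      unfold conv
      refine (enorm_integral_le_lintegral_enorm _).trans (lintegral_mono fun y => ?_)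
      rw [enorm_smul]
      have h0 := hb 0 (Nat.zero_le _) y
      rw [← ofReal_norm, norm_iteratedFDeriv_zero, ofReal_norm] at h0
      simp only [zero_add, Finset.range_one, Finset.sum_singleton, Nat.sub_self, pow_zero,
        ENNReal.ofReal_one, one_mul] at h0
      have h1 : ‖iteratedFDeriv ℝ 0 Y y‖ₑ ≤ scaledJet K j Y y := by
        have := Finset.single_le_sum (s := Finset.range (K + 1)) (f := fun i =>
          ENNReal.ofReal (((2 : ℝ) ^ (-j)) ^ i) * ‖iteratedFDeriv ℝ i Y y‖ₑ)
          (fun i _ => zero_le) (Finset.mem_range.2 (Nat.succ_pos K))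
        refine le_trans (le_of_eq ?_) this
        simp
      calc ‖G (c y) * X y * Y y‖ₑ * ‖B q (x - y)‖ₑ
          ≤ ENNReal.ofReal D * ENNReal.ofReal (M * X₀) * scaledJet K j Y y * ‖B q (x - y)‖ₑ := by
            gcongr
            exact h0.trans (by gcongr)
        _ = _ := by ring

/-- Bernstein's inequality for the dyadic blocks. -/
theorem IsLPFamily.exists_bernstein {act : ℤ → Prop} {A B : ℤ → 𝓢(E, ℝ)}
    (h : IsLPFamily act A B) (K : ℕ) : ∃ C : ℝ≥0, ∀ (j : ℤ) (R : ℝ) (f : E → ℝ), EssBddBy R f →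
      ∀ p : ℝ≥0∞, 1 ≤ p → eLpNorm (scaledJet K j (conv (B j) f)) p volume ≤
        C * eLpNorm (conv (B j) f) p volume := by
  obtain ⟨χ, hχ⟩ := h.reproducing
  refine ⟨∑ i ∈ Finset.range (K + 1), (kernelMass i χ).toNNReal, fun j R f hf p hp => ?_⟩
  have hd : EssBddBy _ (conv (B j) f) := essBddBy_conv hf (B j)
  -- A block is its own convolution with `dil j χ`, so its derivatives can be put on this kernel, at
  -- a cost `2^{ji}` which the normalization cancels.
  have hrep : conv (B j) f = conv (dil j χ) (conv (B j) f) :=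
    (funext fun x => hχ j R f hf x).symm
  have hcont : ∀ i : ℕ, Continuous (iteratedFDeriv ℝ i (conv (B j) f)) := fun i =>
    (contDiff_conv_nat hf i (B j)).continuous_iteratedFDeriv le_rfl
  unfold scaledJet
  refine (eLpNorm_finset_sum_le_ennreal hp _ fun i =>
    ((hcont i).enorm.measurable.const_mul _).aemeasurable).trans ?_
  push_cast
  rw [Finset.sum_mul]
  refine Finset.sum_le_sum fun i _ => ?_
  rw [eLpNorm_const_mul_ennreal hp _ (hcont i).enorm.measurable.aemeasurable,
    ENNReal.coe_toNNReal (kernelMass_lt_top i χ).ne]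
  have h1 := eLpNorm_iteratedFDeriv_conv_le hp hd i (dil j χ)
  rw [← hrep, kernelMass_dil] at h1
  refine (mul_le_mul_right h1 _).trans (le_of_eq ?_)
  rw [← mul_assoc, ← mul_assoc, ← ENNReal.ofReal_mul (by positivity), ← mul_pow,
    ← zpow_add₀ (two_ne_zero' ℝ)]
  simp

end BlockBounds

/-! ### The nonlinear estimate for regular functions -/

section RegularEstimate

set_option linter.unusedSectionVars false

variable {E : Type} [NormedAddCommGroup E] [InnerProductSpace ℝ E] [FiniteDimensional ℝ E]
  [MeasurableSpace E] [BorelSpace E]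

/-- The bounds are convex conditions, hence they persist along the segments of the mean value
inequalities. -/
theorem IsAtScale.combination {K : ℕ} {L : ℝ} {j : ℤ} {X₀ : ℝ} {a b : E → ℝ}
    (ha : IsAtScale K L j X₀ a) (hb : IsAtScale K L j X₀ b) {s t : ℝ} (hs : 0 ≤ s) (ht : 0 ≤ t)
    (hst : s + t = 1) : IsAtScale K L j X₀ (fun y => s • a y + t • b y) := by
  refine ⟨(ha.1.const_smul s).add (hb.1.const_smul t), fun i hi y => ?_⟩
  have hai : ContDiffAt ℝ i a y := (ha.1.of_le (by exact_mod_cast hi)).contDiffAt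
  have hbi : ContDiffAt ℝ i b y := (hb.1.of_le (by exact_mod_cast hi)).contDiffAt
  have e : iteratedFDeriv ℝ i (fun y => s • a y + t • b y) y
      = s • iteratedFDeriv ℝ i a y + t • iteratedFDeriv ℝ i b y := by
    rw [← iteratedFDeriv_const_smul_apply' hai, ← iteratedFDeriv_const_smul_apply' hbi]
    exact iteratedFDeriv_add_apply (hai.const_smul s) (hbi.const_smul t)
  rw [e]
  refine (norm_add_le _ _).trans ?_
  rw [norm_smul, norm_smul, Real.norm_of_nonneg hs, Real.norm_of_nonneg ht]
  calc s * ‖iteratedFDeriv ℝ i a y‖ + t * ‖iteratedFDeriv ℝ i b y‖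
      ≤ s * (L * X₀ * ((2 : ℝ) ^ j) ^ i) + t * (L * X₀ * ((2 : ℝ) ^ j) ^ i) := by
        gcongr
        · exact ha.2 i hi y
        · exact hb.2 i hi y
    _ = _ := by rw [← add_mul, hst, one_mul]

theorem IsAtScale.mono {K : ℕ} {L : ℝ} (hL : 0 ≤ L) {j : ℤ} {X₀ X₁ : ℝ} (h : X₀ ≤ X₁) {a : E → ℝ}
    (ha : IsAtScale K L j X₀ a) : IsAtScale K L j X₁ a :=
  ⟨ha.1, fun i hi y => (ha.2 i hi y).trans (by gcongr)⟩

theorem IsAtScale.abs_le {K : ℕ} {L : ℝ} {j : ℤ} {X₀ : ℝ} {a : E → ℝ} (ha : IsAtScale K L j X₀ a)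
    (y : E) : |a y| ≤ L * X₀ := by
  simpa using ha.2 0 (Nat.zero_le _) y

/-- Two consecutive cut-offs are measured at the same frequency `2^j`, in order to interpolate
between them; the factor `2^K` in the constant absorbs the shift of index. -/
theorem IsLPFamily.exists_isAtScale {act : ℤ → Prop} {A B : ℤ → 𝓢(E, ℝ)}
    (h : IsLPFamily act A B) (K : ℕ) : ∃ L : ℝ, 1 ≤ L ∧ ∀ (j : ℤ) (R : ℝ) (f : E → ℝ), EssBddBy R f →
      IsAtScale K L j (eLpNorm f ∞ volume).toReal (conv (A j) f) ∧
      IsAtScale K L j (eLpNorm f ∞ volume).toReal (conv (A (j + 1)) f) := by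
  choose C hC using h.low_mass
  set L : ℝ := 1 + 2 ^ K * ∑ i ∈ Finset.range (K + 1), (C i : ℝ) with hL
  have hL1 : 1 ≤ L := by
    have : 0 ≤ 2 ^ K * ∑ i ∈ Finset.range (K + 1), (C i : ℝ) := by positivity
    linarith
  refine ⟨L, hL1, fun j R f hf => ?_⟩
  have hfin : eLpNorm f ∞ volume ≠ ∞ := (hf.eLpNorm_le.trans_lt ENNReal.ofReal_lt_top).ne
  have main : ∀ l : ℤ, l = j ∨ l = j + 1 →
      IsAtScale K L j (eLpNorm f ∞ volume).toReal (conv (A l) f) := by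
    intro l hl
    refine ⟨contDiff_conv_nat hf K _, fun i hi y => ?_⟩
    have h1 := (enorm_iteratedFDeriv_conv_le_top hf i (A l) y).trans
      (mul_le_mul_left (hC i l) _)
    rw [← ofReal_norm] at h1
    have h2 := ENNReal.toReal_mono (ENNReal.mul_ne_top (ENNReal.mul_ne_top ENNReal.coe_ne_top
      ENNReal.ofReal_ne_top) hfin) h1
    rw [ENNReal.toReal_ofReal (norm_nonneg _), ENNReal.toReal_mul, ENNReal.toReal_mul,
      ENNReal.toReal_ofReal (by positivity), ENNReal.coe_toReal] at h2
    refine h2.trans ?_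
    have h3 : ((2 : ℝ) ^ l) ^ i ≤ 2 ^ K * ((2 : ℝ) ^ j) ^ i := by
      have h20 : (2 : ℝ) ^ l ≤ 2 * (2 : ℝ) ^ j := by
        have hp : (0 : ℝ) < 2 ^ j := by positivity
        rcases hl with rfl | rfl
        · linarith
        · rw [zpow_add₀ (two_ne_zero' ℝ), zpow_one, mul_comm]
      calc ((2 : ℝ) ^ l) ^ i ≤ (2 * (2 : ℝ) ^ j) ^ i := by gcongr
        _ = 2 ^ i * ((2 : ℝ) ^ j) ^ i := mul_pow _ _ _
        _ ≤ 2 ^ K * ((2 : ℝ) ^ j) ^ i := by gcongr; norm_num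
    have h4 : (C i : ℝ) ≤ ∑ i ∈ Finset.range (K + 1), (C i : ℝ) :=
      Finset.single_le_sum (f := fun i => (C i : ℝ)) (fun i _ => (C i).2)
        (Finset.mem_range.2 (Nat.lt_succ_of_le hi))
    have h5 : (C i : ℝ) * 2 ^ K ≤ L := by
      have : (C i : ℝ) * 2 ^ K ≤ 2 ^ K * ∑ i ∈ Finset.range (K + 1), (C i : ℝ) := by
        rw [mul_comm]
        gcongr
      linarith
    calc (C i : ℝ) * ((2 : ℝ) ^ l) ^ i * (eLpNorm f ∞ volume).toReal
        ≤ (C i : ℝ) * (2 ^ K * ((2 : ℝ) ^ j) ^ i) * (eLpNorm f ∞ volume).toReal := by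
          gcongr
      _ = ((C i : ℝ) * 2 ^ K) * ((eLpNorm f ∞ volume).toReal * ((2 : ℝ) ^ j) ^ i) := by ring
      _ ≤ L * ((eLpNorm f ∞ volume).toReal * ((2 : ℝ) ^ j) ^ i) := by gcongr
      _ = _ := by ring
  exact ⟨main j (Or.inl rfl), main _ (Or.inr rfl)⟩

theorem hasBddDerivs_conv {R : ℝ} {f : E → ℝ} (hf : EssBddBy R f) (k : 𝓢(E, ℝ)) (K : ℕ) :
    HasBddDerivs K (conv k f) :=
  ⟨contDiff_conv_nat hf K k, fun i _ => ⟨_, norm_iteratedFDeriv_conv_le hf i k⟩⟩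

/-- The bounds on the nonlinearity which enter the estimate: `F'(0) = 0`, and the derivatives of `F''`
up to the order `K` are bounded on the ball of radius `ρ`, with the weights given by the scale `R`. -/
structure IsNonlinearity (K : ℕ) (ρ R M : ℝ) (F : ℝ → ℝ) : Prop where
  contDiff : ContDiff ℝ ((K + 2 : ℕ) : WithTop ℕ∞) F
  deriv_zero : deriv F 0 = 0
  bound : ∀ i ≤ K, ∀ t, |t| ≤ ρ → |iteratedDeriv i (deriv (deriv F)) t| * R ^ i ≤ M

theorem IsNonlinearity.contDiff_deriv {K : ℕ} {ρ R M : ℝ} {F : ℝ → ℝ}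
    (h : IsNonlinearity K ρ R M F) : ContDiff ℝ ((K + 1 : ℕ) : WithTop ℕ∞) (deriv F) := by
  have := h.contDiff
  rw [show ((K + 2 : ℕ) : WithTop ℕ∞) = ((K + 1 : ℕ) : WithTop ℕ∞) + 1 by norm_cast] at this
  exact (contDiff_succ_iff_deriv.1 this).2.2

theorem IsNonlinearity.contDiff_deriv_deriv {K : ℕ} {ρ R M : ℝ} {F : ℝ → ℝ}
    (h : IsNonlinearity K ρ R M F) : ContDiff ℝ K (deriv (deriv F)) := by
  have := h.contDiff_deriv
  rw [show ((K + 1 : ℕ) : WithTop ℕ∞) = (K : WithTop ℕ∞) + 1 by norm_cast] at this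
  exact (contDiff_succ_iff_deriv.1 this).2.2

/-- The increment of `F(f) - F(g)` between the frequencies `2^j` and `2^{j+1}`. -/
noncomputable def increment (A : ℤ → 𝓢(E, ℝ)) (F : ℝ → ℝ) (f g : E → ℝ) (j : ℤ) (y : E) : ℝ :=
  (F (conv (A (j + 1)) f y) - F (conv (A (j + 1)) g y)) - (F (conv (A j) f y) - F (conv (A j) g y))

/-- Two mean value inequalities, in `τ` between consecutive cut-offs and in `σ` between the
arguments of `F'`, reduce the increment to products `F''(c) X Y`. The block bound, Young's
inequality and Bernstein's inequality then give the norms of the blocks `Y` themselves. -/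
theorem IsLPFamily.exists_increment_bound {act : ℤ → Prop} {A B : ℤ → 𝓢(E, ℝ)}
    (h : IsLPFamily act A B) (K : ℕ) : ∃ (ρ : ℝ) (C : ℝ≥0), 1 ≤ ρ ∧
      ∀ (F : ℝ → ℝ) (R M : ℝ), 0 < R → 0 ≤ M → IsNonlinearity K (ρ * R) R M F →
      ∀ f g : E → ℝ, EssBddBy R f → EssBddBy R g → ∀ (p : ℝ≥0∞), 1 ≤ p → ∀ q j,
      eLpNorm (conv (B q) (increment A F f g j)) p volume ≤ C * ENNReal.ofReal M *
        (freqGain K (q - j) * (eLpNorm f ∞ volume *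
          eLpNorm (conv (B j) (fun y => f y - g y)) p volume +
          eLpNorm (fun y => f y - g y) ∞ volume * eLpNorm (conv (B j) g) p volume)) := by
  obtain ⟨L, hL1, hL⟩ := h.exists_isAtScale K
  obtain ⟨C₁, hC₁⟩ := h.exists_block_bound K hL1
  obtain ⟨C₂, hC₂⟩ := h.exists_bernstein K
  -- The radius is enlarged by `L` because the intermediate points are only bounded by `L R`: the
  -- kernels are not positive.
  refine ⟨L, C₁ * C₂, hL1, fun F R M hR hM hF f g hf hg p hp q j => ?_⟩
  have hL0 : 0 ≤ L := by linarith
  have hu : EssBddBy (R + R) (fun y => f y - g y) := hf.sub hg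
  set Sf := (eLpNorm f ∞ volume).toReal with hSf
  set Su := (eLpNorm (fun y => f y - g y) ∞ volume).toReal with hSu
  have hfin : ∀ {S : ℝ} {v : E → ℝ}, EssBddBy S v → eLpNorm v ∞ volume ≠ ∞ := fun hv =>
    (hv.eLpNorm_le.trans_lt ENNReal.ofReal_lt_top).ne
  have hleR : ∀ {v : E → ℝ}, EssBddBy R v → (eLpNorm v ∞ volume).toReal ≤ R := fun hv =>
    ENNReal.toReal_le_of_le_ofReal hR.le hv.eLpNorm_le
  have hadd : ∀ {S : ℝ} {v : E → ℝ}, EssBddBy S v → ∀ y,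
      conv (A (j + 1)) v y = conv (A j) v y + conv (B j) v y := fun hv y => by
    rw [h.add j, conv_add _ _ hv]
  by_cases hact : act j
  swap
  -- An absent block leaves the cut-off unchanged, so the increment vanishes.
  · have h0 : increment A F f g j = fun _ => 0 := by
      funext y
      unfold increment
      rw [hadd hf, hadd hg, h.inactive j hact]
      simp
    have h1 : conv (B q) (fun _ : E => (0 : ℝ)) = 0 := by
      funext x
      simp [conv]
    rw [h0, h1]
    simp
  obtain ⟨ζ, hζm, hζC, hζ⟩ := hC₁ q j hact
  have haf := hL j R f hf
  have hag := hL j R g hg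
  have hau := hL j _ _ hu
  have hF1 : ContDiff ℝ 1 F := hF.contDiff.of_le (by norm_cast; omega)
  have hG1 : ContDiff ℝ 1 (deriv F) := hF.contDiff_deriv.of_le (by norm_cast; omega)
  -- the intermediate points between two consecutive low-frequency parts
  have hint : ∀ {S : ℝ} {v : E → ℝ} (_ : EssBddBy S v), ∀ τ ∈ Set.Icc (0 : ℝ) 1,
      IsAtScale K L j (eLpNorm v ∞ volume).toReal
        (fun y => conv (A j) v y + τ * conv (B j) v y) := by
    intro S v hv τ hτ
    obtain ⟨h1, h2⟩ := hL j S v hv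
    have := h1.combination h2 (s := 1 - τ) (t := τ) (by linarith [hτ.2]) hτ.1 (by ring)
    convert this using 2 with y
    rw [hadd hv, smul_eq_mul, smul_eq_mul]
    ring
  obtain ⟨P, hP⟩ : ∃ P : ℝ, (∀ y, |conv (A j) f y| ≤ P) ∧ (∀ y, |conv (A j) g y| ≤ P) ∧
      (∀ y, |conv (B j) f y| ≤ P) ∧ (∀ y, |conv (B j) g y| ≤ P) ∧
      (∀ y, |conv (B j) (fun y => f y - g y) y| ≤ P) ∧ L * R ≤ P := by
    refine ⟨max (max (max ((kernelMass 0 (A j)).toReal * R) ((kernelMass 0 (B j)).toReal * R))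
      ((kernelMass 0 (B j)).toReal * (R + R))) (L * R), ?_, ?_, ?_, ?_, ?_, le_max_right _ _⟩
    · exact fun y => (norm_conv_le hf (A j) y).trans
        (le_max_of_le_left (le_max_of_le_left (le_max_left _ _)))
    · exact fun y => (norm_conv_le hg (A j) y).trans
        (le_max_of_le_left (le_max_of_le_left (le_max_left _ _)))
    · exact fun y => (norm_conv_le hf (B j) y).trans
        (le_max_of_le_left (le_max_of_le_left (le_max_right _ _)))
    · exact fun y => (norm_conv_le hg (B j) y).trans
        (le_max_of_le_left (le_max_of_le_left (le_max_right _ _)))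
    · exact fun y => (norm_conv_le hu (B j) y).trans
        (le_max_of_le_left (le_max_right _ _))
  obtain ⟨hPaf, hPag, hPdf, hPdg, hPdu, hPL⟩ := hP
  have caf := continuous_conv hf (A j)
  have cag := continuous_conv hg (A j)
  have cdf := continuous_conv hf (B j)
  have cdg := continuous_conv hg (B j)
  have cdu := continuous_conv hu (B j)
  have hdu : ∀ y, conv (B j) f y - conv (B j) g y = conv (B j) (fun y => f y - g y) y := fun y =>
    (conv_sub_right _ hf hg y).symm
  have hau' : ∀ τ y, (conv (A j) f y + τ * conv (B j) f y) - (conv (A j) g y + τ * conv (B j) g y)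
      = conv (A j) (fun y => f y - g y) y + τ * conv (B j) (fun y => f y - g y) y := fun τ y => by
    rw [conv_sub_right _ hf hg, conv_sub_right _ hf hg]
    ring
  have hrange : ∀ {c : E → ℝ}, IsAtScale K L j R c →
      ∀ i ≤ K, ∀ y, |iteratedDeriv i (deriv (deriv F)) (c y)| * R ^ i ≤ M := fun hc i hi y =>
    hF.bound i hi _ (hc.abs_le y)
  set V₁ := fun x => ∫⁻ y, ζ (x - y) * scaledJet K j (conv (B j) fun y => f y - g y) y with hV₁
  set V₂ := fun x => ∫⁻ y, ζ (x - y) * scaledJet K j (conv (B j) g) y with hV₂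
  have hpt : ∀ x, ‖conv (B q) (increment A F f g j) x‖ₑ ≤
      freqGain K (q - j) * ENNReal.ofReal (M * Sf) * V₁ x +
      freqGain K (q - j) * ENNReal.ofReal (M * Su) * V₂ x := by
    intro x
    have e : increment A F f g j = fun y =>
        (F (conv (A j) f y + conv (B j) f y) - F (conv (A j) g y + conv (B j) g y)) -
        (F (conv (A j) f y) - F (conv (A j) g y)) := by
      funext y
      rw [increment, hadd hf, hadd hg]
    rw [e]
    refine enorm_conv_increment_le (B q) hF1 caf cag cdf cdg hPaf hPag hPdf hPdg ?_ ?_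
    · intro τ hτ
      have hsc := hint hf τ hτ
      have hscR := hsc.mono hL0 (hleR hf)
      -- Since `F'(0) = 0`, the value of `F'` is itself a difference, relative to the zero function,
      -- and the second mean value inequality applies.
      have e1 : (fun y => deriv F (conv (A j) f y + τ * conv (B j) f y) *
          (conv (B j) f y - conv (B j) g y)) = fun y =>
          (deriv F (conv (A j) f y + τ * conv (B j) f y) - deriv F ((fun _ => (0 : ℝ)) y)) *
          conv (B j) (fun y => f y - g y) y := by
        funext y
        rw [hF.deriv_zero, sub_zero, hdu]
      rw [e1]
      refine enorm_conv_diff_mul_le (B q) hG1 (caf.add (continuous_const.mul cdf))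
        continuous_const cdu (P := P) (fun y => (hscR.abs_le y).trans hPL)
        (fun y => by simpa using (abs_nonneg _).trans (hPaf y)) hPdu fun σ hσ => ?_
      have hc : IsAtScale K L j R
          (fun y => (0 : ℝ) + σ * ((conv (A j) f y + τ * conv (B j) f y) - 0)) := by
        have h0 : IsAtScale K L j R (fun _ : E => (0 : ℝ)) := by
          refine ⟨contDiff_const, fun i hi y => ?_⟩
          rw [iteratedFDeriv_fun_zero]
          simp only [Pi.zero_apply, norm_zero]
          positivity
        have := h0.combination hscR (s := 1 - σ) (t := σ) (by linarith [hσ.2]) hσ.1 (by ring)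
        convert this using 2 with y
        simp
      -- The argument of `F''` is measured with the crude amplitude `R`, but the factor `X` with the
      -- actual supremum of `f`, which must appear linearly in the bound.
      have hX : IsAtScale K L j Sf
          (fun y => (conv (A j) f y + τ * conv (B j) f y) - (0 : ℝ)) := by
        simp only [sub_zero]
        exact hsc
      exact hζ _ _ _ _ R M Sf hR hM ENNReal.toReal_nonneg hF.contDiff_deriv_deriv hc (hrange hc) hX
        (hasBddDerivs_conv hu _ K) x
    · intro τ hτ
      have hscf := (hint hf τ hτ).mono hL0 (hleR hf)
      have hscg := (hint hg τ hτ).mono hL0 (hleR hg)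
      refine enorm_conv_diff_mul_le (B q) hG1 (caf.add (continuous_const.mul cdf))
        (cag.add (continuous_const.mul cdg)) cdg (P := P) (fun y => (hscf.abs_le y).trans hPL)
        (fun y => (hscg.abs_le y).trans hPL) hPdg fun σ hσ => ?_
      have hc : IsAtScale K L j R (fun y => (conv (A j) g y + τ * conv (B j) g y) +
          σ * ((conv (A j) f y + τ * conv (B j) f y) - (conv (A j) g y + τ * conv (B j) g y))) := by
        have := hscg.combination hscf (s := 1 - σ) (t := σ) (by linarith [hσ.2]) hσ.1 (by ring)
        convert this using 2 with y
        simp only [smul_eq_mul]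
        ring
      have hX : IsAtScale K L j Su (fun y =>
          (conv (A j) f y + τ * conv (B j) f y) - (conv (A j) g y + τ * conv (B j) g y)) := by
        simp_rw [hau']
        exact hint hu τ hτ
      exact hζ _ _ _ _ R M Su hR hM ENNReal.toReal_nonneg hF.contDiff_deriv_deriv hc (hrange hc) hX
        (hasBddDerivs_conv hg _ K) x
  have hjet : ∀ {S : ℝ} {v : E → ℝ} (_ : EssBddBy S v),
      AEMeasurable (scaledJet K j (conv (B j) v)) volume := fun hv =>
    (measurable_scaledJet (contDiff_conv_nat hv K _) j).aemeasurable
  have hVm : ∀ {S : ℝ} {v : E → ℝ} (_ : EssBddBy S v),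
      AEMeasurable (fun x => ∫⁻ y, ζ (x - y) * scaledJet K j (conv (B j) v) y) volume := by
    intro S v hv
    refine (Measurable.lintegral_prod_right' (f := fun z : E × E =>
      ζ (z.1 - z.2) * scaledJet K j (conv (B j) v) z.2) ?_).aemeasurable
    exact (hζm.comp (measurable_fst.sub measurable_snd)).mul
      ((measurable_scaledJet (contDiff_conv_nat hv K _) j).comp measurable_snd)
  have hV : ∀ {S : ℝ} {v : E → ℝ} (_ : EssBddBy S v),
      eLpNorm (fun x => ∫⁻ y, ζ (x - y) * scaledJet K j (conv (B j) v) y) p volume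
        ≤ C₁ * C₂ * eLpNorm (conv (B j) v) p volume := fun hv =>
    (eLpNorm_lintegral_conv_le hp hζm (hjet hv)).trans (by
      rw [mul_assoc]
      exact mul_le_mul' hζC (hC₂ j _ _ hv p hp))
  calc eLpNorm (conv (B q) (increment A F f g j)) p volume
      = eLpNorm (fun x => ‖conv (B q) (increment A F f g j) x‖ₑ) p volume := by
        rw [eLpNorm_enorm]
    _ ≤ eLpNorm (fun x => freqGain K (q - j) * ENNReal.ofReal (M * Sf) * V₁ x +
        freqGain K (q - j) * ENNReal.ofReal (M * Su) * V₂ x) p volume := eLpNorm_mono_ennreal hpt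
    _ ≤ freqGain K (q - j) * ENNReal.ofReal (M * Sf) * eLpNorm V₁ p volume +
        freqGain K (q - j) * ENNReal.ofReal (M * Su) * eLpNorm V₂ p volume := by
        refine (eLpNorm_add_le_ennreal hp ((hVm hu).const_mul _) ((hVm hg).const_mul _)).trans ?_
        rw [eLpNorm_const_mul_ennreal hp _ (hVm hu), eLpNorm_const_mul_ennreal hp _ (hVm hg)]
    _ ≤ freqGain K (q - j) * ENNReal.ofReal (M * Sf) *
          (C₁ * C₂ * eLpNorm (conv (B j) fun y => f y - g y) p volume) +
        freqGain K (q - j) * ENNReal.ofReal (M * Su) *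
          (C₁ * C₂ * eLpNorm (conv (B j) g) p volume) := by
        gcongr
        · exact hV hu
        · exact hV hg
    _ = _ := by
        rw [ENNReal.ofReal_mul hM, ENNReal.ofReal_mul hM, hSf, hSu, ENNReal.ofReal_toReal (hfin hf),
          ENNReal.ofReal_toReal (hfin hu)]
        push_cast
        ring

end RegularEstimate

/-! ### Telescoping over the frequencies -/

section Telescoping

set_option linter.unusedSectionVars false

variable {E : Type} [NormedAddCommGroup E] [InnerProductSpace ℝ E] [FiniteDimensional ℝ E]
  [MeasurableSpace E] [BorelSpace E]

/-- Dominated convergence in a convolution. -/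
theorem tendsto_conv_of_bounded (k : 𝓢(E, ℝ)) {w : ℕ → E → ℝ} {v : E → ℝ} {R : ℝ}
    (hw : ∀ n, EssBddBy R (w n))
    (h : ∀ᵐ y, Filter.Tendsto (fun n => w n y) Filter.atTop (nhds (v y))) (x : E) :
    Filter.Tendsto (fun n => conv k (w n) x) Filter.atTop (nhds (conv k v x)) := by
  refine tendsto_integral_of_dominated_convergence (fun y => R * ‖k (x - y)‖)
    (fun n => (integrable_conv (hw n) k x).aestronglyMeasurable)
    ((integrable_kernel_sub k x).norm.const_mul R) (fun n => ?_) ?_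
  · filter_upwards [(hw n).2] with y hy
    rw [norm_smul]
    gcongr
  · filter_upwards [h] with y hy
    exact hy.smul_const _

theorem exists_bound_on_Icc {G : ℝ → ℝ} (hG : Continuous G) (P : ℝ) :
    ∃ Q : ℝ, 0 ≤ Q ∧ ∀ t, |t| ≤ P → |G t| ≤ Q := by
  obtain ⟨Q, hQ⟩ := (isCompact_Icc (a := -P) (b := P)).exists_bound_of_continuousOn hG.continuousOn
  exact ⟨max Q 0, le_max_right _ _, fun t ht => (hQ t (abs_le.1 ht)).trans (le_max_left _ _)⟩

/-- The low-frequency parts of `F(f)` disappear at frequency zero. -/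
theorem tendsto_conv_comp_of_small_fderiv {k : 𝓢(E, ℝ)} {ζ : E → ℝ≥0∞} {C S : ℝ≥0∞} (hC : C ≠ ∞)
    (hS : S ≠ ∞) (hζC : ∫⁻ x, ζ x ≤ C)
    (hζ : ∀ w : E → ℝ, HasBddDerivs 1 w → ∀ x, ‖conv k w x‖ₑ ≤
      S * ∫⁻ y, ζ (x - y) * ‖iteratedFDeriv ℝ 1 w y‖ₑ)
    {F : ℝ → ℝ} (hF : ContDiff ℝ 1 F) {w : ℕ → E → ℝ} {P : ℝ} (hw : ∀ n, HasBddDerivs 1 (w n))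
    (hP : ∀ n y, |w n y| ≤ P) {δ : ℕ → ℝ} (hδ : ∀ n y, ‖iteratedFDeriv ℝ 1 (w n) y‖ ≤ δ n)
    (hδ0 : Filter.Tendsto δ Filter.atTop (nhds 0)) (x : E) :
    Filter.Tendsto (fun n => conv k (fun y => F (w n y)) x) Filter.atTop (nhds 0) := by
  obtain ⟨Q, hQ0, hQ⟩ := exists_bound_on_Icc hF.continuous P
  obtain ⟨Q', hQ0', hQ'⟩ := exists_bound_on_Icc (hF.continuous_deriv le_rfl) P
  have hd : ∀ n y, ‖iteratedFDeriv ℝ 1 (fun y => F (w n y)) y‖ ≤ Q' * δ n := by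
    intro n y
    have h1 : HasFDerivAt (fun y => F (w n y)) (deriv F (w n y) • fderiv ℝ (w n) y) y :=
      ((hF.differentiable one_ne_zero) _).hasDerivAt.comp_hasFDerivAt y
        (((hw n).1.differentiable (by simp)) y).hasFDerivAt
    rw [norm_iteratedFDeriv_one, h1.fderiv, norm_smul]
    have := hδ n y
    rw [norm_iteratedFDeriv_one] at this
    gcongr
    exact hQ' _ (hP n y)
  have hb : ∀ n, HasBddDerivs 1 (fun y => F (w n y)) := by
    intro n
    refine ⟨hF.comp (hw n).1, fun i hi => ?_⟩
    interval_cases i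
    · exact ⟨Q, fun y => by simpa using hQ _ (hP n y)⟩
    · exact ⟨_, hd n⟩
  have hle : ∀ n, ‖conv k (fun y => F (w n y)) x‖ₑ ≤ S * C * ENNReal.ofReal (Q' * δ n) := by
    intro n
    refine (hζ _ (hb n) x).trans ?_
    rw [mul_assoc]
    gcongr
    calc ∫⁻ y, ζ (x - y) * ‖iteratedFDeriv ℝ 1 (fun y => F (w n y)) y‖ₑ
        ≤ ∫⁻ y, ζ (x - y) * ENNReal.ofReal (Q' * δ n) := by
          refine lintegral_mono fun y => ?_
          beta_reduce
          rw [← ofReal_norm (iteratedFDeriv ℝ 1 (fun y => F (w n y)) y)]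
          gcongr
          exact hd n y
      _ = (∫⁻ y, ζ y) * ENNReal.ofReal (Q' * δ n) := by
          rw [lintegral_mul_const' _ _ ENNReal.ofReal_ne_top,
            lintegral_sub_left_eq_self (fun y => ζ y) x]
      _ ≤ _ := by gcongr
  rw [tendsto_zero_iff_enorm_tendsto_zero]
  refine tendsto_of_tendsto_of_tendsto_of_le_of_le tendsto_const_nhds ?_ (fun _ => zero_le) hle
  have h1 : Filter.Tendsto (fun n => ENNReal.ofReal (Q' * δ n)) Filter.atTop (nhds 0) := by
    simpa using ENNReal.tendsto_ofReal (hδ0.const_mul Q')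
  simpa using ENNReal.Tendsto.const_mul (a := S * C) h1 (Or.inr (ENNReal.mul_ne_top hS hC))

/-- The telescoping series is summed from `-n` to `n` after applying the block. At high frequencies
the cut-offs converge pointwise because `f` and `g` are continuous. At low frequencies the
differences need not tend to zero themselves, only their image under the block. -/
theorem IsLPFamily.eLpNorm_block_le_tsum {act : ℤ → Prop} {A B : ℤ → 𝓢(E, ℝ)}
    (h : IsLPFamily act A B) {F : ℝ → ℝ} (hF : ContDiff ℝ 1 F) {R : ℝ} {f g : E → ℝ}
    (hfc : Continuous f) (hgc : Continuous g) (hf : ∀ y, ‖f y‖ ≤ R) (hg : ∀ y, ‖g y‖ ≤ R)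
    {p : ℝ≥0∞} (hp : 1 ≤ p) (q : ℤ) :
    eLpNorm (conv (B q) fun y => F (f y) - F (g y)) p volume ≤
      ∑' j, eLpNorm (conv (B q) (increment A F f g j)) p volume := by
  obtain ⟨C₀, hC₀⟩ := h.low_mass 0
  obtain ⟨C₁, hC₁⟩ := h.low_mass 1
  have hR : 0 ≤ R := (norm_nonneg _).trans (hf 0)
  have hmass0 : ∀ j, (kernelMass 0 (A j)).toReal ≤ C₀ := fun j => by
    refine ENNReal.toReal_le_coe_of_le_coe ?_
    simpa using hC₀ j
  have hP : ∀ {v : E → ℝ}, Continuous v → (∀ y, ‖v y‖ ≤ R) → ∀ j y, |conv (A j) v y| ≤ C₀ * R :=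
    fun hc hv j y => (norm_conv_le (.of_continuous hc hv) (A j) y).trans (by gcongr; exact hmass0 j)
  obtain ⟨Q, hQ0, hQ⟩ := exists_bound_on_Icc hF.continuous (C₀ * R)
  set D : ℤ → E → ℝ := fun j y => F (conv (A j) f y) - F (conv (A j) g y) with hD
  have hFb : ∀ {v : E → ℝ}, Continuous v → (∀ y, ‖v y‖ ≤ R) → ∀ j,
      EssBddBy Q (fun y => F (conv (A j) v y)) := fun hc hv j =>
    .of_continuous (hF.continuous.comp (continuous_conv (.of_continuous hc hv) _))
      (fun y => hQ _ (hP hc hv j y))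
  have hDb : ∀ j, EssBddBy (Q + Q) (D j) := fun j => (hFb hfc hf j).sub (hFb hgc hg j)
  have hpt : ∀ x, ‖conv (B q) (fun y => F (f y) - F (g y)) x‖ₑ ≤
      ∑' j, ‖conv (B q) (increment A F f g j) x‖ₑ := by
    intro x
    have hstep : ∀ j, conv (B q) (D (j + 1)) x - conv (B q) (D j) x
        = conv (B q) (increment A F f g j) x := fun j =>
      (conv_sub_right _ (hDb (j + 1)) (hDb j) x).symm
    have hsum : ∀ (a : ℤ) (n : ℕ), ‖conv (B q) (D (a + n)) x - conv (B q) (D a) x‖ₑ ≤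
        ∑ i ∈ Finset.range n, ‖conv (B q) (increment A F f g (a + i)) x‖ₑ := by
      intro a n
      induction n with
      | zero => simp
      | succ n ih =>
        rw [Finset.sum_range_succ, ← hstep]
        refine le_trans ?_ (add_le_add_left ih _)
        refine le_trans (le_of_eq ?_) (enorm_add_le _ _)
        push_cast
        rw [← add_assoc]
        congr 1
        ring
    have hle : ∀ n : ℕ, ‖conv (B q) (D n) x - conv (B q) (D (-n)) x‖ₑ ≤
        ∑' j, ‖conv (B q) (increment A F f g j) x‖ₑ := by
      intro n
      have h1 := hsum (-n) (2 * n)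
      rw [show (-n : ℤ) + ((2 * n : ℕ) : ℤ) = n by push_cast; ring] at h1
      refine h1.trans ((ENNReal.sum_le_tsum _).trans ?_)
      exact ENNReal.tsum_comp_le_tsum_of_injective (f := fun i : ℕ => (-n : ℤ) + i)
        (fun a b hab => by simpa using hab) (fun j => ‖conv (B q) (increment A F f g j) x‖ₑ)
    have hup : Filter.Tendsto (fun n : ℕ => conv (B q) (D n) x) Filter.atTop
        (nhds (conv (B q) (fun y => F (f y) - F (g y)) x)) := by
      refine tendsto_conv_of_bounded _ (fun n => hDb n) (Filter.Eventually.of_forall fun y => ?_) x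
      exact ((hF.continuous.tendsto _).comp (h.tendsto R f hfc hf y)).sub
        ((hF.continuous.tendsto _).comp (h.tendsto R g hgc hg y))
    -- Either the cut-offs are eventually zero and `F(0) - F(0)` remains, or the gradient of `A (-n)
    -- v` is of size `2^{-n}` and the block is controlled by first derivatives.
    have hdown : Filter.Tendsto (fun n : ℕ => conv (B q) (D (-n)) x) Filter.atTop (nhds 0) := by
      rcases h.low with ⟨J, hJ⟩ | hact
      · refine tendsto_const_nhds.congr' ?_
        filter_upwards [Filter.eventually_ge_atTop (-J).toNat] with n hn
        have : D (-n) = fun _ => 0 := by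
          funext y
          simp [hD, hJ (-n) (by omega)]
        rw [this]
        simp [conv]
      · obtain ⟨C, hC⟩ := h.smoothing 1
        obtain ⟨ζ, -, hζC, hζ⟩ := hC q ⟨q - 1, by omega, hact _⟩
        have key : ∀ {v : E → ℝ}, Continuous v → (∀ y, ‖v y‖ ≤ R) →
            Filter.Tendsto (fun n : ℕ => conv (B q) (fun y => F (conv (A (-n)) v y)) x)
              Filter.atTop (nhds 0) := by
          intro v hc hv
          have hvb : EssBddBy R v := .of_continuous hc hv
          refine tendsto_conv_comp_of_small_fderiv ENNReal.coe_ne_top ENNReal.ofReal_ne_top hζC hζ hF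
            (fun n => hasBddDerivs_conv hvb _ _) (fun n y => hP hc hv _ y)
            (δ := fun n => C₁ * (1 / 2) ^ n * R) (fun n y => ?_) ?_ x
          · refine (norm_iteratedFDeriv_conv_le hvb 1 _ y).trans ?_
            gcongr
            have := ENNReal.toReal_mono (by finiteness) (hC₁ (-n))
            rw [ENNReal.toReal_mul, ENNReal.toReal_ofReal (by positivity)] at this
            simpa using this
          · have := tendsto_pow_atTop_nhds_zero_of_lt_one (r := (1 / 2 : ℝ)) (by norm_num)
              (by norm_num)
            simpa using (this.const_mul (C₁ : ℝ)).mul_const R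
        have := (key hfc hf).sub (key hgc hg)
        rw [sub_zero] at this
        refine this.congr fun n => ?_
        exact (conv_sub_right _ (hFb hfc hf _) (hFb hgc hg _) x).symm
    have hlim := (hup.sub hdown).enorm
    rw [sub_zero] at hlim
    exact le_of_tendsto hlim (Filter.Eventually.of_forall hle)
  have hinc : ∀ j, Continuous (conv (B q) (increment A F f g j)) := fun j =>
    continuous_conv ((hDb (j + 1)).sub (hDb j)) (B q)
  calc eLpNorm (conv (B q) fun y => F (f y) - F (g y)) p volume
      = eLpNorm (fun x => ‖conv (B q) (fun y => F (f y) - F (g y)) x‖ₑ) p volume := by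
        rw [eLpNorm_enorm]
    _ ≤ eLpNorm (fun x => ∑' j, ‖conv (B q) (increment A F f g j) x‖ₑ) p volume :=
        eLpNorm_mono_ennreal hpt
    _ ≤ ∑' j, eLpNorm (fun x => ‖conv (B q) (increment A F f g j) x‖ₑ) p volume :=
        eLpNorm_tsum_le_ennreal hp fun j => (hinc j).enorm.measurable.aemeasurable
    _ = _ := by simp_rw [eLpNorm_enorm]

end Telescoping

/-! ### Mollification, and the nonlinear estimate for bounded functions -/

section Mollification

set_option linter.unusedSectionVars false

variable {E : Type} [NormedAddCommGroup E] [InnerProductSpace ℝ E] [FiniteDimensional ℝ E]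
  [MeasurableSpace E] [BorelSpace E]

/-- A sequence of mollifiers. -/
structure IsMollifier (k : ℕ → 𝓢(E, ℝ)) : Prop where
  nonneg : ∀ n x, 0 ≤ k n x
  integral : ∀ n, ∫ x, k n x = 1
  support : ∀ (n : ℕ) x, 1 / ((n : ℝ) + 1) < ‖x‖ → k n x = 0
  tendsto : ∀ f : E → ℝ, LocallyIntegrable f volume → ∀ᵐ x,
    Filter.Tendsto (fun n => conv (k n) f x) Filter.atTop (nhds (f x))

variable (E) in
theorem exists_isMollifier : ∃ k : ℕ → 𝓢(E, ℝ), IsMollifier k := by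
  -- The outer radius is always twice the inner one: this bounded ratio is what the almost
  -- everywhere convergence for locally integrable functions requires.
  set b : ℕ → ContDiffBump (0 : E) := fun n =>
    ⟨1 / ((n : ℝ) + 1) / 2, 1 / ((n : ℝ) + 1), by positivity, by
      have : 0 < 1 / ((n : ℝ) + 1) := by positivity
      linarith⟩ with hb
  refine ⟨fun n => (b n).hasCompactSupport_normed.toSchwartzMap
    ((b n).contDiff_normed (μ := volume)), ?_, ?_, ?_, ?_⟩
  · exact fun n x => (b n).nonneg_normed x
  · exact fun n => (b n).integral_normed
  · intro n x hx
    change (b n).normed volume x = 0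
    rw [← Function.notMem_support, (b n).support_normed_eq]
    rw [mem_ball_zero_iff, not_lt]
    exact hx.le
  · intro f hf
    have h := ContDiffBump.ae_convolution_tendsto_right_of_locallyIntegrable (φ := b)
      (l := Filter.atTop) (K := 2) (μ := (volume : Measure E)) tendsto_one_div_add_atTop_nhds_zero_nat
      (Filter.Eventually.of_forall fun n => le_of_eq (by simp only [hb]; ring)) hf
    filter_upwards [h] with x hx
    refine hx.congr fun n => ?_
    rw [convolution_eq_swap]
    unfold conv
    congr 1
    funext y
    simp only [ContinuousLinearMap.lsmul_apply, smul_eq_mul]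
    rw [mul_comm]
    rfl

theorem IsMollifier.kernelMass_eq {k : ℕ → 𝓢(E, ℝ)} (hk : IsMollifier k) (n : ℕ) :
    kernelMass 0 (k n) = 1 := by
  rw [kernelMass_zero_eq]
  have := ofReal_integral_eq_lintegral_ofReal ((k n).integrable (μ := volume))
    (Filter.Eventually.of_forall (hk.nonneg n))
  rw [hk.integral n, ENNReal.ofReal_one] at this
  rw [this]
  congr 1
  funext x
  rw [Real.enorm_of_nonneg (hk.nonneg n x)]

theorem IsMollifier.norm_conv_le {k : ℕ → 𝓢(E, ℝ)} (hk : IsMollifier k) {R : ℝ} {f : E → ℝ}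
    (hf : EssBddBy R f) (n : ℕ) (x : E) : ‖conv (k n) f x‖ ≤ R := by
  simpa [hk.kernelMass_eq] using _root_.norm_conv_le hf (k n) x

theorem IsMollifier.eLpNorm_conv_le {k : ℕ → 𝓢(E, ℝ)} (hk : IsMollifier k) {p : ℝ≥0∞} (hp : 1 ≤ p)
    {R : ℝ} {f : E → ℝ} (hf : EssBddBy R f) (n : ℕ) :
    eLpNorm (conv (k n) f) p volume ≤ eLpNorm f p volume := by
  simpa [hk.kernelMass_eq] using _root_.eLpNorm_conv_le hp hf (k n)

theorem EssBddBy.locallyIntegrable {R : ℝ} {f : E → ℝ} (hf : EssBddBy R f) :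
    LocallyIntegrable f volume :=
  (memLp_top_of_bound hf.1 R hf.2).locallyIntegrable le_top

/-- Dominated convergence gives pointwise convergence of the convolutions, and Fatou's lemma keeps
the bound. No convergence in norm is needed, which allows `p = ∞`. -/
theorem eLpNorm_conv_le_of_tendsto {p : ℝ≥0∞} {k : 𝓢(E, ℝ)} {w : ℕ → E → ℝ} {v : E → ℝ} {R : ℝ}
    (hw : ∀ n, EssBddBy R (w n))
    (h : ∀ᵐ y, Filter.Tendsto (fun n => w n y) Filter.atTop (nhds (v y))) {b : ℝ≥0∞}
    (hb : ∀ n, eLpNorm (conv k (w n)) p volume ≤ b) : eLpNorm (conv k v) p volume ≤ b := by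
  refine (Lp.eLpNorm_lim_le_liminf_eLpNorm
    (fun n => (continuous_conv (hw n) k).aestronglyMeasurable) _
    (Filter.Eventually.of_forall (tendsto_conv_of_bounded k hw h))).trans ?_
  refine Filter.liminf_le_of_le (by isBoundedDefault) fun c hc => ?_
  obtain ⟨n, hn⟩ := hc.exists
  exact hn.trans (hb n)

/-- The right-hand side of the nonlinear estimate at frequency `2^q`. -/
noncomputable def interaction (K : ℕ) (B : ℤ → 𝓢(E, ℝ)) (p : ℝ≥0∞) (f g : E → ℝ) (q : ℤ) : ℝ≥0∞ :=
  ∑' j, freqGain K (q - j) * (eLpNorm f ∞ volume *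
      eLpNorm (conv (B j) (fun y => f y - g y)) p volume +
    eLpNorm (fun y => f y - g y) ∞ volume * eLpNorm (conv (B j) g) p volume)

/-- Mollifiers of mass one commute with the blocks and increase none of the norms on the right, so
the estimate for the mollified functions passes to the limit. -/
theorem IsLPFamily.exists_comp_bound {act : ℤ → Prop} {A B : ℤ → 𝓢(E, ℝ)}
    (h : IsLPFamily act A B) (K : ℕ) : ∃ (ρ : ℝ) (C : ℝ≥0), 1 ≤ ρ ∧
      ∀ (F : ℝ → ℝ) (R M : ℝ), 0 < R → 0 ≤ M → IsNonlinearity K (ρ * R) R M F →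
      ∀ f g : E → ℝ, EssBddBy R f → EssBddBy R g → ∀ (p : ℝ≥0∞), 1 ≤ p → ∀ q,
      eLpNorm (conv (B q) fun y => F (f y) - F (g y)) p volume ≤
        C * ENNReal.ofReal M * interaction K B p f g q := by
  obtain ⟨ρ, C, hρ, hC⟩ := h.exists_increment_bound K
  refine ⟨ρ, C, hρ, fun F R M hR hM hF f g hf hg p hp q => ?_⟩
  obtain ⟨k, hk⟩ := exists_isMollifier E
  have hF1 : ContDiff ℝ 1 F := hF.contDiff.of_le (by norm_cast; omega)
  obtain ⟨Q, hQ0, hQ⟩ := exists_bound_on_Icc hF1.continuous R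
  have hcv : ∀ {v : E → ℝ}, EssBddBy R v → ∀ n, EssBddBy R (conv (k n) v) := fun hv n =>
    .of_continuous (continuous_conv hv _) (hk.norm_conv_le hv n)
  have hFcv : ∀ {v : E → ℝ}, EssBddBy R v → ∀ n, EssBddBy Q (fun y => F (conv (k n) v y)) :=
    fun hv n => .of_continuous (hF1.continuous.comp (continuous_conv hv _))
      fun y => hQ _ (hk.norm_conv_le hv n y)
  have hblock : ∀ {S : ℝ} {v : E → ℝ}, EssBddBy S v → ∀ n j,
      eLpNorm (conv (B j) (conv (k n) v)) p volume ≤ eLpNorm (conv (B j) v) p volume := by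
    intro S v hv n j
    rw [show conv (B j) (conv (k n) v) = conv (k n) (conv (B j) v) from
      funext fun x => conv_conv_comm _ _ hv x]
    exact hk.eLpNorm_conv_le hp (essBddBy_conv hv _) n
  have hsub : ∀ n, (fun y => conv (k n) f y - conv (k n) g y) = conv (k n) (fun y => f y - g y) :=
    fun n => funext fun y => (conv_sub_right _ hf hg y).symm
  refine eLpNorm_conv_le_of_tendsto (w := fun n y => F (conv (k n) f y) - F (conv (k n) g y))
    (fun n => (hFcv hf n).sub (hFcv hg n)) ?_ fun n => ?_
  · filter_upwards [hk.tendsto f hf.locallyIntegrable, hk.tendsto g hg.locallyIntegrable] with y h1 h2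
    exact ((hF1.continuous.tendsto _).comp h1).sub ((hF1.continuous.tendsto _).comp h2)
  · refine (h.eLpNorm_block_le_tsum hF1 (continuous_conv hf (k n)) (continuous_conv hg (k n))
      (hk.norm_conv_le hf n) (hk.norm_conv_le hg n) hp q).trans ?_
    unfold interaction
    rw [← ENNReal.tsum_mul_left]
    refine ENNReal.tsum_le_tsum fun j => ?_
    refine (hC F R M hR hM hF _ _ (hcv hf n) (hcv hg n) p hp q j).trans ?_
    rw [hsub]
    gcongr
    · exact hk.eLpNorm_conv_le le_top hf n
    · exact hblock (hf.sub hg) n j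
    · exact hk.eLpNorm_conv_le le_top (hf.sub hg) n
    · exact hblock hg n j

end Mollification

/-! ### Functions of one variable with prescribed derivatives -/

section IteratedPrimitives

/-- One integrates `K` times from `c`, choosing the constants of integration. -/
theorem exists_iteratedDeriv_eq (c : ℝ) (K : ℕ) (a : ℕ → ℝ) {G : ℝ → ℝ} (hG : Continuous G) :
    ∃ H : ℝ → ℝ, ContDiff ℝ K H ∧ (∀ m < K, iteratedDeriv m H c = a m) ∧ iteratedDeriv K H = G := by
  induction K generalizing a with
  | zero => exact ⟨G, contDiff_zero.2 hG, by simp, by simp⟩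
  | succ K ih =>
    obtain ⟨H₁, h1, h2, h3⟩ := ih fun m => a (m + 1)
    have hd : ∀ x, HasDerivAt (fun x => a 0 + ∫ t in c..x, H₁ t) (H₁ x) x := fun x =>
      (intervalIntegral.integral_hasDerivAt_right (h1.continuous.intervalIntegrable _ _)
        (h1.continuous.stronglyMeasurableAtFilter _ _) h1.continuous.continuousAt).const_add _
    have hd' : deriv (fun x => a 0 + ∫ t in c..x, H₁ t) = H₁ := funext fun x => (hd x).deriv
    refine ⟨fun x => a 0 + ∫ t in c..x, H₁ t, ?_, fun m hm => ?_, ?_⟩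
    · rw [show ((K + 1 : ℕ) : WithTop ℕ∞) = (K : WithTop ℕ∞) + 1 by norm_cast,
        contDiff_succ_iff_deriv, hd']
      exact ⟨fun x => (hd x).differentiableAt, by simp, h1⟩
    · cases m with
      | zero => simp
      | succ m =>
        rw [iteratedDeriv_succ', hd']
        exact h2 m (by omega)
    · rw [iteratedDeriv_succ', hd', h3]

theorem ContDiff.deriv_of_succ {K : ℕ} {H : ℝ → ℝ} (hH : ContDiff ℝ ((K + 1 : ℕ) : WithTop ℕ∞) H) :
    Differentiable ℝ H ∧ ContDiff ℝ K (deriv H) := by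
  rw [show ((K + 1 : ℕ) : WithTop ℕ∞) = (K : WithTop ℕ∞) + 1 by norm_cast,
    contDiff_succ_iff_deriv] at hH
  exact ⟨hH.1, hH.2.2⟩

/-- Each integration from `c` costs one more power of `1 + |x - c|`. -/
theorem abs_iteratedDeriv_le_of_forall {c M : ℝ} (hM : 0 ≤ M) {K : ℕ} {H : ℝ → ℝ}
    (hH : ContDiff ℝ K H) (hc : ∀ m < K, |iteratedDeriv m H c| ≤ M)
    (hK : ∀ x, |iteratedDeriv K H x| ≤ M) :
    ∀ m ≤ K, ∀ x, |iteratedDeriv m H x| ≤ M * (1 + |x - c|) ^ (K - m) := by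
  induction K generalizing H with
  | zero =>
    intro m hm x
    obtain rfl : m = 0 := by omega
    simpa using hK x
  | succ K ih =>
    obtain ⟨hd, hH'⟩ := hH.deriv_of_succ
    have ih' := ih hH' (fun m hm => by simpa [iteratedDeriv_succ'] using hc (m + 1) (by omega))
      (fun x => by simpa [iteratedDeriv_succ'] using hK x)
    intro m hm x
    cases m with
    | succ m =>
      have := ih' m (by omega) x
      rw [iteratedDeriv_succ']
      simpa using this
    | zero =>
      have h1 : ‖H x - H c‖ ≤ M * (1 + |x - c|) ^ K * ‖x - c‖ := by
        refine (convex_closedBall c |x - c|).norm_image_sub_le_of_norm_deriv_le (fun y _ => hd y)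
          (fun y hy => ?_) (Metric.mem_closedBall_self (abs_nonneg _)) ?_
        · have h2 := ih' 0 (Nat.zero_le _) y
          rw [iteratedDeriv_zero, Nat.sub_zero] at h2
          rw [Metric.mem_closedBall, Real.dist_eq] at hy
          exact h2.trans (mul_le_mul_of_nonneg_left
            (pow_le_pow_left₀ (by positivity) (by linarith) K) hM)
        · rw [Metric.mem_closedBall, Real.dist_eq]
      have h3 := hc 0 (Nat.succ_pos _)
      rw [iteratedDeriv_zero] at h3 ⊢
      have h4 : |H x| ≤ |H c| + |H x - H c| := by
        have := abs_add_le (H c) (H x - H c)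
        rwa [add_sub_cancel] at this
      rw [Real.norm_eq_abs, Real.norm_eq_abs] at h1
      -- With `d = |x - c|`, this gives `M + M (1 + d)^K d ≤ M (1 + d)^{K+1}`.
      have h5 : (1 : ℝ) ≤ (1 + |x - c|) ^ K := one_le_pow₀ (by linarith [abs_nonneg (x - c)])
      rw [Nat.sub_zero, pow_succ]
      nlinarith

theorem eqOn_of_iteratedDeriv_eq {c : ℝ} {S : Set ℝ} (hS : Convex ℝ S) (hcS : c ∈ S) {K : ℕ}
    {H h : ℝ → ℝ} (hH : ContDiff ℝ K H) (hh : ContDiff ℝ K h)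
    (hc : ∀ m < K, iteratedDeriv m H c = iteratedDeriv m h c)
    (hK : ∀ x ∈ S, iteratedDeriv K H x = iteratedDeriv K h x) : ∀ x ∈ S, H x = h x := by
  induction K generalizing H h with
  | zero => simpa using hK
  | succ K ih =>
    obtain ⟨hd, hH'⟩ := hH.deriv_of_succ
    obtain ⟨hd2, hh'⟩ := hh.deriv_of_succ
    have ih' := ih hH' hh' (fun m hm => by simpa [iteratedDeriv_succ'] using hc (m + 1) (by omega))
      (fun x hx => by simpa [iteratedDeriv_succ'] using hK x hx)
    intro x hx
    have h1 := hS.norm_image_sub_le_of_norm_deriv_le (f := fun y => H y - h y) (C := 0)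
      (fun y _ => (hd y).sub (hd2 y)) (fun y hy => ?_) hcS hx
    · have h2 := hc 0 (Nat.succ_pos _)
      rw [iteratedDeriv_zero, iteratedDeriv_zero] at h2
      rw [zero_mul, h2, sub_self, sub_zero, norm_le_zero_iff, sub_eq_zero] at h1
      exact h1
    · rw [deriv_fun_sub (hd y) (hd2 y), ih' y hy, sub_self, norm_zero]

end IteratedPrimitives

/-! ### Weak derivatives -/

section WeakDerivatives

theorem integrable_mul_of_tsupport_subset {U : Set ℝ} {v φ : ℝ → ℝ}
    (hv : LocallyIntegrableOn v U) (hφ : Continuous φ) (hc : HasCompactSupport φ)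
    (hs : tsupport φ ⊆ U) : Integrable (fun x => v x * φ x) := by
  have h1 : IntegrableOn v (tsupport φ) := hv.integrableOn_compact_subset hs hc
  have h2 : IntegrableOn (fun x => v x * φ x) (tsupport φ) :=
    h1.mul_continuousOn hφ.continuousOn hc
  refine (integrableOn_iff_integrable_of_support_subset fun x hx => ?_).1 h2
  exact subset_tsupport φ fun h0 => hx (by simp [h0])

theorem HasWeakDerivOn.ae_eq {m : ℕ} {U : Set ℝ} (hU : IsOpen U) {u v v' : ℝ → ℝ}
    (h : HasWeakDerivOn m U u v) (h' : HasWeakDerivOn m U u v') : v =ᵐ[volume.restrict U] v' := by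
  have h0 : ∀ᵐ x, x ∈ U → (v - v') x = 0 := by
    refine hU.ae_eq_zero_of_integral_contDiff_smul_eq_zero (h.2.1.sub h'.2.1) fun φ h1 h2 h3 => ?_
    have e1 := h.2.2 φ h1 h2 h3
    rw [h'.2.2 φ h1 h2 h3] at e1
    have e2 := mul_left_cancel₀ (pow_ne_zero m (neg_ne_zero.2 one_ne_zero)) e1
    have e3 := integral_sub (integrable_mul_of_tsupport_subset h.2.1 h1.continuous h2 h3)
      (integrable_mul_of_tsupport_subset h'.2.1 h1.continuous h2 h3)
    rw [e2, sub_self] at e3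
    rw [← e3]
    congr 1
    funext x
    simp only [Pi.sub_apply, smul_eq_mul]
    ring
  filter_upwards [ae_restrict_of_ae h0, ae_restrict_mem hU.measurableSet] with x hx hxU
  exact sub_eq_zero.1 (hx hxU)

theorem exists_weakDeriv_of_sobolevInftyNorm_ne_top {k : ℕ} {U : Set ℝ} (hU : IsOpen U) {u : ℝ → ℝ}
    (h : sobolevInftyNorm k U u ≠ ∞) : ∃ v : ℕ → ℝ → ℝ, ∀ m ≤ k, HasWeakDerivOn m U u (v m) ∧
      eLpNorm (v m) ∞ (volume.restrict U) ≤ sobolevInftyNorm k U u := by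
  have hm : ∀ m : ℕ, ∃ v, m ≤ k → HasWeakDerivOn m U u v ∧
      eLpNorm v ∞ (volume.restrict U) ≤ sobolevInftyNorm k U u := by
    intro m
    by_cases hmk : m ≤ k
    swap
    · exact ⟨0, fun h => absurd h hmk⟩
    have hle : (⨅ (v : ℝ → ℝ) (_ : HasWeakDerivOn m U u v), eLpNorm v ∞ (volume.restrict U)) ≤
        sobolevInftyNorm k U u :=
      Finset.single_le_sum (f := fun m => ⨅ (v : ℝ → ℝ) (_ : HasWeakDerivOn m U u v),
        eLpNorm v ∞ (volume.restrict U)) (fun _ _ => zero_le)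
        (Finset.mem_range.2 (Nat.lt_succ_of_le hmk))
    have hlt := hle.trans_lt h.lt_top
    simp only [iInf_lt_iff] at hlt
    obtain ⟨v, hv, -⟩ := hlt
    -- Any competitor agrees with `v` almost everywhere on `U`, so the norm of `v` is the infimum.
    refine ⟨v, fun _ => ⟨hv, le_trans (le_iInf₂ fun w hw => ?_) hle⟩⟩
    exact (eLpNorm_congr_ae (hv.ae_eq hU hw)).le
  choose v hv using hm
  exact ⟨v, hv⟩

theorem hasDerivAt_conv (k : 𝓢(ℝ, ℝ)) {R : ℝ} {f : ℝ → ℝ} (hf : EssBddBy R f) (x : ℝ) :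
    HasDerivAt (conv k f) (conv (SchwartzMap.derivCLM ℝ ℝ k) f x) x := by
  have h := (hasFDerivAt_conv k hf x).hasDerivAt
  refine h.congr_deriv ?_
  unfold conv
  rw [ContinuousLinearMap.integral_apply (integrable_conv hf _ x)]
  congr 1

theorem iteratedDeriv_conv (k : 𝓢(ℝ, ℝ)) {R : ℝ} {f : ℝ → ℝ} (hf : EssBddBy R f) (m : ℕ) (x : ℝ) :
    iteratedDeriv m (conv k f) x = ∫ y, f y * iteratedDeriv m k (x - y) := by
  induction m generalizing k with
  | zero => simp [conv]
  | succ m ih =>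
    have h1 : deriv (conv k f) = conv (SchwartzMap.derivCLM ℝ ℝ k) f :=
      funext fun x => (hasDerivAt_conv k hf x).deriv
    rw [iteratedDeriv_succ', h1, ih, iteratedDeriv_succ']
    rfl

/-- The derivatives of a mollification are the mollifications of the weak derivatives. -/
theorem HasWeakDerivOn.iteratedDeriv_conv {k : 𝓢(ℝ, ℝ)} {ε x : ℝ} {U : Set ℝ}
    (hk : ∀ y, ε < ‖y‖ → k y = 0) (hx : Metric.closedBall x ε ⊆ U) {m : ℕ} {u v : ℝ → ℝ}
    (h : HasWeakDerivOn m U u v) {R : ℝ} (hu : EssBddBy R (U.indicator u)) :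
    iteratedDeriv m (conv k (U.indicator u)) x = conv k (U.indicator v) x := by
  -- The reflected kernel, supported in the ball of radius `ε` about `x`, is an admissible test
  -- function on `U`; the sign `(-1)^m` of the reflection cancels that of the weak derivative.
  set φ : ℝ → ℝ := fun y => k (x - y) with hφ
  have hsupp : tsupport φ ⊆ Metric.closedBall x ε := by
    refine closure_minimal (fun y hy => ?_) Metric.isClosed_closedBall
    by_contra hlt
    rw [Metric.mem_closedBall, not_le, dist_comm, dist_eq_norm] at hlt
    exact hy (hk _ hlt)
  have hcomp : HasCompactSupport φ :=
    (isCompact_closedBall x ε).of_isClosed_subset (isClosed_tsupport _) hsupp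
  have hder : ∀ y, iteratedDeriv m φ y = (-1) ^ m * iteratedDeriv m k (x - y) := fun y => by
    rw [hφ, iteratedDeriv_comp_const_sub]
    rfl
  have hout : ∀ y, y ∉ U → iteratedDeriv m k (x - y) = 0 := by
    intro y hy
    have h1 : y ∉ tsupport φ := fun h => hy (hx (hsupp h))
    have h2 : iteratedFDeriv ℝ m φ y = 0 := by
      by_contra h3
      exact h1 (support_iteratedFDeriv_subset m h3)
    have h3 : iteratedDeriv m φ y = 0 := by
      rw [iteratedDeriv_eq_iteratedFDeriv, h2]
      rfl
    rw [hder] at h3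
    exact (mul_eq_zero.1 h3).resolve_left (pow_ne_zero m (neg_ne_zero.2 one_ne_zero))
  have hmain := h.2.2 φ ((k.smooth _).comp (contDiff_const.sub contDiff_id)) hcomp (hsupp.trans hx)
  rw [_root_.iteratedDeriv_conv k hu]
  have e1 : ∫ y, u y * iteratedDeriv m φ y =
      (-1) ^ m * ∫ y, U.indicator u y * iteratedDeriv m k (x - y) := by
    rw [← integral_const_mul]
    congr 1
    funext y
    rw [hder]
    by_cases hy : y ∈ U
    · rw [Set.indicator_of_mem hy]
      ring
    · rw [hout y hy]
      ring
  have e2 : ∫ y, v y * φ y = conv k (U.indicator v) x := by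
    unfold conv
    congr 1
    funext y
    by_cases hy : y ∈ U
    · rw [Set.indicator_of_mem hy, smul_eq_mul]
    · have : φ y = 0 := by
        by_contra h3
        exact hy (hx (hsupp (subset_tsupport φ h3)))
      rw [this, Set.indicator_of_notMem hy]
      simp
  rw [e1, e2] at hmain
  exact mul_left_cancel₀ (pow_ne_zero m (neg_ne_zero.2 one_ne_zero)) hmain

end WeakDerivatives

/-! ### Approximation of the nonlinearity by functions on the whole line -/

section Approximation

/-- A mollification extends to the whole line, with derivatives of polynomial growth. -/
theorem exists_extension_of_mollification {K : ℕ} {U : Set ℝ} (hUc : U.OrdConnected) {k : 𝓢(ℝ, ℝ)}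
    {ε : ℝ} (hε : 0 ≤ ε) (hk : ∀ y, ε < ‖y‖ → k y = 0) {u : ℝ → ℝ} {v : ℕ → ℝ → ℝ}
    (hv : ∀ m ≤ K, HasWeakDerivOn m U u (v m)) {M : ℝ} (hu : EssBddBy M (U.indicator u))
    (hkv : ∀ m ≤ K, ∀ x, ‖conv k (U.indicator (v m)) x‖ ≤ M) {c : ℝ}
    (hc : Metric.closedBall c ε ⊆ U) :
    ∃ H : ℝ → ℝ, ContDiff ℝ K H ∧
      (∀ m ≤ K, ∀ x, |iteratedDeriv m H x| ≤ M * (1 + |x - c|) ^ (K - m)) ∧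
      ∀ x, Metric.closedBall x ε ⊆ U → H x = conv k (U.indicator u) x := by
  set h := conv k (U.indicator u) with hh
  have hM : 0 ≤ M := hu.nonneg
  have hhK : ContDiff ℝ K h := contDiff_conv_nat hu K k
  have hbound : ∀ m ≤ K, ∀ x, Metric.closedBall x ε ⊆ U → |iteratedDeriv m h x| ≤ M := by
    intro m hm x hx
    rw [hh, (hv m hm).iteratedDeriv_conv hk hx hu]
    exact hkv m hm x
  -- The derivative of order `K` is truncated to `[-M, M]`. This changes nothing at the points whose
  -- `ε`-ball lies in `U`, and integrating back from `c` gives a bounded-growth extension that still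
  -- agrees with the mollification there.
  have hGc : Continuous fun x => max (-M) (min M (iteratedDeriv K h x)) :=
    continuous_const.max (continuous_const.min (hhK.continuous_iteratedDeriv K le_rfl))
  obtain ⟨H, hH, hHc, hHK⟩ := exists_iteratedDeriv_eq c K (fun m => iteratedDeriv m h c) hGc
  refine ⟨H, hH, ?_, ?_⟩
  · refine abs_iteratedDeriv_le_of_forall hM hH (fun m hm => ?_) fun x => ?_
    · rw [hHc m hm]
      exact hbound m hm.le c hc
    · rw [hHK]
      exact abs_le.2 ⟨le_max_left _ _, max_le (by linarith) (min_le_left _ _)⟩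
  · have hS : Convex ℝ {x | Metric.closedBall x ε ⊆ U} := by
      refine Set.OrdConnected.convex ⟨fun x hx y hy z hz t ht => ?_⟩
      rw [Real.closedBall_eq_Icc, Set.mem_Icc] at ht
      refine hUc.out (hx (a := x - ε) ?_) (hy (a := y + ε) ?_) ⟨?_, ?_⟩
      · simp [abs_of_nonneg hε]
      · simp [abs_of_nonneg hε]
      · linarith [hz.1, ht.1]
      · linarith [hz.2, ht.2]
    refine eqOn_of_iteratedDeriv_eq hS hc hH hhK hHc fun x hx => ?_
    rw [hHK]
    have := abs_le.1 (hbound K le_rfl x hx)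
    simp only [min_eq_right this.2, max_eq_right this.1]

theorem essBddBy_indicator {U : Set ℝ} (hU : IsOpen U) {v : ℝ → ℝ} {M : ℝ≥0∞} (hM : M ≠ ∞)
    (hv : LocallyIntegrableOn v U) (h : eLpNorm v ∞ (volume.restrict U) ≤ M) :
    EssBddBy M.toReal (U.indicator v) := by
  refine ⟨(aestronglyMeasurable_indicator_iff hU.measurableSet).2 hv.aestronglyMeasurable, ?_⟩
  have h1 := ae_le_eLpNormEssSup (f := v) (μ := volume.restrict U)
  rw [ae_restrict_iff' hU.measurableSet] at h1
  filter_upwards [h1] with x hx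
  by_cases hxU : x ∈ U
  · rw [Set.indicator_of_mem hxU]
    rw [← eLpNorm_exponent_top] at hx
    have := ENNReal.toReal_mono hM ((hx hxU).trans h)
    rwa [toReal_enorm] at this
  · rw [Set.indicator_of_notMem hxU, norm_zero]
    exact ENNReal.toReal_nonneg

/-- A base point near `0` gives `1 + |x - c| ≤ 2 + |x|`, a growth bound which does not depend on
`J`. -/
theorem exists_mem_interior_abs_le_one {J : Set ℝ} (hJ : J.OrdConnected) (h0 : (0 : ℝ) ∈ J)
    (hne : (interior J).Nonempty) : ∃ c ∈ interior J, |c| ≤ 1 := by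
  obtain ⟨d, hd⟩ := hne
  have hdJ := interior_subset hd
  by_cases h1 : |d| ≤ 1
  · exact ⟨d, hd, h1⟩
  rw [not_le, lt_abs] at h1
  rcases h1 with h1 | h1
  · exact ⟨1, interior_maximal (Set.Ioo_subset_Icc_self.trans (hJ.out h0 hdJ)) isOpen_Ioo
      ⟨one_pos, h1⟩, by simp⟩
  · exact ⟨-1, interior_maximal (Set.Ioo_subset_Icc_self.trans (hJ.out hdJ h0)) isOpen_Ioo
      ⟨by linarith, by norm_num⟩, by simp⟩

/-- Only the larger endpoint can fail to be interior, so boundary points of `J` do not affect the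
integrals of `F''`. -/
theorem ae_uIoc_subset_interior {J : Set ℝ} (hJ : J.OrdConnected) {a b : ℝ} (ha : a ∈ J)
    (hb : b ∈ J) : ∀ᵐ y : ℝ, y ∈ Set.uIoc a b → y ∈ interior J := by
  have h1 : Set.Ioo (min a b) (max a b) ⊆ interior J :=
    interior_maximal (Set.Ioo_subset_Icc_self.trans (hJ.uIcc_subset ha hb)) isOpen_Ioo
  filter_upwards [(Set.countable_singleton (max a b)).ae_notMem volume] with y hy hyI
  exact h1 ⟨hyI.1, lt_of_le_of_ne hyI.2 hy⟩

theorem primitive_contDiff {K : ℕ} {H : ℝ → ℝ} (hH : ContDiff ℝ K H) :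
    ContDiff ℝ ((K + 1 : ℕ) : WithTop ℕ∞) (fun x => ∫ t in (0 : ℝ)..x, H t) ∧
      deriv (fun x => ∫ t in (0 : ℝ)..x, H t) = H := by
  have hd : ∀ x, HasDerivAt (fun x => ∫ t in (0 : ℝ)..x, H t) (H x) x := fun x =>
    intervalIntegral.integral_hasDerivAt_right (hH.continuous.intervalIntegrable _ _)
      (hH.continuous.stronglyMeasurableAtFilter _ _) hH.continuous.continuousAt
  have hd' : deriv (fun x => ∫ t in (0 : ℝ)..x, H t) = H := funext fun x => (hd x).deriv
  refine ⟨?_, hd'⟩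
  rw [show ((K + 1 : ℕ) : WithTop ℕ∞) = (K : WithTop ℕ∞) + 1 by norm_cast,
    contDiff_succ_iff_deriv, hd']
  exact ⟨fun x => (hd x).differentiableAt, by simp, hH⟩

/-- An admissible nonlinearity is the limit on `J` of functions which are smooth on the whole
line. -/
theorem IsAdmissibleNonlinearity.exists_approx {K : ℕ} {I J : Set ℝ} {F : ℝ → ℝ}
    (hF : IsAdmissibleNonlinearity K I F) (hJI : J ⊆ I) (hJ : J.OrdConnected) (h0 : (0 : ℝ) ∈ J)
    (hne : (interior J).Nonempty)
    (hM : sobolevInftyNorm K (interior J) (deriv (deriv F)) ≠ ∞) :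
    ∃ G : ℕ → ℝ → ℝ, (∀ n, ContDiff ℝ ((K + 2 : ℕ) : WithTop ℕ∞) (G n)) ∧
      (∀ n, deriv (G n) 0 = 0) ∧
      (∀ n, ∀ m ≤ K, ∀ x, |iteratedDeriv m (deriv (deriv (G n))) x| ≤
        (sobolevInftyNorm K (interior J) (deriv (deriv F))).toReal * (2 + |x|) ^ (K - m)) ∧
      ∀ x ∈ J, Filter.Tendsto (fun n => G n x) Filter.atTop (nhds (F x - F 0)) := by
  set U := interior J with hU
  have hUo : IsOpen U := isOpen_interior
  have hUc : U.OrdConnected := hJ.interior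
  set u := deriv (deriv F) with hu
  set M := (sobolevInftyNorm K U u).toReal with hMdef
  have hM0 : 0 ≤ M := ENNReal.toReal_nonneg
  obtain ⟨v, hv⟩ := exists_weakDeriv_of_sobolevInftyNorm_ne_top hUo hM
  obtain ⟨c, hcU, hc1⟩ := exists_mem_interior_abs_le_one hJ h0 hne
  obtain ⟨k, hk⟩ := exists_isMollifier ℝ
  have hvb : ∀ m ≤ K, EssBddBy M (U.indicator (v m)) := fun m hm =>
    essBddBy_indicator hUo hM (hv m hm).1.2.1 (hv m hm).2
  have hu0 : HasWeakDerivOn 0 U u u :=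
    ⟨(hv 0 (Nat.zero_le _)).1.1, (hv 0 (Nat.zero_le _)).1.1, by simp⟩
  have hub : EssBddBy M (U.indicator u) := by
    refine essBddBy_indicator hUo hM hu0.1 (le_of_eq_of_le ?_ (hv 0 (Nat.zero_le _)).2)
    exact eLpNorm_congr_ae (hu0.ae_eq hUo (hv 0 (Nat.zero_le _)).1)
  have hball : ∀ x ∈ U, ∃ n₀ : ℕ, ∀ n, n₀ ≤ n →
      Metric.closedBall x (1 / ((n : ℝ) + 1)) ⊆ U := by
    intro x hx
    obtain ⟨ε, hε, hεU⟩ := Metric.isOpen_iff.1 hUo x hx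
    obtain ⟨n₀, hn₀⟩ := exists_nat_one_div_lt hε
    refine ⟨n₀, fun n hn => (Metric.closedBall_subset_ball (lt_of_le_of_lt ?_ hn₀)).trans hεU⟩
    exact Nat.one_div_le_one_div hn
  -- Shifting the mollifiers by `n₀` keeps the ball about the base point inside `U` for every index.
  obtain ⟨n₀, hn₀⟩ := hball c hcU
  choose H hHK hHb hHeq using fun n : ℕ => exists_extension_of_mollification hUc (by positivity)
    (hk.support (n + n₀)) (fun m hm => (hv m hm).1) hub
    (fun m hm x => hk.norm_conv_le (hvb m hm) (n + n₀) x) (hn₀ (n + n₀) (Nat.le_add_left _ _))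
  have hHb' : ∀ n, ∀ m ≤ K, ∀ x, |iteratedDeriv m (H n) x| ≤ M * (2 + |x|) ^ (K - m) := by
    intro n m hm x
    refine (hHb n m hm x).trans ?_
    have : |x - c| ≤ |x| + |c| := abs_sub _ _
    gcongr ?_ * ?_ ^ _
    linarith
  have hH0 : ∀ {n x y}, |y| ≤ |x| → ‖H n y‖ ≤ M * (2 + |x|) ^ K := by
    intro n x y hxy
    have := hHb' n 0 (Nat.zero_le _) y
    rw [iteratedDeriv_zero, Nat.sub_zero] at this
    exact this.trans (by gcongr)
  have hH1 := fun n => primitive_contDiff (hHK n)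
  set H₁ : ℕ → ℝ → ℝ := fun n x => ∫ t in (0 : ℝ)..x, H n t with hH₁
  have hH2 := fun n => primitive_contDiff (hH1 n).1
  have hlim0 : ∀ᵐ y, y ∈ U → Filter.Tendsto (fun n => H n y) Filter.atTop (nhds (u y)) := by
    filter_upwards [hk.tendsto _ hub.locallyIntegrable] with y hy hyU
    rw [Set.indicator_of_mem hyU] at hy
    obtain ⟨n₁, hn₁⟩ := hball y hyU
    refine ((Filter.tendsto_add_atTop_iff_nat n₀).2 hy).congr' ?_
    filter_upwards [Filter.eventually_ge_atTop n₁] with n hn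
    exact (hHeq n y (hn₁ _ (hn.trans (Nat.le_add_right _ _)))).symm
  have habs : ∀ {x y : ℝ}, y ∈ Set.uIoc 0 x → |y| ≤ |x| := by
    intro x y hy
    rcases Set.mem_uIoc.1 hy with h | h
    · rw [abs_of_pos h.1]
      exact h.2.trans (le_abs_self x)
    · rw [abs_of_nonpos h.2]
      exact (neg_le_neg h.1.le).trans (neg_le_abs x)
  -- `F''` is the genuine derivative of `F'` and is integrable on the segment, so the fundamental
  -- theorem of calculus and dominated convergence identify the limit. The next step repeats this
  -- once more, for `F`.
  have hlim1 : ∀ x ∈ J, Filter.Tendsto (fun n => H₁ n x) Filter.atTop (nhds (deriv F x)) := by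
    intro x hx
    have hae := ae_uIoc_subset_interior hJ h0 hx
    have hint : IntervalIntegrable u volume 0 x := by
      have h1 : IntervalIntegrable (U.indicator u) volume 0 x :=
        (hub.locallyIntegrable.integrableOn_isCompact isCompact_uIcc).intervalIntegrable
      refine h1.congr_ae ?_
      rw [Filter.EventuallyEq, ae_restrict_iff' measurableSet_uIoc]
      filter_upwards [hae] with y hy hyI
      rw [Set.indicator_of_mem (hy hyI)]
    have hftc : ∫ y in (0 : ℝ)..x, u y = deriv F x - deriv F 0 :=
      intervalIntegral.integral_eq_sub_of_hasDerivAt (fun y hy =>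
        ((hF.differentiable_deriv).differentiableAt (hF.isOpen.mem_nhds
          (hJI (hJ.uIcc_subset h0 hx hy)))).hasDerivAt) hint
    rw [hF.deriv_zero, sub_zero] at hftc
    rw [← hftc]
    refine intervalIntegral.tendsto_integral_filter_of_dominated_convergence
      (fun _ => M * (2 + |x|) ^ K) (Filter.Eventually.of_forall fun n =>
        (hHK n).continuous.aestronglyMeasurable) (Filter.Eventually.of_forall fun n =>
        Filter.Eventually.of_forall fun y hy => hH0 (habs hy)) intervalIntegrable_const ?_
    filter_upwards [hae, hlim0] with y h1 h2 hy
    exact h2 (h1 hy)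
  have hlim2 : ∀ x ∈ J, Filter.Tendsto (fun n => ∫ t in (0 : ℝ)..x, H₁ n t) Filter.atTop
      (nhds (F x - F 0)) := by
    intro x hx
    have hsub : Set.uIcc 0 x ⊆ I := (hJ.uIcc_subset h0 hx).trans hJI
    have hftc : ∫ y in (0 : ℝ)..x, deriv F y = F x - F 0 :=
      intervalIntegral.integral_eq_sub_of_hasDerivAt (fun y hy =>
        (hF.differentiable.differentiableAt (hF.isOpen.mem_nhds (hsub hy))).hasDerivAt)
        (hF.differentiable_deriv.continuousOn.mono hsub).intervalIntegrable
    rw [← hftc]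
    refine intervalIntegral.tendsto_integral_filter_of_dominated_convergence
      (fun _ => M * (2 + |x|) ^ K * |x|) (Filter.Eventually.of_forall fun n =>
        (hH1 n).1.continuous.aestronglyMeasurable) (Filter.Eventually.of_forall fun n =>
        Filter.Eventually.of_forall fun y hy => ?_) intervalIntegrable_const
        (Filter.Eventually.of_forall fun y hy =>
          hlim1 y (hJ.uIcc_subset h0 hx (Set.uIoc_subset_uIcc hy)))
    refine (intervalIntegral.norm_integral_le_of_norm_le_const (C := M * (2 + |x|) ^ K)
      fun t ht => hH0 ((habs ht).trans (habs hy))).trans ?_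
    rw [sub_zero]
    exact mul_le_mul_of_nonneg_left (habs hy) (by positivity)
  -- The second primitive which vanishes to first order at `0`: this keeps the condition `F'(0) = 0`
  -- and loses only the constant `F 0`.
  refine ⟨fun n x => ∫ t in (0 : ℝ)..x, H₁ n t, fun n => (hH2 n).1, fun n => ?_, fun n m hm x => ?_,
    hlim2⟩
  · rw [(hH2 n).2]
    simp
  · rw [(hH2 n).2, (hH1 n).2]
    exact hHb' n m hm x

end Approximation

/-! ### The nonlinear estimate at a fixed time -/

section FixedTime

set_option linter.unusedSectionVars false

variable {E : Type} [NormedAddCommGroup E] [InnerProductSpace ℝ E] [FiniteDimensional ℝ E]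
  [MeasurableSpace E] [BorelSpace E]

theorem eq_zero_of_interior_eq_empty {J : Set ℝ} (hJ : J.OrdConnected) (h0 : (0 : ℝ) ∈ J)
    (he : interior J = ∅) {x : ℝ} (hx : x ∈ J) : x = 0 := by
  by_contra hne
  have h1 : Set.Ioo (min 0 x) (max 0 x) ⊆ interior J :=
    interior_maximal (Set.Ioo_subset_Icc_self.trans (hJ.uIcc_subset h0 hx)) isOpen_Ioo
  have h2 : (Set.Ioo (min 0 x) (max 0 x)).Nonempty :=
    Set.nonempty_Ioo.2 (min_lt_max.2 (Ne.symm hne))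
  rw [he] at h1
  exact (h2.mono h1).ne_empty rfl

theorem conv_eq_zero_of_ae_eq (k : 𝓢(E, ℝ)) {f g : E → ℝ} (h : f =ᵐ[volume] g) (F : ℝ → ℝ) :
    conv k (fun y => F (f y) - F (g y)) = 0 := by
  funext x
  rw [conv_congr_ae k (g := fun _ => 0) (h.mono fun y hy => by simp [hy])]
  simp [conv]

theorem abs_sub_le_of_deriv_deriv_bound {G : ℝ → ℝ} (hG : Differentiable ℝ G)
    (hG' : Differentiable ℝ (deriv G)) (h0 : deriv G 0 = 0) {R L : ℝ} (hR : 0 ≤ R)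
    (hL : ∀ x, |x| ≤ R → |deriv (deriv G) x| ≤ L) {x y : ℝ} (hx : |x| ≤ R) (hy : |y| ≤ R) :
    |G x - G y| ≤ L * R * (2 * R) := by
  have hmem : ∀ {z : ℝ}, |z| ≤ R ↔ z ∈ Metric.closedBall (0 : ℝ) R := by simp
  have hL0 : 0 ≤ L := (abs_nonneg _).trans (hL 0 (by simpa using hR))
  have h1 : ∀ z ∈ Metric.closedBall (0 : ℝ) R, ‖deriv G z‖ ≤ L * R := by
    intro z hz
    have := (convex_closedBall (0 : ℝ) R).norm_image_sub_le_of_norm_deriv_le (fun w _ => hG' w)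
      (fun w hw => hL w (hmem.2 hw)) (Metric.mem_closedBall_self hR) hz
    rw [h0, sub_zero, sub_zero] at this
    exact this.trans (mul_le_mul_of_nonneg_left (hmem.2 hz) hL0)
  refine ((convex_closedBall (0 : ℝ) R).norm_image_sub_le_of_norm_deriv_le (fun w _ => hG w) h1
    (hmem.1 hy) (hmem.1 hx)).trans (mul_le_mul_of_nonneg_left ?_ (by positivity))
  exact (abs_sub _ _).trans (by linarith)

/-- The estimate holds for each approximating nonlinearity with a constant independent of the index,
and Fatou's lemma transfers it to `F`. The constant `F 0` disappears in the difference. -/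
theorem IsLPFamily.exists_admissible_comp_bound {act : ℤ → Prop} {A B : ℤ → 𝓢(E, ℝ)}
    (h : IsLPFamily act A B) (K : ℕ) : ∃ C : ℝ≥0, ∀ (I J : Set ℝ) (F : ℝ → ℝ),
      IsAdmissibleNonlinearity K I F → J ⊆ I → J.OrdConnected → (0 : ℝ) ∈ J →
      sobolevInftyNorm K (interior J) (deriv (deriv F)) ≠ ∞ →
      ∀ (R : ℝ), 1 ≤ R → ∀ f g : E → ℝ, EssBddBy R f → EssBddBy R g → (∀ᵐ y, f y ∈ J) →
      (∀ᵐ y, g y ∈ J) → ∀ (p : ℝ≥0∞), 1 ≤ p → ∀ q,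
      eLpNorm (conv (B q) fun y => F (f y) - F (g y)) p volume ≤
        C * ENNReal.ofReal R ^ K * sobolevInftyNorm K (interior J) (deriv (deriv F)) *
          interaction K B p f g q := by
  obtain ⟨ρ, C, hρ, hC⟩ := h.exists_comp_bound K
  -- For `|t| ≤ ρ R` with `ρ, R ≥ 1` one has `2 + |t| ≤ 3 ρ R`. Thus the growth `(2 + |t|)^{K-i}`
  -- times the weight `R^i` is at most `(3 ρ R)^K`.
  refine ⟨C * (Real.toNNReal (3 * ρ)) ^ K,
    fun I J F hF hJI hJ h0 hM R hR f g hf hg hfJ hgJ p hp q => ?_⟩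
  -- If the interior is empty then `J = {0}`, and both functions vanish almost everywhere.
  rcases (interior J).eq_empty_or_nonempty with he | hne
  · have hfg : f =ᵐ[volume] g := by
      filter_upwards [hfJ, hgJ] with y h1 h2
      rw [eq_zero_of_interior_eq_empty hJ h0 he h1, eq_zero_of_interior_eq_empty hJ h0 he h2]
    rw [conv_eq_zero_of_ae_eq _ hfg]
    simp
  obtain ⟨G, hG, hG0, hGb, hGlim⟩ := hF.exists_approx hJI hJ h0 hne hM
  set M := (sobolevInftyNorm K (interior J) (deriv (deriv F))).toReal with hMdef
  have hM0 : 0 ≤ M := ENNReal.toReal_nonneg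
  have hR0 : 0 < R := by linarith
  have hnl : ∀ n, IsNonlinearity K (ρ * R) R (M * (3 * ρ * R) ^ K) (G n) := by
    refine fun n => ⟨hG n, hG0 n, fun i hi t ht => ?_⟩
    have h1 : 2 + |t| ≤ 3 * ρ * R := by nlinarith
    have h2 : R ≤ 3 * ρ * R := by nlinarith
    calc |iteratedDeriv i (deriv (deriv (G n))) t| * R ^ i
        ≤ M * (2 + |t|) ^ (K - i) * R ^ i := by
          gcongr
          exact hGb n i hi t
      _ ≤ M * (3 * ρ * R) ^ (K - i) * (3 * ρ * R) ^ i := by gcongr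
      _ = _ := by rw [mul_assoc, ← pow_add, Nat.sub_add_cancel hi]
  have hdiff : ∀ n, ∀ x y, |x| ≤ R → |y| ≤ R →
      |G n x - G n y| ≤ M * (2 + R) ^ K * R * (2 * R) := by
    intro n x y hx hy
    refine abs_sub_le_of_deriv_deriv_bound ((hG n).differentiable (by simp))
      ((hnl n).contDiff_deriv.differentiable (by simp)) (hG0 n) hR0.le (fun z hz => ?_) hx hy
    have := hGb n 0 (Nat.zero_le _) z
    rw [iteratedDeriv_zero, Nat.sub_zero] at this
    exact this.trans (by gcongr)
  have key : eLpNorm (conv (B q) fun y => F (f y) - F (g y)) p volume ≤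
      C * ENNReal.ofReal (M * (3 * ρ * R) ^ K) * interaction K B p f g q := by
    refine eLpNorm_conv_le_of_tendsto (w := fun n y => G n (f y) - G n (g y))
      (R := M * (2 + R) ^ K * R * (2 * R)) (fun n => ⟨?_, ?_⟩) ?_ fun n =>
        hC (G n) R _ hR0 (by positivity) (hnl n) f g hf hg p hp q
    · exact ((hG n).continuous.comp_aestronglyMeasurable hf.1).sub
        ((hG n).continuous.comp_aestronglyMeasurable hg.1)
    · filter_upwards [hf.2, hg.2] with y h1 h2
      exact hdiff n _ _ h1 h2
    · filter_upwards [hfJ, hgJ] with y h1 h2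
      have := (hGlim _ h1).sub (hGlim _ h2)
      rwa [sub_sub_sub_cancel_right] at this
  refine key.trans (le_of_eq ?_)
  rw [ENNReal.ofReal_mul hM0, hMdef, ENNReal.ofReal_toReal hM, ENNReal.ofReal_pow (by positivity),
    ENNReal.ofReal_mul (by positivity), mul_pow]
  push_cast
  rw [ENNReal.ofReal]
  ring

/-- A bounded function all of whose dyadic blocks vanish is constant, and it vanishes if there is a
block of lowest frequency. -/
theorem IsLPFamily.exists_ae_eq_const {act : ℤ → Prop} {A B : ℤ → 𝓢(E, ℝ)}
    (h : IsLPFamily act A B) {R : ℝ} {f : E → ℝ} (hf : EssBddBy R f)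
    (hB : ∀ j x, conv (B j) f x = 0) :
    ∃ c, f =ᵐ[volume] (fun _ => c) ∧ ((∃ J, ∀ j ≤ J, A j = 0) → c = 0) := by
  obtain ⟨k, hk⟩ := exists_isMollifier E
  have hcv : ∀ n, EssBddBy R (conv (k n) f) := fun n =>
    .of_continuous (continuous_conv hf _) (hk.norm_conv_le hf n)
  have hBn : ∀ n j x, conv (B j) (conv (k n) f) x = 0 := by
    intro n j x
    rw [conv_conv_comm _ _ hf, show conv (B j) f = fun _ => 0 from funext (hB j)]
    simp [conv]
  have hA : ∀ n x (i : ℕ) (j : ℤ), conv (A (j + i)) (conv (k n) f) x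
      = conv (A j) (conv (k n) f) x := by
    intro n x i j
    induction i with
    | zero => simp
    | succ i ih =>
      rw [← ih, Nat.cast_succ, ← add_assoc, h.add, conv_add _ _ (hcv n), hBn, add_zero]
  -- Without blocks, all the cut-offs of the mollified function coincide, hence they equal their
  -- limit, the function itself.
  have hrep : ∀ n x (j : ℤ), conv (k n) f x = conv (A j) (conv (k n) f) x := by
    intro n x j
    refine tendsto_nhds_unique (h.tendsto R _ (continuous_conv hf _) (hk.norm_conv_le hf n) x)
      (tendsto_const_nhds.congr' ?_)
    filter_upwards [Filter.eventually_ge_atTop j.toNat] with i hi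
    have : (i : ℤ) = j + ((i - j).toNat : ℕ) := by omega
    rw [this, hA]
  have hlim := hk.tendsto f hf.locallyIntegrable
  have hconst : ∀ n x, conv (k n) f x = conv (k n) f 0 := by
    intro n x
    rcases h.low with ⟨J, hJ⟩ | -
    · rw [hrep n x J, hrep n 0 J, hJ J le_rfl, conv_zero_left, conv_zero_left]
    -- Equal to its cut-off at frequency `2^{-i}` for every `i`, the mollified function has a
    -- gradient of size `2^{-i}`, hence zero.
    · obtain ⟨C, hC⟩ := h.low_mass 1
      have hd : Differentiable ℝ (conv (k n) f) :=
        (contDiff_conv_nat hf 1 (k n)).differentiable (by simp)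
      refine is_const_of_fderiv_eq_zero hd (fun y => ?_) x 0
      have hle : ∀ i : ℕ, ‖fderiv ℝ (conv (k n) f) y‖ ≤ C * (1 / 2) ^ i * R := by
        intro i
        have e : conv (k n) f = conv (A (-i)) (conv (k n) f) := funext fun x => hrep n x _
        rw [← norm_iteratedFDeriv_one, e]
        refine (norm_iteratedFDeriv_conv_le (hcv n) 1 _ y).trans ?_
        have hR := hf.nonneg
        gcongr
        have := ENNReal.toReal_mono (by finiteness) (hC (-i))
        rw [ENNReal.toReal_mul, ENNReal.toReal_ofReal (by positivity)] at this
        simpa using this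
      have h0 : Filter.Tendsto (fun i : ℕ => (C : ℝ) * (1 / 2) ^ i * R) Filter.atTop (nhds 0) := by
        have := tendsto_pow_atTop_nhds_zero_of_lt_one (r := (1 / 2 : ℝ)) (by norm_num)
          (by norm_num)
        simpa using (this.const_mul (C : ℝ)).mul_const R
      exact norm_le_zero_iff.1 (ge_of_tendsto' h0 hle)
  obtain ⟨x₀, hx₀⟩ := hlim.exists
  refine ⟨f x₀, ?_, fun ⟨J, hJ⟩ => ?_⟩
  · filter_upwards [hlim] with x hx
    exact tendsto_nhds_unique hx (hx₀.congr fun n => by rw [hconst n x, hconst n x₀])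
  · refine tendsto_nhds_unique hx₀ (tendsto_const_nhds.congr fun n => ?_)
    rw [hrep n x₀ J, hJ J le_rfl, conv_zero_left]

/-- Both functions are constant. In the inhomogeneous case they are zero; in the homogeneous case
the block annihilates the constant `F c - F d`. No regularity of `F` enters, as the case of an
infinite Sobolev norm requires. -/
theorem IsLPFamily.block_comp_eq_zero {act : ℤ → Prop} {A B : ℤ → 𝓢(E, ℝ)}
    (h : IsLPFamily act A B) {R : ℝ} {f g : E → ℝ} (hf : EssBddBy R f) (hg : EssBddBy R g)
    (hBf : ∀ j x, conv (B j) f x = 0) (hBg : ∀ j x, conv (B j) g x = 0) (F : ℝ → ℝ) (q : ℤ) :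
    conv (B q) (fun y => F (f y) - F (g y)) = 0 := by
  obtain ⟨c, hc, hc0⟩ := h.exists_ae_eq_const hf hBf
  obtain ⟨d, hd, hd0⟩ := h.exists_ae_eq_const hg hBg
  rcases h.low with hJ | hact
  · refine conv_eq_zero_of_ae_eq _ ?_ F
    filter_upwards [hc, hd] with y h1 h2
    rw [h1, h2, hc0 hJ, hd0 hJ]
  · funext x
    rw [conv_congr_ae (B q) (g := fun _ => F c - F d)
      (by filter_upwards [hc, hd] with y h1 h2; rw [h1, h2])]
    obtain ⟨C, hC⟩ := h.smoothing 1
    obtain ⟨ζ, -, -, hζ⟩ := hC q ⟨q - 1, by omega, hact _⟩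
    have hb : HasBddDerivs 1 (fun _ : E => F c - F d) := by
      refine ⟨contDiff_const, fun i _ => ?_⟩
      rcases Nat.eq_zero_or_pos i with rfl | hi
      · exact ⟨|F c - F d|, fun y => by simp⟩
      · exact ⟨0, fun y => by rw [iteratedFDeriv_const_of_ne hi.ne']; simp⟩
    have := hζ _ hb x
    have h0 : ∀ y, ‖iteratedFDeriv ℝ 1 (fun _ : E => F c - F d) y‖ₑ = 0 := fun y => by
      rw [← ofReal_norm, norm_iteratedFDeriv_one]
      simp
    simpa [h0] using this

end FixedTime

/-! ### Time-dependent functions -/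

section TimeDependent

set_option linter.unusedSectionVars false

variable {E : Type} [NormedAddCommGroup E] [InnerProductSpace ℝ E] [FiniteDimensional ℝ E]
  [MeasurableSpace E] [BorelSpace E] {τ : Measure ℝ} [SFinite τ]

/-- The norm of `L^θ(τ; L^p)`. -/
noncomputable def timeNorm (τ : Measure ℝ) (θ p : ℝ≥0∞) (u : ℝ → E → ℝ) : ℝ≥0∞ :=
  eLpNorm (fun t => eLpNorm (u t) p volume) θ τ

/-- The Chemin-Lerner norm defined by the blocks `B`. -/
noncomputable def blockNorm (B : ℤ → 𝓢(E, ℝ)) (τ : Measure ℝ) (θ : ℝ≥0∞) (s : ℝ) (p r : ℝ≥0∞)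
    (u : ℝ → E → ℝ) : ℝ≥0∞ :=
  seqNorm r fun q =>
    ENNReal.ofReal ((2 : ℝ) ^ ((q : ℝ) * s)) * timeNorm τ θ p fun t => conv (B q) (u t)

/-- `u` is measurable, and essentially bounded uniformly in time. -/
structure IsBoundedField (τ : Measure ℝ) (u : ℝ → E → ℝ) : Prop where
  measurable : AEStronglyMeasurable (fun z : ℝ × E => u z.1 z.2) (τ.prod volume)
  bounded : timeNorm τ ∞ ∞ u < ∞

theorem aemeasurable_eLpNorm_slice {u : ℝ → E → ℝ}
    (hu : AEStronglyMeasurable (fun z : ℝ × E => u z.1 z.2) (τ.prod volume)) {p : ℝ≥0∞}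
    (hp : 1 ≤ p) : AEMeasurable (fun t => eLpNorm (u t) p volume) τ := by
  obtain ⟨w, hw, huw⟩ := hu
  refine ⟨fun t => eLpNorm (fun x => ‖w (t, x)‖ₑ) p volume,
    measurable_eLpNorm_section (h := fun z => ‖w z‖ₑ) hp hw.enorm, ?_⟩
  filter_upwards [Measure.ae_ae_of_ae_prod huw] with t ht
  rw [eLpNorm_enorm]
  exact eLpNorm_congr_ae ht

/-- A measurable representative changes `u t` on a null set for almost every `t`, and for these `t`
the convolution is the same at every `x`. -/
theorem aestronglyMeasurable_conv {u : ℝ → E → ℝ}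
    (hu : AEStronglyMeasurable (fun z : ℝ × E => u z.1 z.2) (τ.prod volume)) (k : 𝓢(E, ℝ)) :
    AEStronglyMeasurable (fun z : ℝ × E => conv k (u z.1) z.2) (τ.prod volume) := by
  refine ⟨fun z => ∫ y, hu.mk _ (z.1, y) • k (z.2 - y), ?_, ?_⟩
  · refine StronglyMeasurable.integral_prod_right'
      (f := fun w : (ℝ × E) × E => hu.mk _ (w.1.1, w.2) • k (w.1.2 - w.2)) ?_
    refine StronglyMeasurable.smul (hu.stronglyMeasurable_mk.comp_measurable (by fun_prop)) ?_
    exact (k.continuous.comp (by fun_prop)).stronglyMeasurable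
  · refine Measure.quasiMeasurePreserving_fst.ae
      (p := fun t => ∀ x, conv k (u t) x = ∫ y, hu.mk _ (t, y) • k (x - y)) ?_ |>.mono
      fun z hz => hz z.2
    filter_upwards [Measure.ae_ae_of_ae_prod hu.ae_eq_mk] with t ht x
    exact conv_congr_ae k ht x

theorem IsBoundedField.ae_essBddBy {u : ℝ → E → ℝ} (hu : IsBoundedField τ u) :
    ∀ᵐ t ∂τ, EssBddBy (timeNorm τ ∞ ∞ u).toReal (u t) := by
  have h1 : ∀ᵐ t ∂τ, eLpNorm (u t) ∞ volume ≤ timeNorm τ ∞ ∞ u := by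
    unfold timeNorm
    rw [eLpNorm_top_ennreal]
    exact ENNReal.ae_le_essSup _
  filter_upwards [h1, hu.measurable.prodMk_left] with t h2 h3
  refine ⟨h3, ?_⟩
  filter_upwards [ae_le_eLpNormEssSup (f := u t) (μ := volume)] with y hy
  rw [← eLpNorm_exponent_top] at hy
  have := ENNReal.toReal_mono hu.bounded.ne (hy.trans h2)
  rwa [toReal_enorm] at this

theorem IsBoundedField.sub {f g : ℝ → E → ℝ} (hf : IsBoundedField τ f) (hg : IsBoundedField τ g) :
    IsBoundedField τ (fun t x => f t x - g t x) := by
  refine ⟨hf.measurable.sub hg.measurable, ?_⟩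
  unfold timeNorm
  rw [eLpNorm_top_ennreal]
  refine (essSup_le_of_ae_le (ENNReal.ofReal ((timeNorm τ ∞ ∞ f).toReal +
    (timeNorm τ ∞ ∞ g).toReal)) ?_).trans_lt ENNReal.ofReal_lt_top
  filter_upwards [hf.ae_essBddBy, hg.ae_essBddBy] with t h1 h2
  exact (h1.sub h2).eLpNorm_le

theorem ae_eq_zero_of_timeNorm_eq_zero {u : ℝ → E → ℝ}
    (hu : AEStronglyMeasurable (fun z : ℝ × E => u z.1 z.2) (τ.prod volume)) {θ p : ℝ≥0∞}
    (hθ : 1 ≤ θ) (hp : 1 ≤ p) (h : timeNorm τ θ p u = 0) : ∀ᵐ t ∂τ, u t =ᵐ[volume] 0 := by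
  unfold timeNorm at h
  rw [eLpNorm_eq_zero_iff (aemeasurable_eLpNorm_slice hu hp).aestronglyMeasurable
    (zero_lt_one.trans_le hθ).ne'] at h
  filter_upwards [h, hu.prodMk_left] with t h1 h2
  exact (eLpNorm_eq_zero_iff h2 (zero_lt_one.trans_le hp).ne').1 h1

/-- The weights are positive, so every block vanishes almost everywhere; being continuous in `x`, it
vanishes everywhere. -/
theorem IsBoundedField.conv_eq_zero_of_blockNorm_eq_zero {u : ℝ → E → ℝ} (hu : IsBoundedField τ u)
    {B : ℤ → 𝓢(E, ℝ)} {θ p r : ℝ≥0∞} {s : ℝ} (hθ : 1 ≤ θ) (hp : 1 ≤ p) (hr : 1 ≤ r)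
    (h : blockNorm B τ θ s p r u = 0) : ∀ᵐ t ∂τ, ∀ j x, conv (B j) (u t) x = 0 := by
  rw [ae_all_iff]
  intro j
  have h1 := seqNorm_eq_zero hr h j
  have h2 := (mul_eq_zero.1 h1).resolve_left (by
    rw [ENNReal.ofReal_eq_zero, not_le]
    positivity)
  filter_upwards [ae_eq_zero_of_timeNorm_eq_zero (aestronglyMeasurable_conv hu.measurable (B j)) hθ hp
    h2, hu.ae_essBddBy] with t h3 h4 x
  exact congrFun ((Continuous.ae_eq_iff_eq volume (continuous_conv h4 _) continuous_const).1 h3) x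

theorem blockNorm_eq_zero {B : ℤ → 𝓢(E, ℝ)} {θ p r : ℝ≥0∞} {s : ℝ} (hr : 1 ≤ r)
    {u : ℝ → E → ℝ} (h : ∀ᵐ t ∂τ, ∀ q, conv (B q) (u t) = 0) : blockNorm B τ θ s p r u = 0 := by
  have h1 : ∀ q, timeNorm τ θ p (fun t => conv (B q) (u t)) = 0 := by
    intro q
    unfold timeNorm
    rw [eLpNorm_congr_ae (g := fun _ => 0) (by filter_upwards [h] with t ht; rw [ht q]; simp)]
    simp
  unfold blockNorm
  simp only [h1, mul_zero]
  rw [seqNorm_eq_eLpNorm hr]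
  simp

/-- Two geometric series: the ratio is `2^{s-K}` for positive `n` and `2^{-s}` for negative `n`.
This is where `s > 0` and `s < K` are needed. -/
theorem tsum_freqGain_ne_top {s : ℝ} (hs : 0 < s) {K : ℕ} (hK : s < K) :
    ∑' n : ℤ, freqGain K n * ENNReal.ofReal ((2 : ℝ) ^ ((n : ℝ) * s)) ≠ ∞ := by
  have e : ∀ n : ℤ, freqGain K n * ENNReal.ofReal ((2 : ℝ) ^ ((n : ℝ) * s)) =
      ENNReal.ofReal (((2 : ℝ) ^ (-(max n 0))) ^ K * (2 : ℝ) ^ ((n : ℝ) * s)) := fun n => by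
    rw [freqGain, ENNReal.ofReal_mul (by positivity)]
  simp_rw [e]
  refine Summable.tsum_ofReal_ne_top (Summable.of_nat_of_neg ?_ ?_)
  · have hlt : (2 : ℝ) ^ (s - K) < 1 := Real.rpow_lt_one_of_one_lt_of_neg one_lt_two (by linarith)
    refine (summable_geometric_of_lt_one (by positivity) hlt).congr fun n => ?_
    rw [max_eq_left (by positivity), ← Real.rpow_natCast, ← Real.rpow_natCast, ← Real.rpow_intCast,
      ← Real.rpow_mul two_pos.le, ← Real.rpow_mul two_pos.le, ← Real.rpow_add two_pos]
    congr 1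
    push_cast
    ring
  · have hlt : (2 : ℝ) ^ (-s) < 1 := Real.rpow_lt_one_of_one_lt_of_neg one_lt_two (by linarith)
    refine (summable_geometric_of_lt_one (by positivity) hlt).congr fun n => ?_
    rw [max_eq_right (by omega), neg_zero, zpow_zero, one_pow, one_mul, ← Real.rpow_natCast,
      ← Real.rpow_mul two_pos.le]
    congr 1
    push_cast
    ring

/-- The estimate of the interaction of the frequencies, in the Chemin-Lerner norms. -/
theorem seqNorm_interaction_le {B : ℤ → 𝓢(E, ℝ)} {f g : ℝ → E → ℝ} (hf : IsBoundedField τ f)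
    (hg : IsBoundedField τ g) {s : ℝ} {K : ℕ} {p r θ θ₁ θ₂ θ₃ θ₄ : ℝ≥0∞} (hp : 1 ≤ p)
    (hr : 1 ≤ r) (hθ : 1 ≤ θ) (hθ₁ : 1 ≤ θ₁) (hθ₂ : 1 ≤ θ₂) (hθ₃ : 1 ≤ θ₃) (hθ₄ : 1 ≤ θ₄)
    (h₁₂ : θ⁻¹ = θ₁⁻¹ + θ₂⁻¹) (h₃₄ : θ⁻¹ = θ₃⁻¹ + θ₄⁻¹) :
    seqNorm r (fun q => ENNReal.ofReal ((2 : ℝ) ^ ((q : ℝ) * s)) *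
      eLpNorm (fun t => interaction K B p (f t) (g t) q) θ τ) ≤
    (∑' n : ℤ, freqGain K n * ENNReal.ofReal ((2 : ℝ) ^ ((n : ℝ) * s))) *
      (timeNorm τ θ₁ ∞ (fun t x => f t x - g t x) * blockNorm B τ θ₂ s p r g +
        blockNorm B τ θ₄ s p r (fun t x => f t x - g t x) * timeNorm τ θ₃ ∞ f) := by
  have hfg := hf.sub hg
  set u : ℝ → E → ℝ := fun t x => f t x - g t x with hu
  have ma : AEMeasurable (fun t => eLpNorm (f t) ∞ volume) τ :=
    aemeasurable_eLpNorm_slice hf.measurable le_top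
  have md : AEMeasurable (fun t => eLpNorm (u t) ∞ volume) τ :=
    aemeasurable_eLpNorm_slice hfg.measurable le_top
  have mb : ∀ j, AEMeasurable (fun t => eLpNorm (conv (B j) (u t)) p volume) τ := fun j =>
    aemeasurable_eLpNorm_slice (aestronglyMeasurable_conv hfg.measurable _) hp
  have me : ∀ j, AEMeasurable (fun t => eLpNorm (conv (B j) (g t)) p volume) τ := fun j =>
    aemeasurable_eLpNorm_slice (aestronglyMeasurable_conv hg.measurable _) hp
  set X : ℤ → ℝ≥0∞ := fun j => timeNorm τ θ₃ ∞ f * timeNorm τ θ₄ p (fun t => conv (B j) (u t)) +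
    timeNorm τ θ₁ ∞ u * timeNorm τ θ₂ p (fun t => conv (B j) (g t)) with hX
  have h1 : ∀ q, eLpNorm (fun t => interaction K B p (f t) (g t) q) θ τ ≤
      ∑' j, freqGain K (q - j) * X j := by
    intro q
    unfold interaction
    refine (eLpNorm_tsum_le_ennreal hθ fun j =>
      (((ma.mul (mb j)).add (md.mul (me j))).const_mul _)).trans (ENNReal.tsum_le_tsum fun j => ?_)
    refine (eLpNorm_const_mul_ennreal hθ _ ((ma.mul (mb j)).add (md.mul (me j)))).trans_le ?_
    gcongr
    refine (eLpNorm_add_le_ennreal hθ (ma.mul (mb j)) (md.mul (me j))).trans ?_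
    exact add_le_add (eLpNorm_mul_le_ennreal hθ hθ₃ hθ₄ h₃₄ ma (mb j))
      (eLpNorm_mul_le_ennreal hθ hθ₁ hθ₂ h₁₂ md (me j))
  set W : ℤ → ℝ≥0∞ := fun q => ENNReal.ofReal ((2 : ℝ) ^ ((q : ℝ) * s)) with hW
  -- The weight is multiplicative, so it can be shared between the convolution kernel and the
  -- sequence.
  have h2 : ∀ q j, W q = W (q - j) * W j := by
    intro q j
    rw [hW]
    beta_reduce
    rw [← ENNReal.ofReal_mul (by positivity), ← Real.rpow_add two_pos]
    congr 2
    push_cast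
    ring
  calc seqNorm r (fun q => W q * eLpNorm (fun t => interaction K B p (f t) (g t) q) θ τ)
      ≤ seqNorm r (fun q => ∑' j, (freqGain K (q - j) * W (q - j)) * (W j * X j)) := by
        refine seqNorm_mono hr fun q => (mul_le_mul_right (h1 q) _).trans (le_of_eq ?_)
        rw [← ENNReal.tsum_mul_left]
        congr 1
        funext j
        rw [h2 q j]
        ring
    _ ≤ (∑' n, freqGain K n * W n) * seqNorm r (fun j => W j * X j) :=
        seqNorm_conv_le hr (fun n => freqGain K n * W n) _
    _ ≤ _ := by
        gcongr
        have e : (fun j => W j * X j) = fun j => timeNorm τ θ₁ ∞ u *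
            (W j * timeNorm τ θ₂ p (fun t => conv (B j) (g t))) + timeNorm τ θ₃ ∞ f *
            (W j * timeNorm τ θ₄ p (fun t => conv (B j) (u t))) := by
          funext j
          rw [hX]
          ring
        rw [e]
        refine (seqNorm_add_le hr _ _).trans ?_
        rw [seqNorm_const_mul hr, seqNorm_const_mul hr, mul_comm (blockNorm _ _ _ _ _ _ _)]
        rfl

theorem IsLPFamily.exists_blockNorm_comp_bound {act : ℤ → Prop} {A B : ℤ → 𝓢(E, ℝ)}
    (h : IsLPFamily act A B) {s : ℝ} (hs : 0 < s) {K : ℕ} (hK : s < K)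
    {p r θ θ₁ θ₂ θ₃ θ₄ : ℝ≥0∞} (hp : 1 ≤ p)
    (hr : 1 ≤ r) (hθ : 1 ≤ θ) (hθ₁ : 1 ≤ θ₁) (hθ₂ : 1 ≤ θ₂) (hθ₃ : 1 ≤ θ₃) (hθ₄ : 1 ≤ θ₄)
    (h₁₂ : θ⁻¹ = θ₁⁻¹ + θ₂⁻¹) (h₃₄ : θ⁻¹ = θ₃⁻¹ + θ₄⁻¹) :
    ∃ C : ℝ≥0, ∀ (τ : Measure ℝ) [SFinite τ] (I J : Set ℝ) (F : ℝ → ℝ),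
      IsAdmissibleNonlinearity K I F → J ⊆ I → J.OrdConnected → (0 : ℝ) ∈ J →
      ∀ f g : ℝ → E → ℝ, IsBoundedField τ f → IsBoundedField τ g →
      (∀ᵐ t ∂τ, ∀ᵐ x, f t x ∈ J) → (∀ᵐ t ∂τ, ∀ᵐ x, g t x ∈ J) →
      blockNorm B τ θ s p r (fun t x => F (f t x) - F (g t x)) ≤
        C * (1 + timeNorm τ ∞ ∞ f + timeNorm τ ∞ ∞ g) ^ K *
          sobolevInftyNorm K (interior J) (deriv (deriv F)) *
          (timeNorm τ θ₁ ∞ (fun t x => f t x - g t x) * blockNorm B τ θ₂ s p r g +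
            blockNorm B τ θ₄ s p r (fun t x => f t x - g t x) * timeNorm τ θ₃ ∞ f) := by
  obtain ⟨C, hC⟩ := h.exists_admissible_comp_bound K
  set S := ∑' n : ℤ, freqGain K n * ENNReal.ofReal ((2 : ℝ) ^ ((n : ℝ) * s)) with hS
  have hSt : S ≠ ∞ := tsum_freqGain_ne_top hs hK
  -- The added one makes the constant nonzero, so that an infinite Sobolev norm gives an infinite
  -- right-hand side unless the last factor vanishes.
  refine ⟨C * S.toNNReal + 1, fun τ _ I J F hF hJI hJ h0 f g hf hg hfJ hgJ => ?_⟩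
  have hfg := hf.sub hg
  set X := timeNorm τ θ₁ ∞ (fun t x => f t x - g t x) * blockNorm B τ θ₂ s p r g +
      blockNorm B τ θ₄ s p r (fun t x => f t x - g t x) * timeNorm τ θ₃ ∞ f with hX
  set Nf := timeNorm τ ∞ ∞ f with hNf
  set Ng := timeNorm τ ∞ ∞ g with hNg
  by_cases hM : sobolevInftyNorm K (interior J) (deriv (deriv F)) = ∞
  · by_cases hX0 : X = 0
    swap
    · have h1 : ((C * S.toNNReal + 1 : ℝ≥0) : ℝ≥0∞) * (1 + Nf + Ng) ^ K ≠ 0 := by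
        refine mul_ne_zero (by simp) (pow_ne_zero _ ?_)
        simp
      rw [hM, ENNReal.mul_top h1, ENNReal.top_mul hX0]
      exact le_top
    · rw [blockNorm_eq_zero hr]
      · exact zero_le
      -- Either `f = g` almost everywhere, or all blocks of `g` vanish. In the second case those of
      -- `f` vanish too: either the blocks of `f - g` do, or `f` is zero.
      rw [hX, add_eq_zero, mul_eq_zero, mul_eq_zero] at hX0
      obtain ⟨h1, h2⟩ := hX0
      rcases h1 with h1 | h1
      · filter_upwards [ae_eq_zero_of_timeNorm_eq_zero hfg.measurable hθ₁ le_top h1] with t ht q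
        refine conv_eq_zero_of_ae_eq _ ?_ F
        filter_upwards [ht] with x hx
        exact sub_eq_zero.1 hx
      · have hBg := hg.conv_eq_zero_of_blockNorm_eq_zero hθ₂ hp hr h1
        have hBf : ∀ᵐ t ∂τ, ∀ j x, conv (B j) (f t) x = 0 := by
          rcases h2 with h2 | h2
          · filter_upwards [hBg, hfg.conv_eq_zero_of_blockNorm_eq_zero hθ₄ hp hr h2, hf.ae_essBddBy,
              hg.ae_essBddBy] with t h3 h4 h5 h6 j x
            have := h4 j x
            rwa [conv_sub_right _ h5 h6, h3, sub_zero] at this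
          · filter_upwards [ae_eq_zero_of_timeNorm_eq_zero hf.measurable hθ₃ le_top h2] with t ht j x
            rw [conv_congr_ae _ ht]
            simp [conv]
        filter_upwards [hBf, hBg, hf.ae_essBddBy, hg.ae_essBddBy] with t h3 h4 h5 h6 q
        refine h.block_comp_eq_zero (R := max Nf.toReal Ng.toReal)
          ⟨h5.1, h5.2.mono fun x hx => hx.trans (le_max_left _ _)⟩
          ⟨h6.1, h6.2.mono fun x hx => hx.trans (le_max_right _ _)⟩ h3 h4 F q
  · set M := sobolevInftyNorm K (interior J) (deriv (deriv F)) with hMdef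
    -- At almost every time this common radius bounds both functions, and it is at least one, as the
    -- polynomial weights require.
    set R : ℝ := 1 + Nf.toReal + Ng.toReal with hR
    have hRe : ENNReal.ofReal R = 1 + Nf + Ng := by
      rw [hR, ENNReal.ofReal_add (by positivity) (by positivity),
        ENNReal.ofReal_add (by positivity) (by positivity), ENNReal.ofReal_one,
        ENNReal.ofReal_toReal hf.bounded.ne, ENNReal.ofReal_toReal hg.bounded.ne]
    have hNf0 : 0 ≤ Nf.toReal := ENNReal.toReal_nonneg
    have hNg0 : 0 ≤ Ng.toReal := ENNReal.toReal_nonneg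
    have hslice : ∀ q, timeNorm τ θ p (fun t => conv (B q) (fun x => F (f t x) - F (g t x))) ≤
        (C * (1 + Nf + Ng) ^ K * M) * eLpNorm (fun t => interaction K B p (f t) (g t) q) θ τ := by
      intro q
      have hm : AEMeasurable (fun t => interaction K B p (f t) (g t) q) τ := by
        unfold interaction
        refine AEMeasurable.tsum fun j => AEMeasurable.const_mul (AEMeasurable.add
          (AEMeasurable.mul ?_ ?_) (AEMeasurable.mul ?_ ?_)) _
        · exact aemeasurable_eLpNorm_slice hf.measurable le_top
        · exact aemeasurable_eLpNorm_slice
            (aestronglyMeasurable_conv (u := fun t x => f t x - g t x) hfg.measurable _) hp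
        · exact aemeasurable_eLpNorm_slice hfg.measurable le_top
        · exact aemeasurable_eLpNorm_slice (aestronglyMeasurable_conv hg.measurable _) hp
      rw [← eLpNorm_const_mul_ennreal hθ _ hm]
      refine eLpNorm_mono_ae_ennreal ?_
      filter_upwards [hf.ae_essBddBy, hg.ae_essBddBy, hfJ, hgJ] with t h1 h2 h3 h4
      rw [← hRe]
      refine hC I J F hF hJI hJ h0 hM R (by linarith) (f t) (g t) ⟨h1.1, h1.2.mono fun x hx => ?_⟩
        ⟨h2.1, h2.2.mono fun x hx => ?_⟩ h3 h4 p hp q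
      · exact hx.trans (by linarith)
      · exact hx.trans (by linarith)
    calc blockNorm B τ θ s p r (fun t x => F (f t x) - F (g t x))
        ≤ seqNorm r (fun q => (C * (1 + Nf + Ng) ^ K * M) *
            (ENNReal.ofReal ((2 : ℝ) ^ ((q : ℝ) * s)) *
              eLpNorm (fun t => interaction K B p (f t) (g t) q) θ τ)) := by
          refine seqNorm_mono hr fun q => (mul_le_mul_right (hslice q) _).trans (le_of_eq ?_)
          ring
      _ ≤ (C * (1 + Nf + Ng) ^ K * M) * (S * X) := by
          rw [seqNorm_const_mul hr]
          gcongr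
          exact seqNorm_interaction_le hf hg hp hr hθ hθ₁ hθ₂ hθ₃ hθ₄ h₁₂ h₃₄
      _ = ((C * S.toNNReal : ℝ≥0) : ℝ≥0∞) * (1 + Nf + Ng) ^ K * M * X := by
          rw [ENNReal.coe_mul, ENNReal.coe_toNNReal hSt]
          ring
      _ ≤ _ := by
          gcongr
          exact le_self_add

end TimeDependent

/-! ### The composition estimates in Chemin-Lerner spaces -/

section CheminLerner

variable {N : ℕ} {φ₀ : 𝓢(EuclideanSpace ℝ (Fin N), ℝ)}

theorem eLpNorm_ofReal_comp (w : EuclideanSpace ℝ (Fin N) → ℝ) (p : ℝ≥0∞) :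
    eLpNorm (fun x => (w x : ℂ)) p volume = eLpNorm w p volume :=
  eLpNorm_congr_norm_ae (Filter.Eventually.of_forall fun x => by simp)

theorem IsDyadicGenerator.homCheminLernerNorm_eq (h : IsDyadicGenerator φ₀) (T θ : ℝ≥0∞) (s : ℝ)
    (p r : ℝ≥0∞) (u : ℝ → EuclideanSpace ℝ (Fin N) → ℝ) :
    homCheminLernerNorm φ₀ T θ s p r u = blockNorm (fun q => dil q h.blockKernel)
      (volume.restrict (timeInterval T)) θ s p r u := by
  unfold homCheminLernerNorm blockNorm mixedNorm timeNorm
  simp_rw [h.homBlock_eq, eLpNorm_ofReal_comp]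

theorem IsDyadicGenerator.cheminLernerNorm_eq (h : IsDyadicGenerator φ₀) (T θ : ℝ≥0∞) (s : ℝ)
    (p r : ℝ≥0∞) (u : ℝ → EuclideanSpace ℝ (Fin N) → ℝ) :
    cheminLernerNorm φ₀ T θ s p r u = blockNorm (fun q => if 0 ≤ q then dil q h.blockKernel
      else if q = -1 then h.lowPassKernel else 0)
      (volume.restrict (timeInterval T)) θ s p r u := by
  unfold cheminLernerNorm blockNorm mixedNorm timeNorm
  simp_rw [h.inhomBlock_eq, eLpNorm_ofReal_comp]

theorem IsBoundedWithValuesIn.isBoundedField {T : ℝ≥0∞} {J : Set ℝ}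
    {u : ℝ → EuclideanSpace ℝ (Fin N) → ℝ} (hu : IsBoundedWithValuesIn T J u) :
    IsBoundedField (volume.restrict (timeInterval T)) u :=
  ⟨hu.measurable, hu.bounded⟩

end CheminLerner

/-! ### The two composition estimates -/

theorem proposition5p1 (N : ℕ) (hN : 1 ≤ N)
    (φ₀ : 𝓢(EuclideanSpace ℝ (Fin N), ℝ)) (hφ₀ : IsDyadicGenerator φ₀)
    (s : ℝ) (hs : 0 < s) (p r θ θ₁ θ₂ θ₃ θ₄ : ℝ≥0∞)
    (hp : 1 ≤ p) (hr : 1 ≤ r) (hθ : 1 ≤ θ)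
    (hθ₁ : 1 ≤ θ₁) (hθ₂ : 1 ≤ θ₂) (hθ₃ : 1 ≤ θ₃) (hθ₄ : 1 ≤ θ₄)
    (h₁₂ : θ⁻¹ = θ₁⁻¹ + θ₂⁻¹) (h₃₄ : θ⁻¹ = θ₃⁻¹ + θ₄⁻¹) :
    (∃ C : ℝ≥0, ∀ T : ℝ≥0∞, 0 < T → ∀ (I : Set ℝ) (F : ℝ → ℝ),
      IsAdmissibleNonlinearity (⌊s⌋₊ + 1) I F →
      ∀ J ⊆ I, J.OrdConnected → (0 : ℝ) ∈ J →
      ∀ f g : ℝ → EuclideanSpace ℝ (Fin N) → ℝ,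
        IsBoundedWithValuesIn T J f → IsBoundedWithValuesIn T J g →
        cheminLernerNorm φ₀ T θ s p r (fun t x => F (f t x) - F (g t x)) ≤
          C * (1 + mixedNorm T ∞ ∞ f + mixedNorm T ∞ ∞ g) ^ (⌊s⌋₊ + 1) *
            sobolevInftyNorm (⌊s⌋₊ + 1) (interior J) (deriv (deriv F)) *
            (mixedNorm T θ₁ ∞ (fun t x => f t x - g t x) *
                (⨆ κ ∈ Set.Icc (0 : ℝ) 1,
                  cheminLernerNorm φ₀ T θ₂ s p r (fun t x => g t x + κ * (f t x - g t x))) +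
              cheminLernerNorm φ₀ T θ₄ s p r (fun t x => f t x - g t x) *
                (⨆ κ ∈ Set.Icc (0 : ℝ) 1,
                  mixedNorm T θ₃ ∞ (fun t x => g t x + κ * (f t x - g t x))))) ∧
    ((s < N * (p⁻¹).toReal ∨ (s = N * (p⁻¹).toReal ∧ r = 1)) →
      ∃ C : ℝ≥0, ∀ T : ℝ≥0∞, 0 < T → ∀ (I : Set ℝ) (F : ℝ → ℝ),
      IsAdmissibleNonlinearity (⌊s⌋₊ + 1) I F →
      ∀ J ⊆ I, J.OrdConnected → (0 : ℝ) ∈ J →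
      ∀ f g : ℝ → EuclideanSpace ℝ (Fin N) → ℝ,
        IsBoundedWithValuesIn T J f → IsBoundedWithValuesIn T J g →
        homCheminLernerNorm φ₀ T θ s p r (fun t x => F (f t x) - F (g t x)) ≤
          C * (1 + mixedNorm T ∞ ∞ f + mixedNorm T ∞ ∞ g) ^ (⌊s⌋₊ + 1) *
            sobolevInftyNorm (⌊s⌋₊ + 1) (interior J) (deriv (deriv F)) *
            (mixedNorm T θ₁ ∞ (fun t x => f t x - g t x) *
                (⨆ κ ∈ Set.Icc (0 : ℝ) 1,
                  homCheminLernerNorm φ₀ T θ₂ s p r (fun t x => g t x + κ * (f t x - g t x))) +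
              homCheminLernerNorm φ₀ T θ₄ s p r (fun t x => f t x - g t x) *
                (⨆ κ ∈ Set.Icc (0 : ℝ) 1,
                  mixedNorm T θ₃ ∞ (fun t x => g t x + κ * (f t x - g t x))))) := by

  have hK : s < ((⌊s⌋₊ + 1 : ℕ) : ℝ) := by
    push_cast
    exact Nat.lt_floor_add_one s
  -- The estimate above has the norm of `g` in the first product and that of `f` in the second: they
  -- are the terms `κ = 0` and `κ = 1` of the two suprema.
  have hle : ∀ {a b₁ b₂ c₁ : ℝ≥0∞} {b c : ℝ → ℝ≥0∞} {Q : ℝ≥0∞}, b 0 = b₂ → c 1 = c₁ →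
      Q * (a * b₂ + b₁ * c₁) ≤ Q * (a * (⨆ κ ∈ Set.Icc (0 : ℝ) 1, b κ) +
        b₁ * (⨆ κ ∈ Set.Icc (0 : ℝ) 1, c κ)) := by
    intro a b₁ b₂ c₁ b c Q hb hc
    gcongr
    · exact hb ▸ le_iSup₂ (f := fun κ _ => b κ) (0 : ℝ) (by simp)
    · exact hc ▸ le_iSup₂ (f := fun κ _ => c κ) (1 : ℝ) (by simp)
  refine ⟨?_, fun _ => ?_⟩
  · obtain ⟨C, hC⟩ := hφ₀.isLPPair.inhom.exists_blockNorm_comp_bound hs hK hp hr hθ hθ₁ hθ₂ hθ₃ hθ₄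
      h₁₂ h₃₄
    refine ⟨C, fun T _ I F hF J hJI hJ h0 f g hf hg => ?_⟩
    have h1 := hC (volume.restrict (timeInterval T)) I J F hF hJI hJ h0 f g hf.isBoundedField
      hg.isBoundedField (Measure.ae_ae_of_ae_prod hf.values) (Measure.ae_ae_of_ae_prod hg.values)
    simp_rw [← hφ₀.cheminLernerNorm_eq] at h1
    refine h1.trans (hle ?_ ?_)
    · simp
    · simp [mixedNorm, timeNorm]
  · obtain ⟨C, hC⟩ := hφ₀.isLPPair.hom.exists_blockNorm_comp_bound hs hK hp hr hθ hθ₁ hθ₂ hθ₃ hθ₄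
      h₁₂ h₃₄
    refine ⟨C, fun T _ I F hF J hJI hJ h0 f g hf hg => ?_⟩
    have h1 := hC (volume.restrict (timeInterval T)) I J F hF hJI hJ h0 f g hf.isBoundedField
      hg.isBoundedField (Measure.ae_ae_of_ae_prod hf.values) (Measure.ae_ae_of_ae_prod hg.values)
    simp_rw [← hφ₀.homCheminLernerNorm_eq] at h1
    refine h1.trans (hle ?_ ?_)
    · simp
    · simp [mixedNorm, timeNorm]
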